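/- **Setting.** Let $\psi=(\theta,\eta)\in\Psi\subseteq\mathbb R^{k+q}$ with $\theta\in\mathbb R^k$ the parameter of interest and $\eta\in\mathbb R^q$ a nuisance parameter ($q\ge 0$), and let $f(x\mid\psi)$ be a density on $\mathbb R^p$ with respect to a product of $\sigma$-finite measures. For a dataset $X$ with rows $x_1,\dots,x_N$ put $f(X\mid\psi)=\prod_i f(x_i\mid\psi)$, $u(\psi\mid X)=\partial_\psi\log f(X\mid\psi)$ and $I(\psi\mid X)=-\partial^2_\psi\log f(X\mid\psi)$. Let $\widehat\psi(X)$ (with $\theta$-part $\widehat\theta(X)$) and $\widehat\psi_0(X)$ be maximum likelihood estimators (maximizers whenever a maximizer exists) over $\Psi$ and over $\{\psi\in\Psi:\theta=\theta_0\}$, and $\widehat V(X)$ an estimator of the variance matrix of $\widehat\theta(X)$. Let $d$ be any of the Wald, likelihood ratio and Rao score devices $$(\widehat\theta-\theta_0)^{T}\widehat V^{-1}(\widehat\theta-\theta_0),\qquad 2\log\frac{f(X\mid\widehat\psi)}{f(X\mid\widehat\psi_0)},\qquad u(\widehat\psi_0\mid X)^{T}I(\widehat\psi_0\mid X)^{-1}u(\widehat\psi_0\mid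 X).$$ For every $n$ let $X$ be a dataset of $n$ independent rows with density $f(\cdot\mid\psi^\star_n)$, $\psi^\star_n\in\Psi$, only the part $X_{\rm obs}$ of which is observed, and let $X^1,\dots,X^m$ be random completions of $X_{\rm obs}$. The integrated density gives $f(X_{\rm obs}\mid\psi)$, an observed-data MLE $\widehat\theta_{\rm obs}$ (a function of $X_{\rm obs}$), and $f(X\mid X_{\rm obs},\psi)=f(X\mid\psi)/f(X_{\rm obs}\mid\psi)$. Assume $\psi^\star_n\to\psi^\circ$, and that $\sqrt n A(\theta^\star_n-\theta_0)\to\delta$ for some $\delta$ and some invertible $A$ (local alternatives; $\delta=0$ under the null). Let $J_{\rm com}$ and $J_{\rm mis}$ be the limits of $n^{-1}E\{-\partial_\psi^2\log f(X\mid\psi^\star_n)\}$ and $n^{-1}E\{-\partial_\psi^2\log f(X\mid X_{\rm obs},\psi^\star_n)\}$ (the expectations and limits are assumed to exist), with $J_{\rm com}$ and $J_{\rm com}-J_{\rm mis}$ positive definite. Let $I_{\rm com}$ and $I_{\rm obs}$ be the corresponding informations of $\theta$ per observation, that is, $J_{\theta\theta}-J_{\theta\eta}J_{\eta\eta}^{-1}J_{\eta\theta}$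 for $J=J_{\rm com}$ and for $J=J_{\rm com}-J_{\rm mis}$, and let $I_{\rm mis}=I_{\rm com}-I_{\rm obs}$. Let $f_1\ge\dots\ge f_k$ be the eigenvalues of $I_{\rm mis}I_{\rm com}^{-1}$, and $r_j=f_j/(1-f_j)$ the odds of missing information (OMI). **Conditions.** 1. $\sqrt n(\widehat\theta_{\rm obs}-\theta^\star_n)\Rightarrow N_k(0,I_{\rm obs}^{-1})$. 2. The pairs $(\widehat\theta(X^\ell),\widehat V(X^\ell))$, $\ell=1,\dots,m$, are conditionally independent given $X_{\rm obs}$. The matrix $B=I_{\rm obs}^{-1}-I_{\rm com}^{-1}$ is positive semidefinite and, for each $\ell$, conditionally on $X_{\rm obs}$ (in probability), $\sqrt n(\widehat\theta(X^\ell)-\widehat\theta_{\rm obs})\Rightarrow N_k(0,B)$ and $n\widehat V(X^\ell)\to I_{\rm com}^{-1}$ in probability. 3. For all distinct non-empty $S_1,S_2\subseteq\{1,\dots,m\}$ and all $\tau\in\{1,\dots,k\}$, the statistics $\widehat T_{S_1,S_2}^{2\tau}$ defined below are asymptotically uniformly integrable: $\lim_{C\to\infty}\limsup_{n\to\infty}E[\widehat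 T_{S_1,S_2}^{2\tau}\mathbb 1\{|\widehat T_{S_1,S_2}|>C\}]=0$. 4. (Standard regularity of each completed dataset $X^\ell$.) (a) For some ball $U\subseteq\Psi$ centred at $\psi^\circ$, almost surely, for every row $x$ of $X^\ell$, $f(x\mid\cdot)$ is positive and $\log f(x\mid\cdot)$ is $C^2$ on $U$. (b) For every $\varepsilon>0$ there is $\rho>0$ such that each entry of $n^{-1}I(\psi\mid X^\ell)$ is within $\varepsilon$ of that of $J_{\rm com}$ for all $\psi$ with $\|\psi-\psi^\circ\|<\rho$, with probability tending to $1$. (c) $n^{-1/2}u(\psi_n^\star\mid X^\ell)$ is stochastically bounded. (d) For every $\varepsilon>0$ there is $c>0$ such that, with probability tending to $1$, $f(X^\ell\mid\psi)\le e^{-cn}f(X^\ell\mid\psi^\circ)$ for all $\psi\in\Psi$ with $\|\psi-\psi^\circ\|\ge\varepsilon$. For the Wald device, moreover, $\widehat V$ is a plug-in estimator: with probability tending to $1$, $N\widehat V(X)=\Phi\bigl(N^{-1}\sum_i h(x_i,\widehat\psi(X))\bigr)$ for each fixed stacked dataset $X$ of $X^1,\dots,X^m$, with $N$ rows $x_i$.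 Here $h$ has values in some $\mathbb R^b$; for every $\varepsilon>0$ there is $\rho>0$ such that, for each $\ell$, with probability tending to $1$, the average over the rows of $X^\ell$ of $h(\cdot,\psi)$ is within $\varepsilon$ of a fixed vector $h_0$ for all $\psi$ with $\|\psi-\psi^\circ\|<\rho$; and $\Phi$ is continuous at $h_0$. **Estimators.** For a non-empty multiset $S$ from $\{1,\dots,m\}$ let $X^S$ be the dataset obtained by stacking the $X^\ell$, $\ell\in S$, row by row, and $\widehat d^S=d(X^S)/|S|$. For distinct non-empty sets $S_1,S_2$ let $$\widehat T_{S_1,S_2}=\frac{|S_1|+|S_2|}{|S_1|+|S_2|-2|S_1\cap S_2|}\Bigl\{|S_1|\widehat d^{S_1}+|S_2|\widehat d^{S_2}-(|S_1|+|S_2|)\widehat d^{S_1\oplus S_2}\Bigr\},$$ where $\oplus$ is multiset addition. Let $\Lambda$ be one of $$\Lambda_{\rm Jack}=\{(\{\ell\},\{1,\dots,m\}\setminus\{\ell\})\}_{1\le\ell\le m},\quad \Lambda_{\rm Full}=\{(\{\ell\},\{1,\dots,m\})\}_{1\le\ell\le m},\quad \Lambda_{\rm Pair}=\{(\{\ell\},\{\ell'\})\}_{1\le\ell<\ell'\le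 m},$$ and $\widehat t_\tau=|\Lambda|^{-1}\sum_{(S_1,S_2)\in\Lambda}\widehat T^\tau_{S_1,S_2}$ for $\tau=1,\dots,k$. Put $\widehat R_{1:k}=M_2^{-1}(\widehat t_{1:k})$, where $M_2^{-1}$ maps $t_{1:k}$ to $$R_\tau=\frac{t_\tau}{(\tau-1)!\,2^{\tau-1}}-\sum_{j=1}^{\tau-1}\frac{t_{\tau-j}R_j}{(\tau-j)!\,2^{\tau-j}},\qquad \tau=1,\dots,k,$$ and $\widehat r_{1:k}=M_1^{-1}(\widehat R_{1:k})$, where $M_1^{-1}(R_{1:k})_j$ is the $j$th largest modulus (with multiplicity) of the eigenvalues of $$\left[\begin{array}{c|c}0_{k-1}&I_{k-1}\\ \hline a_1&a_2\ \cdots\ a_k\end{array}\right],\qquad a_k=R_1,\quad a_{k-j+1}=\frac1j\Bigl(R_j-\sum_{i=1}^{j-1}R_i\,a_{k-j+i+1}\Bigr)\quad (2\le j\le k).$$ **Corollary.** For each rule $\Lambda\in\{\Lambda_{\rm Jack},\Lambda_{\rm Full},\Lambda_{\rm Pair}\}$, each $j\in\{1,\dots,k\}$ and given $r_1,\dots,r_k$,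 there is a function $V(m)$ with $V(m)\to0$ as $m\to\infty$ such that, for each of the three devices and every $m\ge2$, under the conditions above, $E(\widehat r_j-r_j)^2$ is finite for all large $n$ and $$\operatorname{MSE}(\widehat r_j)=E(\widehat r_j-r_j)^2\to V(m)\qquad(n\to\infty).$$ -/

import Mathlib

open MeasureTheory ProbabilityTheory Filter Topology
open scoped ENNReal BigOperators Matrix BoundedContinuousFunction

namespace StackedMI

noncomputable section

/-! ### Parameters, rows and datasets -/

/-- A parameter `ψ = (θ, η)` with `θ ∈ ℝ^k` of interest and a nuisance part `η ∈ ℝ^q`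
(`q = 0` is allowed). -/
abbrev Param (k q : ℕ) : Type := EuclideanSpace ℝ (Fin k ⊕ Fin q)

/-- The sub-vector of interest `θ` of `ψ = (θ, η)`. -/
def thetaPart {k q : ℕ} (ψ : Param k q) : EuclideanSpace ℝ (Fin k) :=
  WithLp.toLp 2 fun a => ψ (Sum.inl a)

/-- One row of a dataset with `p` columns. -/
abbrev Row (p : ℕ) : Type := Fin p → ℝ

/-- One row of the observed data: the response pattern (`true` = observed) and the observed
entries (missing entries are blanked by `0`). -/
abbrev ObsRow (p : ℕ) : Type := (Fin p → Bool) × (Fin p → ℝ)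

/-- The observed part of the row `x` under the response pattern `M`. -/
def observe {p : ℕ} (M : Fin p → Bool) (x : Row p) : ObsRow p :=
  (M, fun c => if M c = true then x c else 0)

/-- The parametric model for one row, densities being taken with respect to the product of
`σ`-finite measures `ν c` (for instance Lebesgue or counting measures), with the null value `θ₀`. -/
structure Model (k q p : ℕ) where
  /-- the parameter space -/
  Psi : Set (Param k q)
  /-- the reference measure of each column -/
  ν : Fin p → Measure ℝ
  /-- the density `f(x ∣ ψ)` of one row -/
  f : Param k q → Row p → ℝ
  /-- the null value of `θ` -/
  θ₀ : EuclideanSpace ℝ (Fin k)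
  sigmaFinite_ν : ∀ c, SigmaFinite (ν c)
  measurable_f : ∀ ψ ∈ Psi, Measurable (f ψ)
  nonneg_f : ∀ ψ ∈ Psi, ∀ x, 0 ≤ f ψ x
  lintegral_f : ∀ ψ ∈ Psi, ∫⁻ x, ENNReal.ofReal (f ψ x) ∂(Measure.pi ν) = 1

variable {k q p m : ℕ}

/-- The likelihood `f(X ∣ ψ)` of a dataset (a list of independent rows). -/
def Model.lik (𝓜 : Model k q p) (X : List (Row p)) (ψ : Param k q) : ℝ :=
  (X.map (𝓜.f ψ)).prod

/-- The density of the observed part of a row: the missing coordinates are integrated out. -/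
def Model.obsDensity (𝓜 : Model k q p) (ψ : Param k q) (o : ObsRow p) : ℝ :=
  ∫ y : {c : Fin p // o.1 c = false} → ℝ,
    𝓜.f ψ (fun c => if h : o.1 c = false then y ⟨c, h⟩ else o.2 c)
      ∂(Measure.pi fun c : {c : Fin p // o.1 c = false} => 𝓜.ν c.1)

/-- The observed-data likelihood. -/
def Model.obsLik (𝓜 : Model k q p) (O : List (ObsRow p)) (ψ : Param k q) : ℝ :=
  (O.map (𝓜.obsDensity ψ)).prod

/-- First derivatives of `g` at `ψ`. -/
def grad (g : Param k q → ℝ) (ψ : Param k q) : Fin k ⊕ Fin q → ℝ :=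
  fun a => fderiv ℝ g ψ (EuclideanSpace.single a 1)

/-- Second derivatives of `g` at `ψ`. -/
def hess (g : Param k q → ℝ) (ψ : Param k q) : Matrix (Fin k ⊕ Fin q) (Fin k ⊕ Fin q) ℝ :=
  Matrix.of fun a b =>
    iteratedFDeriv ℝ 2 g ψ ![EuclideanSpace.single a 1, EuclideanSpace.single b 1]

/-- The score `u(ψ ∣ X)`. -/
def Model.score (𝓜 : Model k q p) (X : List (Row p)) (ψ : Param k q) : Fin k ⊕ Fin q → ℝ :=
  grad (fun φ => Real.log (𝓜.lik X φ)) ψ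

/-- The information `I(ψ ∣ X) = - ∂² log f(X ∣ ψ) / ∂ψ ∂ψᵀ`. -/
def Model.info (𝓜 : Model k q p) (X : List (Row p)) (ψ : Param k q) :
    Matrix (Fin k ⊕ Fin q) (Fin k ⊕ Fin q) ℝ :=
  - hess (fun φ => Real.log (𝓜.lik X φ)) ψ

/-- The information in `X_mis` given `X_obs`: `- ∂² log f(X ∣ X_obs, ψ) / ∂ψ ∂ψᵀ`, where
`f(X ∣ X_obs, ψ) = f(X ∣ ψ) / f(X_obs ∣ ψ)`, for a dataset of `n` rows with response patterns. -/
def Model.missInfo (𝓜 : Model k q p) {n : ℕ} (X : Fin n → Row p) (M : Fin n → Fin p → Bool)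
    (ψ : Param k q) : Matrix (Fin k ⊕ Fin q) (Fin k ⊕ Fin q) ℝ :=
  - hess (fun φ => Real.log (𝓜.lik (List.ofFn X) φ /
      𝓜.obsLik (List.ofFn fun i => observe (M i) (X i)) φ)) ψ

/-! ### Maximum likelihood estimators and the three testing devices -/

/-- The functions of a dataset used by the analyst: unrestricted MLE, `H₀`-restricted MLE,
variance estimator of `θ̂`, and the observed-data MLE. -/
structure Estimators (k q p : ℕ) where
  ψhat : List (Row p) → Param k q
  ψhat₀ : List (Row p) → Param k q
  Vhat : List (Row p) → Matrix (Fin k) (Fin k) ℝ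
  ψobs : List (ObsRow p) → Param k q

/-- `ψ` maximizes `L` over `s`. -/
def IsMaximizer (L : Param k q → ℝ) (s : Set (Param k q)) (ψ : Param k q) : Prop :=
  ψ ∈ s ∧ ∀ φ ∈ s, L φ ≤ L ψ

/-- The three estimators of `ψ` are maximum likelihood estimators: each is a maximizer of its
likelihood for every dataset for which a maximizer exists. -/
structure Estimators.AreMLE (𝓔 : Estimators k q p) (𝓜 : Model k q p) : Prop where
  unrestricted : ∀ X, (∃ ψ, IsMaximizer (𝓜.lik X) 𝓜.Psi ψ) →
    IsMaximizer (𝓜.lik X) 𝓜.Psi (𝓔.ψhat X)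
  restricted : ∀ X, (∃ ψ, IsMaximizer (𝓜.lik X) {φ ∈ 𝓜.Psi | thetaPart φ = 𝓜.θ₀} ψ) →
    IsMaximizer (𝓜.lik X) {φ ∈ 𝓜.Psi | thetaPart φ = 𝓜.θ₀} (𝓔.ψhat₀ X)
  observed : ∀ O, (∃ ψ, IsMaximizer (𝓜.obsLik O) 𝓜.Psi ψ) →
    IsMaximizer (𝓜.obsLik O) 𝓜.Psi (𝓔.ψobs O)

/-- The three complete-data tests: Wald, likelihood ratio, Rao score. -/
inductive Test
  | wald
  | lrt
  | score

/-- The complete-data testing device `X ↦ d(X)`. -/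
def device (𝓜 : Model k q p) (𝓔 : Estimators k q p) : Test → List (Row p) → ℝ
  | .wald, X =>
      (thetaPart (𝓔.ψhat X) - 𝓜.θ₀).ofLp ⬝ᵥ
        ((𝓔.Vhat X)⁻¹ *ᵥ (thetaPart (𝓔.ψhat X) - 𝓜.θ₀).ofLp)
  | .lrt, X => 2 * Real.log (𝓜.lik X (𝓔.ψhat X) / 𝓜.lik X (𝓔.ψhat₀ X))
  | .score, X =>
      𝓜.score X (𝓔.ψhat₀ X) ⬝ᵥ ((𝓜.info X (𝓔.ψhat₀ X))⁻¹ *ᵥ 𝓜.score X (𝓔.ψhat₀ X))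

/-! ### Stacking -/

/-- The dataset `X^S` obtained by stacking, row by row, the datasets `D ℓ` for `ℓ` in the
multiset `S`. -/
def stack (D : Fin m → List (Row p)) (S : Multiset (Fin m)) : List (Row p) :=
  (S.sort (· ≤ ·)).flatMap D

/-- `d̂^S = d(X^S) / |S|`. -/
def dHat (d : List (Row p) → ℝ) (D : Fin m → List (Row p)) (S : Multiset (Fin m)) : ℝ :=
  d (stack D S) / (Multiset.card S : ℝ)

/-- The stacked multiple imputation statistic `T̂_{S₁,S₂}`; `S₁.val + S₂.val` is the multiset
`S₁ ⊕ S₂`. -/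
def THat (d : List (Row p) → ℝ) (D : Fin m → List (Row p)) (S₁ S₂ : Finset (Fin m)) : ℝ :=
  ((S₁.card : ℝ) + S₂.card) / ((S₁.card : ℝ) + S₂.card - 2 * (S₁ ∩ S₂).card) *
    (S₁.card * dHat d D S₁.val + S₂.card * dHat d D S₂.val
      - ((S₁.card : ℝ) + S₂.card) * dHat d D (S₁.val + S₂.val))

/-- The three selection rules. -/
inductive SelectionRule
  | jackknife
  | full
  | pair

/-- The set `Λ` of pairs of subsets of `{1, …, m}` attached to a selection rule. -/
def SelectionRule.pairs (m : ℕ) : SelectionRule → Finset (Finset (Fin m) × Finset (Fin m))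
  | .jackknife => Finset.univ.image fun ℓ : Fin m => ({ℓ}, {ℓ}ᶜ)
  | .full => Finset.univ.image fun ℓ : Fin m => ({ℓ}, Finset.univ)
  | .pair => (Finset.univ.filter fun e : Fin m × Fin m => e.1 < e.2).image
      fun e => ({e.1}, {e.2})

/-- `t̂_τ(Λ)`, the average of `T̂_{S₁,S₂}^τ` over `(S₁, S₂) ∈ Λ`. -/
def tHat (d : List (Row p) → ℝ) (D : Fin m → List (Row p))
    (Λ : Finset (Finset (Fin m) × Finset (Fin m))) (τ : ℕ) : ℝ :=
  (Λ.card : ℝ)⁻¹ * ∑ S ∈ Λ, THat d D S.1 S.2 ^ τ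

/-! ### From `t_{1:k}` to `R_{1:k}` to `r_{1:k}` -/

/-- The map `M₂⁻¹ : t_{1:k} ↦ R_{1:k}`:
`R_τ = t_τ / ((τ-1)! 2^(τ-1)) - ∑_{j=1}^{τ-1} t_{τ-j} R_j / ((τ-j)! 2^(τ-j))`
(so `R_1 = t_1`; the value at `τ = 0` is not used). -/
def powerSums (t : ℕ → ℝ) : ℕ → ℝ
  | 0 => 0
  | τ + 1 => t (τ + 1) / ((Nat.factorial τ : ℝ) * 2 ^ τ) -
      ∑ j : Fin τ, t (τ - j) * powerSums t (j + 1) / ((Nat.factorial (τ - j) : ℝ) * 2 ^ (τ - j))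
decreasing_by omega

/-- The numbers `companionCoeff R j = a_{k-j+1}`, `j ≥ 1`, given by
`a_{k-j+1} = (R_j - ∑_{i=1}^{j-1} R_i a_{k-j+i+1}) / j` (so `a_k = R_1`; the value at `0` is not
used). -/
def companionCoeff (R : ℕ → ℝ) : ℕ → ℝ
  | 0 => 0
  | j + 1 => (R (j + 1) - ∑ i : Fin j, R (i + 1) * companionCoeff R (j - i)) / ((j : ℝ) + 1)
decreasing_by omega

/-- The `k × k` matrix `A` with `I_{k-1}` above the diagonal and last row `a_1, …, a_k`. -/
def companion (k : ℕ) (R : ℕ → ℝ) : Matrix (Fin k) (Fin k) ℝ :=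
  Matrix.of fun a b =>
    if (a : ℕ) + 1 = k then companionCoeff R (k - b)
    else if (b : ℕ) = a + 1 then 1 else 0

/-- The map `M₁⁻¹ : R_{1:k} ↦ r_{1:k}`: the moduli of the (complex) eigenvalues of `A`, listed
with multiplicity in decreasing order; `j : Fin k` is counted from `0`. -/
def eigenModulus (k : ℕ) (R : ℕ → ℝ) (j : Fin k) : ℝ :=
  ((((companion k R).map (algebraMap ℝ ℂ)).charpoly.roots.map fun z => ‖z‖).sort (· ≥ ·)).getD j 0

/-- The estimator `r̂_j`, the `j`-th entry of `M₁⁻¹(M₂⁻¹(t̂_{1:k}))`. -/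
def rHat (k : ℕ) (d : List (Row p) → ℝ) (D : Fin m → List (Row p))
    (Λ : Finset (Finset (Fin m) × Finset (Fin m))) (j : Fin k) : ℝ :=
  eigenModulus k (powerSums (tHat d D Λ)) j

/-! ### Incomplete data and their imputations, for every sample size `n` -/

/-- For every `n`: the complete dataset `X` with `n` rows, the response indicators `M`
(`true` = observed), and the `m` completed datasets `Y ℓ`, random and defined on `Ω n`. -/
structure MIData (p m : ℕ) (Ω : ℕ → Type*) [∀ n, MeasurableSpace (Ω n)] where
  X : (n : ℕ) → Ω n → Fin n → Row p
  M : (n : ℕ) → Ω n → Fin n → Fin p → Bool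
  Y : (n : ℕ) → Fin m → Ω n → Fin n → Row p
  measurable_X : ∀ n, Measurable (X n)
  measurable_M : ∀ n, Measurable (M n)
  measurable_Y : ∀ n ℓ, Measurable (Y n ℓ)
  /-- a completed dataset agrees with the complete one where the latter is observed -/
  Y_observed : ∀ n ℓ ω i c, M n ω i c = true → Y n ℓ ω i c = X n ω i c

variable {Ω : ℕ → Type*} [∀ n, MeasurableSpace (Ω n)]

/-- The complete dataset as a list of rows. -/
def MIData.complete (𝓓 : MIData p m Ω) (n : ℕ) (ω : Ω n) : List (Row p) :=
  List.ofFn (𝓓.X n ω)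

/-- The observed data `X_obs`. -/
def MIData.observed (𝓓 : MIData p m Ω) (n : ℕ) (ω : Ω n) : Fin n → ObsRow p :=
  fun i => observe (𝓓.M n ω i) (𝓓.X n ω i)

/-- The completed datasets `X¹, …, X^m`. -/
def MIData.completed (𝓓 : MIData p m Ω) (n : ℕ) (ω : Ω n) (ℓ : Fin m) : List (Row p) :=
  List.ofFn (𝓓.Y n ℓ ω)

/-- The `σ`-algebra generated by `X_obs`. -/
abbrev MIData.sigmaObs (𝓓 : MIData p m Ω) (n : ℕ) : MeasurableSpace (Ω n) :=
  MeasurableSpace.comap (𝓓.observed n) inferInstance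

theorem measurable_observe :
    Measurable fun z : (Fin p → Bool) × Row p => observe z.1 z.2 := by
  refine Measurable.prodMk measurable_fst (measurable_pi_lambda _ fun c => ?_)
  have hc : Measurable fun z : (Fin p → Bool) × Row p => z.1 c :=
    (measurable_pi_apply c).comp measurable_fst
  exact Measurable.ite (hc (measurableSet_singleton true))
    ((measurable_pi_apply c).comp measurable_snd) measurable_const

theorem MIData.measurable_observed (𝓓 : MIData p m Ω) (n : ℕ) : Measurable (𝓓.observed n) := by
  refine measurable_pi_lambda _ fun i => ?_
  have h : Measurable fun ω => (𝓓.M n ω i, 𝓓.X n ω i) :=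
    ((measurable_pi_apply i).comp (𝓓.measurable_M n)).prodMk
      ((measurable_pi_apply i).comp (𝓓.measurable_X n))
  exact measurable_observe.comp h

theorem MIData.sigmaObs_le (𝓓 : MIData p m Ω) (n : ℕ) :
    𝓓.sigmaObs n ≤ (inferInstance : MeasurableSpace (Ω n)) :=
  (𝓓.measurable_observed n).comap_le

/-- The observed-data MLE `θ̂_obs`. -/
def thetaObs (𝓔 : Estimators k q p) (𝓓 : MIData p m Ω) (n : ℕ) (ω : Ω n) :
    EuclideanSpace ℝ (Fin k) :=
  thetaPart (𝓔.ψobs (List.ofFn (𝓓.observed n ω)))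

/-- The imputed statistic `θ̂^ℓ`. -/
def thetaImp (𝓔 : Estimators k q p) (𝓓 : MIData p m Ω) (n : ℕ) (ℓ : Fin m) (ω : Ω n) :
    EuclideanSpace ℝ (Fin k) :=
  thetaPart (𝓔.ψhat (𝓓.completed n ω ℓ))

/-- The imputed statistic `V̂^ℓ`. -/
def VImp (𝓔 : Estimators k q p) (𝓓 : MIData p m Ω) (n : ℕ) (ℓ : Fin m) (ω : Ω n) :
    Fin k → Fin k → ℝ :=
  fun a b => 𝓔.Vhat (𝓓.completed n ω ℓ) a b

/-! ### Fisher information of `θ` and odds of missing information -/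

/-- The Fisher information of `θ` when `J` is the Fisher information of `ψ = (θ, η)`:
`J_θθ - J_θη J_ηη⁻¹ J_ηθ`, the inverse of the `θ`-block of `J⁻¹`.  It is the `θθ`-block of `J`
when there is no nuisance part or when `J_θη = 0`. -/
def thetaInfo (J : Matrix (Fin k ⊕ Fin q) (Fin k ⊕ Fin q) ℝ) : Matrix (Fin k) (Fin k) ℝ :=
  J.toBlocks₁₁ - J.toBlocks₁₂ * J.toBlocks₂₂⁻¹ * J.toBlocks₂₁

/-- `r_1 ≥ ⋯ ≥ r_k` are the odds of missing information: `r_j = f_j / (1 - f_j)`, where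
`f_1 ≥ ⋯ ≥ f_k` are the eigenvalues, with multiplicity, of `F = I_mis I_com⁻¹`, for the Fisher
informations `I_com` and `I_obs = I_com - I_mis` of `θ`. -/
def IsOMI (Icom Iobs : Matrix (Fin k) (Fin k) ℝ) (r : Fin k → ℝ) : Prop :=
  ∃ f : Fin k → ℝ, Antitone f ∧
    ((Icom - Iobs) * Icom⁻¹).charpoly = ∏ j, (Polynomial.X - Polynomial.C (f j)) ∧
    ∀ j, r j = f j / (1 - f j)

/-- The sequence of true parameters `ψstar n`, the limits `Jcom` and `Jmis` of the complete-data and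
missing-data Fisher informations of `ψ` per observation. -/
structure Truth (k q : ℕ) where
  ψstar : ℕ → Param k q
  ψlim : Param k q
  Jcom : Matrix (Fin k ⊕ Fin q) (Fin k ⊕ Fin q) ℝ
  Jmis : Matrix (Fin k ⊕ Fin q) (Fin k ⊕ Fin q) ℝ

/-- The complete-data Fisher information of `θ`, per observation. -/
def Truth.Icom (𝓣 : Truth k q) : Matrix (Fin k) (Fin k) ℝ := thetaInfo 𝓣.Jcom

/-- The observed-data Fisher information of `θ`, per observation. -/
def Truth.Iobs (𝓣 : Truth k q) : Matrix (Fin k) (Fin k) ℝ := thetaInfo (𝓣.Jcom - 𝓣.Jmis)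

/-- The data are generated from the model at `ψstar n`, and `Jcom`, `Jmis` are the limits of the
expected informations divided by `n` (these are constant in `n` if `ψstar` is constant and the
pairs of a row and its response pattern are identically distributed). -/
structure Generated (𝓜 : Model k q p) (𝓣 : Truth k q) (𝓓 : MIData p m Ω)
    (P : ∀ n, Measure (Ω n)) : Prop where
  mem : ∀ n, 𝓣.ψstar n ∈ 𝓜.Psi
  tendsto_ψstar : Tendsto 𝓣.ψstar atTop (𝓝 𝓣.ψlim)
  indep : ∀ n, iIndepFun (fun i ω => 𝓓.X n ω i) (P n)
  law : ∀ n i, (P n).map (fun ω => 𝓓.X n ω i) =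
    (Measure.pi 𝓜.ν).withDensity fun x => ENNReal.ofReal (𝓜.f (𝓣.ψstar n) x)
  integrable_com : ∀ n a b,
    Integrable (fun ω => 𝓜.info (𝓓.complete n ω) (𝓣.ψstar n) a b) (P n)
  integrable_mis : ∀ n a b,
    Integrable (fun ω => 𝓜.missInfo (𝓓.X n ω) (𝓓.M n ω) (𝓣.ψstar n) a b) (P n)
  tendsto_com : ∀ a b, Tendsto (fun n : ℕ =>
    (n : ℝ)⁻¹ * ∫ ω, 𝓜.info (𝓓.complete n ω) (𝓣.ψstar n) a b ∂(P n)) atTop (𝓝 (𝓣.Jcom a b))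
  tendsto_mis : ∀ a b, Tendsto (fun n : ℕ =>
    (n : ℝ)⁻¹ * ∫ ω, 𝓜.missInfo (𝓓.X n ω) (𝓓.M n ω) (𝓣.ψstar n) a b ∂(P n)) atTop
      (𝓝 (𝓣.Jmis a b))
  posDef_com : 𝓣.Jcom.PosDef
  posDef_obs : (𝓣.Jcom - 𝓣.Jmis).PosDef

/-- Local alternatives: `√n A (θ* - θ₀) → δ` for some `δ` and some invertible `A`. -/
def LocalAlternatives (𝓜 : Model k q p) (𝓣 : Truth k q) : Prop :=
  ∃ (A : Matrix (Fin k) (Fin k) ℝ) (δ : Fin k → ℝ), IsUnit A.det ∧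
    Tendsto (fun n : ℕ => √(n : ℝ) • (A *ᵥ (thetaPart (𝓣.ψstar n) - 𝓜.θ₀).ofLp)) atTop (𝓝 δ)

/-! ### Conditions -/

/-- The standard regularity conditions on the likelihood of each single completed dataset `X^ℓ`:
smoothness in a neighbourhood of the parameter, a locally uniform law of large numbers for the
information, a stochastically bounded normalized score, and separation of the maximum. -/
structure Regular (𝓜 : Model k q p) (𝓣 : Truth k q) (𝓓 : MIData p m Ω)
    (P : ∀ n, Measure (Ω n)) : Prop where
  smooth : ∃ ρ > 0, Metric.ball 𝓣.ψlim ρ ⊆ 𝓜.Psi ∧ ∀ n ℓ, ∀ᵐ ω ∂(P n), ∀ i : Fin n,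
    (∀ ψ ∈ Metric.ball 𝓣.ψlim ρ, 0 < 𝓜.f ψ (𝓓.Y n ℓ ω i)) ∧
      ContDiffOn ℝ 2 (fun ψ => Real.log (𝓜.f ψ (𝓓.Y n ℓ ω i))) (Metric.ball 𝓣.ψlim ρ)
  info : ∀ ℓ a b, ∀ ε > 0, ∃ ρ > 0, Tendsto (fun n : ℕ =>
    (P n) {ω | ∃ ψ ∈ Metric.ball 𝓣.ψlim ρ,
      ε ≤ |(n : ℝ)⁻¹ * 𝓜.info (𝓓.completed n ω ℓ) ψ a b - 𝓣.Jcom a b|}) atTop (𝓝 0)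
  score : ∀ ℓ a, ∀ ε : ℝ≥0∞, 0 < ε → ∃ K : ℝ, ∀ᶠ n : ℕ in atTop,
    (P n) {ω | K * √(n : ℝ) < |𝓜.score (𝓓.completed n ω ℓ) (𝓣.ψstar n) a|} ≤ ε
  separated : ∀ ℓ, ∀ ε > 0, ∃ c > 0, Tendsto (fun n : ℕ =>
    (P n) {ω | ∃ ψ ∈ 𝓜.Psi, ε ≤ ‖ψ - 𝓣.ψlim‖ ∧
      Real.exp (-(c * n)) * 𝓜.lik (𝓓.completed n ω ℓ) 𝓣.ψlim < 𝓜.lik (𝓓.completed n ω ℓ) ψ})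
      atTop (𝓝 0)

/-- `V̂` is a plug-in variance estimator: with probability tending to one, a stacked dataset with
`N` rows `x_i` has `N V̂(X) = Φ(N⁻¹ ∑_i h(x_i, ψ̂(X)))`, where `Φ` is continuous at the limit of
the average of `h` over each single completed dataset, this limit being locally uniform.  The
inverse of the observed information (also of the expected information) and the sandwich estimator
are of this form. -/
def PlugInVariance (𝓔 : Estimators k q p) (𝓣 : Truth k q) (𝓓 : MIData p m Ω)
    (P : ∀ n, Measure (Ω n)) : Prop :=
  ∃ (b : ℕ) (h : Row p → Param k q → Fin b → ℝ)
    (Φ : (Fin b → ℝ) → Matrix (Fin k) (Fin k) ℝ) (h₀ : Fin b → ℝ),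
    ContinuousAt Φ h₀ ∧
    (∀ ℓ, ∀ ε > 0, ∃ ρ > 0, Tendsto (fun n : ℕ =>
      (P n) {ω | ∃ ψ ∈ Metric.ball 𝓣.ψlim ρ,
        ε ≤ ‖(n : ℝ)⁻¹ • ((𝓓.completed n ω ℓ).map fun x => h x ψ).sum - h₀‖}) atTop (𝓝 0)) ∧
    ∀ S : Multiset (Fin m), S ≠ 0 → Tendsto (fun n : ℕ =>
      (P n) {ω | ((stack (𝓓.completed n ω) S).length : ℝ) • 𝓔.Vhat (stack (𝓓.completed n ω) S) ≠
        Φ (((stack (𝓓.completed n ω) S).length : ℝ)⁻¹ •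
          ((stack (𝓓.completed n ω) S).map
            fun x => h x (𝓔.ψhat (stack (𝓓.completed n ω) S))).sum)}) atTop (𝓝 0)

/-- The statistics in use are random variables, and `θ̂_obs` is a function of `X_obs`. -/
structure AreStatistics (𝓜 : Model k q p) (𝓔 : Estimators k q p) (𝓓 : MIData p m Ω)
    (test : Test) : Prop where
  thetaObs : ∀ n, Measurable[𝓓.sigmaObs n] (thetaObs 𝓔 𝓓 n)
  thetaImp : ∀ n ℓ, Measurable (thetaImp 𝓔 𝓓 n ℓ)
  VImp : ∀ n ℓ, Measurable (VImp 𝓔 𝓓 n ℓ)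
  device : ∀ (S : Multiset (Fin m)), S ≠ 0 → ∀ n,
    Measurable fun ω => device 𝓜 𝓔 test (stack (𝓓.completed n ω) S)

/-- Asymptotic normality of the observed-data MLE: `√n (θ̂_obs - θ*) ⇒ N(0, I_obs⁻¹)`, with
`I_obs` the information per observation. -/
def ObsNormality (𝓔 : Estimators k q p) (𝓣 : Truth k q) (𝓓 : MIData p m Ω)
    (P : ∀ n, Measure (Ω n)) [∀ n, IsProbabilityMeasure (P n)] : Prop :=
  TendstoInDistribution
    (fun (n : ℕ) ω => √(n : ℝ) • (thetaObs 𝓔 𝓓 n ω - thetaPart (𝓣.ψstar n))) atTop id P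
    (multivariateGaussian 0 𝓣.Iobs⁻¹)

/-- Proper imputation: given `X_obs`, the imputed statistics `(θ̂^ℓ, V̂^ℓ)` are independent,
`√n (θ̂^ℓ - θ̂_obs) ⇒ N(0, B)` with `B = I_obs⁻¹ - I_com⁻¹`, and `n V̂^ℓ → V = I_com⁻¹` in
probability, with all informations per observation.  Conditional weak convergence is convergence
in probability of the conditional expectations of bounded continuous functions. -/
structure ProperImputation (𝓔 : Estimators k q p) (𝓣 : Truth k q) (𝓓 : MIData p m Ω)
    (P : ∀ n, Measure (Ω n)) [∀ n, IsProbabilityMeasure (P n)]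
    [∀ n, StandardBorelSpace (Ω n)] : Prop where
  condIndep : ∀ n, iCondIndepFun (𝓓.sigmaObs n) (𝓓.sigmaObs_le n)
    (fun ℓ ω => (thetaImp 𝓔 𝓓 n ℓ ω, VImp 𝓔 𝓓 n ℓ ω)) (P n)
  posSemidef : (𝓣.Iobs⁻¹ - 𝓣.Icom⁻¹).PosSemidef
  condNormal : ∀ ℓ, ∀ g : EuclideanSpace ℝ (Fin k) →ᵇ ℝ, ∀ ε > 0, Tendsto (fun n : ℕ =>
    (P n) {ω | ε ≤
      |((P n)[fun ω' => g (√(n : ℝ) • (thetaImp 𝓔 𝓓 n ℓ ω' - thetaObs 𝓔 𝓓 n ω')) |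
          𝓓.sigmaObs n]) ω
        - ∫ z, g z ∂(multivariateGaussian 0 (𝓣.Iobs⁻¹ - 𝓣.Icom⁻¹))|}) atTop (𝓝 0)
  condVariance : ∀ ℓ a b, ∀ ε > 0, ∀ ε' > 0, Tendsto (fun n : ℕ =>
    (P n) {ω | ε' ≤
      ((P n)[({ω' | ε ≤ |(n : ℝ) * VImp 𝓔 𝓓 n ℓ ω' a b - 𝓣.Icom⁻¹ a b|}.indicator
          fun _ => (1 : ℝ)) | 𝓓.sigmaObs n]) ω}) atTop (𝓝 0)

/-- Uniform integrability, as `n → ∞`, of `T̂_{S₁,S₂}^{2τ}`, for all non-empty and distinct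
`S₁, S₂` and all `τ ∈ {1, …, k}`. -/
def UniformlyIntegrable (𝓜 : Model k q p) (𝓔 : Estimators k q p) (𝓓 : MIData p m Ω)
    (P : ∀ n, Measure (Ω n)) (test : Test) : Prop :=
  ∀ S₁ S₂ : Finset (Fin m), S₁.Nonempty → S₂.Nonempty → S₁ ≠ S₂ → ∀ τ ∈ Finset.Icc 1 k,
    ∀ ε : ℝ≥0∞, 0 < ε → ∃ C : ℝ, ∀ᶠ n : ℕ in atTop,
      ∫⁻ ω in {ω | C < |THat (device 𝓜 𝓔 test) (𝓓.completed n ω) S₁ S₂|},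
        ENNReal.ofReal (THat (device 𝓜 𝓔 test) (𝓓.completed n ω) S₁ S₂ ^ (2 * τ)) ∂(P n) ≤ ε

end

end StackedMI

namespace StackedMI

noncomputable section

/-! ### The companion matrix and its eigenvalues -/

/-! Fix the number `m` of imputations and put `w_S = √n (θ̂(X^S) - θ₀)`. Near the parameter each
completed dataset has a quadratic log-likelihood with Hessian close to `-n J_com`. Log-likelihoods
add under stacking, so `X^S` has the same kind of expansion with `|S| J_com`. Consequently each of
the three devices satisfies `d(X^S) = |S| w_Sᵀ I_com w_S + o_p(1)` (`tendsto_device`), and `w_S` is,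
up to `o_p(1)`, the mean of the `w_ℓ`, `ℓ ∈ S` (`tendsto_wStack_sub`). In `T̂` the three quadratic
forms combine, by an identity for weighted means (`quadratic_weighted_mean`), into one quadratic
form in the difference of two means. There the common shift `θ̂_obs - θ₀` cancels
(`wMean_sub_wMean`), and with it the local alternative.

By proper imputation the remaining deviations `√n (θ̂^ℓ - θ̂_obs)` converge jointly to independent
`N(0, B)` vectors (`tendsto_integral_of_iCondIndepFun`). The eigenvalues of `I_com B` are the odds
`r_a` (`exists_diagonalization_of_isOMI`). So the `T̂` of all pairs in `Λ` converge jointly to `∑_a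
r_a (∑_l u_S(l) z_l)_a²`, with independent standard Gaussian vectors `z_l` and a unit weight vector
`u_S` for each pair (`limStat`). This limit does not involve the device, and `V(m)` is the mean
squared error of the estimator evaluated at it (`limMSE`).

The passage from convergence in law to convergence of the mean squared error needs domination. The
map `M₁⁻¹ ∘ M₂⁻¹` is weighted homogeneous: `t_τ` has weight `τ` and the result has weight one
(`exists_bound_eigenModulus`). Hence the estimator grows at most linearly in the `T̂`, and uniform
integrability of `T̂²` suffices for every `k` (`sqError_powerMean_le`).

It remains that `V(m) → 0`. Each limit statistic is distributed as `∑ r_a x_a²` with independent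
standard normal `x_a`. Gaussian integration by parts yields a recursion for its moments whose
solution is `M₂⁻¹` (`powerSums_quadMoment`), and Newton's identities turn the power sums into the
polynomial with roots `r_a` (`companionCoeff_sum_pow`): the exact moments return the exact odds. For
each rule the unit weights form a tight frame, so the mean squared correlation of two pairs is `1/(m
- 1)` (`sum_sq_inner_unitWeight`) and the averaged powers converge in mean square to the moments.
Continuity of roots in the coefficients (`continuous_rootModulus`) and the growth bound conclude
(`tendsto_limMSE`).

Convergence in probability is written as convergence along one filter on `Σ n, Ω n` (`probFilter`),
so that deterministic asymptotics apply. Stochastic boundedness is handled by restriction to events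
of large probability (`tendsto_probFilter_of_inf_principal`). -/

/-- The matrix with ones above the diagonal and last row `v`. -/
def lastRowMatrix {K : Type*} [Field K] {k : ℕ} (v : Fin k → K) : Matrix (Fin k) (Fin k) K :=
  Matrix.of fun a b =>
    if (a : ℕ) + 1 = k then v b else if (b : ℕ) = a + 1 then 1 else 0

/-- Expansion along the first column, where only `X` in the first row and `-v 0` in the last row
survive. The first minor is the same matrix for the shifted vector, the second is lower triangular
with `-1` on the diagonal. -/
theorem charpoly_lastRowMatrix {K : Type*} [Field K] {k : ℕ} (v : Fin k → K) :
    (lastRowMatrix v).charpoly =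
      Polynomial.X ^ k - ∑ b, Polynomial.C (v b) * Polynomial.X ^ (b : ℕ) := by
  induction k with
  | zero => simp
  | succ k ih =>
    -- In size one the first row is also the last one, and the two entries of the column would
    -- coincide.
    rcases k with _ | k
    · simp [Matrix.charpoly, Matrix.charmatrix, lastRowMatrix]
    rw [Matrix.charpoly, Matrix.det_succ_column_zero, Fin.sum_univ_succ, Fin.sum_univ_castSucc]
    have hmid : ∀ i : Fin k, (lastRowMatrix v).charmatrix i.castSucc.succ 0 = 0 := by
      intro i
      have h1 : (i : ℕ) ≠ k := i.2.ne
      simp [lastRowMatrix, h1]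
    have hfirst : (lastRowMatrix v).charmatrix 0 0 = Polynomial.X := by
      simp [lastRowMatrix]
    have hlast : (lastRowMatrix v).charmatrix (Fin.last k).succ 0 = - Polynomial.C (v 0) := by
      simp [lastRowMatrix]
    have hsub : (lastRowMatrix v).charmatrix.submatrix (Fin.succAbove 0) Fin.succ =
        (lastRowMatrix fun b => v b.succ).charmatrix := by
      ext1 a b
      simp [Matrix.charmatrix_apply, lastRowMatrix, Matrix.diagonal_apply]
    have htri : ((lastRowMatrix v).charmatrix.submatrix (Fin.last k).succ.succAbove
        Fin.succ).det = (-1) ^ (k + 1) := by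
      rw [Fin.succ_last, Fin.succAbove_last, Matrix.det_of_isLowerTriangular]
      · have h1 : ∀ i : Fin (k + 1), (i : ℕ) ≠ k + 1 := fun i => i.2.ne
        have h2 : ∀ i : Fin (k + 1), i.castSucc ≠ i.succ := fun i => Fin.castSucc_lt_succ.ne
        simp [lastRowMatrix, h1, h2]
      · intro a b hab
        have hab' : (a : ℕ) < b := hab
        have h1 : (a : ℕ) ≠ k + 1 := a.2.ne
        have h2 : a.castSucc ≠ b.succ := by
          intro h
          have := congrArg Fin.val h
          simp at this
          omega
        have h3 : (b : ℕ) ≠ a := by omega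
        simp [lastRowMatrix, h1, h2, h3]
    have h1 := ih fun b => v b.succ
    rw [Matrix.charpoly] at h1
    simp only [hmid, hfirst, hlast, hsub, htri, h1]
    rw [Fin.sum_univ_succ (n := k + 1)]
    simp only [mul_zero, zero_mul, Finset.sum_const_zero, Fin.val_zero, pow_zero, one_mul,
      Fin.val_succ, Fin.val_last, zero_add, mul_one, mul_sub, Finset.mul_sum]
    have h2 : (-1 : Polynomial K) ^ (k + 1) * (-1) ^ (k + 1) = 1 := by
      rw [← mul_pow]; simp
    have h3 : ∀ b : Fin (k + 1), Polynomial.X * (Polynomial.C (v b.succ) * Polynomial.X ^ (b : ℕ))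
        = Polynomial.C (v b.succ) * Polynomial.X ^ ((b : ℕ) + 1) := fun b => by ring
    simp only [h3]
    linear_combination (-Polynomial.C (v 0)) * h2

theorem companion_eq_lastRowMatrix (k : ℕ) (R : ℕ → ℝ) :
    (companion k R).map (algebraMap ℝ ℂ) =
      lastRowMatrix fun b : Fin k => (companionCoeff R (k - b) : ℂ) := by
  ext a b
  simp only [companion, lastRowMatrix, Matrix.map_apply, Matrix.of_apply]
  split_ifs <;> simp

/-! ### Order statistics -/

/-- The `j`-th largest entry of `x`, counted from `0`. -/
def orderStat {k : ℕ} (j : Fin k) (x : Fin k → ℝ) : ℝ :=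
  ((Finset.univ.val.map x).sort (· ≥ ·)).getD j 0

/-- In a decreasing list the entries that are at least `c` form an initial segment, so their number
decides whether position `j`, counted from `0`, belongs to it. All later facts on order statistics
follow by counting, without handling the sort. -/
theorem le_orderStat_iff {k : ℕ} (j : Fin k) (x : Fin k → ℝ) (c : ℝ) :
    c ≤ orderStat j x ↔ (j : ℕ) < (Finset.univ.filter fun i => c ≤ x i).card := by
  set l := (Finset.univ.val.map x).sort (· ≥ ·) with hl
  have hlen : l.length = k := by simp [hl]
  have hcard : (Finset.univ.filter fun i => c ≤ x i).card = l.countP (c ≤ ·) := by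
    rw [← Multiset.coe_countP, hl, Multiset.sort_eq, Multiset.countP_map]
    rfl
  have hsort : l.Pairwise (· ≥ ·) := Multiset.pairwise_sort _ _
  have hj : (j : ℕ) < l.length := j.2.trans_eq hlen.symm
  have hget : orderStat j x = l[(j : ℕ)] := by
    rw [orderStat, ← hl, List.getD_eq_getElem _ _ hj]
  rw [hget, hcard]
  constructor
  · intro h
    have h1 : (l.take (j + 1)).countP (c ≤ ·) = (j : ℕ) + 1 := by
      rw [List.countP_eq_length.2]
      · simp; omega
      · intro a ha
        obtain ⟨i, hi, rfl⟩ := List.mem_iff_getElem.1 ha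
        rw [List.getElem_take]
        have hi' : i ≤ j := by simp at hi; omega
        have : l[(j : ℕ)] ≤ l[i]'(by omega) := by
          rcases hi'.lt_or_eq with h' | h'
          · exact List.pairwise_iff_getElem.1 hsort _ _ _ hj h'
          · simp [h']
        simpa using h.trans this
    have h2 := (List.take_sublist (j + 1 : ℕ) l).countP_le (p := (c ≤ ·))
    omega
  · intro h
    by_contra! hc
    have h1 : l.countP (c ≤ ·) ≤ (l.take j).countP (c ≤ ·) + (l.drop j).countP (c ≤ ·) := by
      rw [← List.countP_append, List.take_append_drop]
    have h2 : (l.drop j).countP (c ≤ ·) = 0 := by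
      rw [List.countP_eq_zero]
      intro a ha
      obtain ⟨i, hi, rfl⟩ := List.mem_iff_getElem.1 ha
      rw [List.getElem_drop]
      have hi2 : (j : ℕ) + i < l.length := by simp at hi; omega
      have : l[(j : ℕ) + i] ≤ l[(j : ℕ)] := by
        rcases Nat.eq_zero_or_pos i with h' | h'
        · simp [h']
        · exact List.pairwise_iff_getElem.1 hsort _ _ hj hi2 (by omega)
      simpa using this.trans_lt hc
    have h3 : (l.take j).countP (c ≤ ·) ≤ j :=
      List.countP_le_length.trans (by simp)
    omega

/-- Lipschitz with constant one for the sup distance: wherever `x` is at least `c`, `y` is at least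
`c - dist x y`. -/
theorem continuous_orderStat {k : ℕ} (j : Fin k) : Continuous (orderStat j) := by
  have key : ∀ x y : Fin k → ℝ, orderStat j x ≤ orderStat j y + dist x y := by
    intro x y
    rw [← sub_le_iff_le_add, le_orderStat_iff]
    refine ((le_orderStat_iff j x _).1 le_rfl).trans_le (Finset.card_le_card ?_)
    intro i hi
    simp only [Finset.mem_filter, Finset.mem_univ, true_and] at hi ⊢
    have := dist_le_pi_dist x y i
    rw [Real.dist_eq] at this
    linarith [(abs_le.1 this).2]
  exact (LipschitzWith.of_le_add key).continuous

theorem orderStat_of_antitone {k : ℕ} (j : Fin k) {x : Fin k → ℝ} (hx : Antitone x) :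
    orderStat j x = x j := by
  apply le_antisymm
  · by_contra! h
    obtain ⟨c, hc1, hc2⟩ := exists_between h
    have h1 := (le_orderStat_iff j x c).1 hc2.le
    have h2 : (Finset.univ.filter fun i => c ≤ x i) ⊆ Finset.Iio j := by
      intro i hi
      simp only [Finset.mem_filter, Finset.mem_univ, true_and, Finset.mem_Iio] at hi ⊢
      by_contra! hij
      linarith [hx hij]
    have h3 := Finset.card_le_card h2
    simp at h3
    omega
  · rw [le_orderStat_iff]
    have h2 : Finset.Iic j ⊆ (Finset.univ.filter fun i => x j ≤ x i) := by
      intro i hi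
      simp only [Finset.mem_filter, Finset.mem_univ, true_and, Finset.mem_Iic] at hi ⊢
      exact hx hi
    have h3 := Finset.card_le_card h2
    simp at h3
    omega

/-! ### Continuity of the roots in the coefficients -/

/-- The coefficients `v` with `∏ (X - z_i) = X^k - ∑ v_b X^b`. -/
def coeffsOfRoots {k : ℕ} (z : Fin k → ℂ) (b : Fin k) : ℂ :=
  - (∏ i, (Polynomial.X - Polynomial.C (z i))).coeff b

theorem prod_X_sub_C_eq {k : ℕ} (z : Fin k → ℂ) :
    ∏ i, (Polynomial.X - Polynomial.C (z i)) = Polynomial.X ^ k -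
      ∑ b : Fin k, Polynomial.C (coeffsOfRoots z b) * Polynomial.X ^ (b : ℕ) := by
  set p := ∏ i, (Polynomial.X - Polynomial.C (z i)) with hp
  have hdeg : p.natDegree = k := by simp [hp]
  have hmon : p.Monic := Polynomial.monic_prod_of_monic _ _ fun i _ => Polynomial.monic_X_sub_C _
  conv_lhs => rw [hmon.as_sum, hdeg]
  simp only [coeffsOfRoots, ← hp, Polynomial.C_neg, neg_mul, Finset.sum_neg_distrib, sub_neg_eq_add]
  rw [Finset.sum_range fun i => Polynomial.C (p.coeff i) * Polynomial.X ^ i]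

/-- Cauchy's bound with weights: the coefficient of `X ^ b` is measured against `l ^ (k - b)`, its
degree in the roots. This makes the bound linear in the scale `l`, which later becomes the linear
growth of the estimator. -/
theorem norm_le_of_root {k : ℕ} {v : Fin k → ℂ} {z : ℂ} {C l : ℝ} (hC : 0 ≤ C) (hl : 0 < l)
    (hv : ∀ b : Fin k, ‖v b‖ ≤ C * l ^ (k - b : ℕ)) (hz : z ^ k = ∑ b, v b * z ^ (b : ℕ)) :
    ‖z‖ ≤ (1 + k * C) * l := by
  by_contra! h
  have hlz : l ≤ ‖z‖ := by nlinarith [mul_nonneg (mul_nonneg (Nat.cast_nonneg (α := ℝ) k) hC) hl.le]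
  have hz0 : 0 < ‖z‖ := hl.trans_le hlz
  rcases Nat.eq_zero_or_pos k with rfl | hk
  · simp at hz
  have h1 : ‖z‖ ^ k ≤ ∑ b : Fin k, C * l * ‖z‖ ^ (k - 1) := by
    rw [← norm_pow, hz]
    refine norm_sum_le_of_le _ fun b _ => ?_
    rw [norm_mul, norm_pow]
    have hb := b.2
    calc ‖v b‖ * ‖z‖ ^ (b : ℕ) ≤ C * l ^ (k - b : ℕ) * ‖z‖ ^ (b : ℕ) := by gcongr; exact hv b
      _ = C * l * (l ^ (k - b - 1 : ℕ) * ‖z‖ ^ (b : ℕ)) := by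
          rw [show (k - b : ℕ) = (k - b - 1) + 1 by omega, pow_succ]; simp; ring
      _ ≤ C * l * (‖z‖ ^ (k - b - 1 : ℕ) * ‖z‖ ^ (b : ℕ)) := by gcongr
      _ = C * l * ‖z‖ ^ (k - 1) := by rw [← pow_add]; congr 2; omega
  rw [Finset.sum_const, Finset.card_univ, Fintype.card_fin, nsmul_eq_mul] at h1
  have h2 : ‖z‖ ^ k = ‖z‖ * ‖z‖ ^ (k - 1) := by rw [← pow_succ']; congr 1; omega
  have h3 : ‖z‖ ≤ k * (C * l) := by
    have := pow_pos hz0 (k - 1)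
    rw [h2] at h1
    nlinarith
  nlinarith

theorem pow_eq_sum_coeffsOfRoots {k : ℕ} (z : Fin k → ℂ) (i : Fin k) :
    z i ^ k = ∑ b, coeffsOfRoots z b * z i ^ (b : ℕ) := by
  have h := congrArg (Polynomial.eval (z i)) (prod_X_sub_C_eq z)
  rw [Polynomial.eval_prod, Finset.prod_eq_zero (Finset.mem_univ i) (by simp)] at h
  simp only [Polynomial.eval_sub, Polynomial.eval_pow, Polynomial.eval_X,
    Polynomial.eval_finsetSum, Polynomial.eval_mul, Polynomial.eval_C] at h
  exact (sub_eq_zero.1 h.symm)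

theorem continuous_coeffsOfRoots {k : ℕ} : Continuous (coeffsOfRoots (k := k)) := by
  refine continuous_pi fun b => ?_
  have h : ∀ z : Fin k → ℂ, coeffsOfRoots z b = -((-1) ^ (k - b : ℕ) *
      ((Finset.univ.val.map z).esymm (k - b))) := by
    intro z
    have := Multiset.prod_X_sub_C_coeff (Finset.univ.val.map z) (k := b) (by simp [b.2.le])
    simp only [Multiset.map_map, Multiset.card_map, Finset.card_val, Finset.card_univ,
      Fintype.card_fin] at this
    rw [coeffsOfRoots, ← this]
    rfl
  simp only [h, ← MvPolynomial.aeval_esymm_eq_multiset_esymm (Fin k) ℂ]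
  refine (continuous_const.mul ?_).neg
  simp only [MvPolynomial.esymm, map_sum, map_prod, MvPolynomial.aeval_X]
  fun_prop

theorem surjective_coeffsOfRoots {k : ℕ} : Function.Surjective (coeffsOfRoots (k := k)) := by
  intro v
  set p : Polynomial ℂ := (lastRowMatrix v).charpoly with hp
  have hmon : p.Monic := Matrix.charpoly_monic _
  have hdeg : p.natDegree = k := by rw [hp, Matrix.charpoly_natDegree_eq_dim, Fintype.card_fin]
  have hcard : p.roots.card = k := by
    rw [← hdeg]; exact (Polynomial.splits_iff_card_roots.1 (IsAlgClosed.splits p))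
  obtain ⟨l, hl⟩ := Quot.exists_rep p.roots
  have hlen : l.length = k := by rw [← hcard, ← hl]; rfl
  subst hlen
  refine ⟨l.get, ?_⟩
  have hprod : ∏ i, (Polynomial.X - Polynomial.C (l.get i)) = p := by
    rw [← Polynomial.prod_multiset_X_sub_C_of_monic_of_roots_card_eq hmon (by rw [hcard, hdeg]),
      ← hl, ← List.prod_ofFn]
    rw [show (fun i => Polynomial.X - Polynomial.C (l.get i)) =
      (fun a => Polynomial.X - Polynomial.C a) ∘ l.get from rfl, ← List.map_ofFn, List.ofFn_get]
    rfl
  funext b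
  rw [coeffsOfRoots, hprod, hp, charpoly_lastRowMatrix]
  simp only [Polynomial.coeff_sub, Polynomial.coeff_X_pow, Polynomial.finsetSum_coeff,
    Polynomial.coeff_C_mul]
  rw [Finset.sum_eq_single b]
  · simp [b.2.ne]
  · intro c _ hc
    have : (b : ℕ) ≠ c := fun h => hc (Fin.ext h.symm)
    simp [this]
  · simp

/-- The map from roots to coefficients is continuous, onto, and proper, since Cauchy's bound
confines the roots of a bounded family of polynomials. It is thus closed and a quotient map. A
function of the coefficients is continuous as soon as it is continuous in the roots, and no
continuous choice of roots is needed. -/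
theorem isQuotientMap_coeffsOfRoots {k : ℕ} : IsQuotientMap (coeffsOfRoots (k := k)) := by
  have hproper : IsProperMap (coeffsOfRoots (k := k)) := by
    rw [isProperMap_iff_isCompact_preimage]
    refine ⟨continuous_coeffsOfRoots, fun K hK => ?_⟩
    obtain ⟨C, hC⟩ := hK.isBounded.exists_norm_le
    refine Metric.isCompact_of_isClosed_isBounded
      (hK.isClosed.preimage continuous_coeffsOfRoots) ?_
    rw [isBounded_iff_forall_norm_le]
    refine ⟨1 + k * max C 0, fun z hz => ?_⟩
    rw [pi_norm_le_iff_of_nonneg (by positivity)]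
    intro i
    have := norm_le_of_root (C := max C 0) (l := 1) (le_max_right _ _) one_pos
      (fun b => by
        have h1 := (norm_le_pi_norm (coeffsOfRoots z) b).trans (hC _ hz)
        simpa using Or.inl h1) (pow_eq_sum_coeffsOfRoots z i)
    simpa using this
  exact hproper.isClosedMap.isQuotientMap continuous_coeffsOfRoots surjective_coeffsOfRoots

/-- The `j`-th largest modulus of the roots of `X^k - ∑ v_b X^b`. -/
def rootModulus {k : ℕ} (j : Fin k) (v : Fin k → ℂ) : ℝ :=
  (((lastRowMatrix v).charpoly.roots.map fun z => ‖z‖).sort (· ≥ ·)).getD j 0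

theorem rootModulus_coeffsOfRoots {k : ℕ} (j : Fin k) (z : Fin k → ℂ) :
    rootModulus j (coeffsOfRoots z) = orderStat j fun i => ‖z i‖ := by
  have h : (lastRowMatrix (coeffsOfRoots z)).charpoly.roots = Finset.univ.val.map z := by
    rw [charpoly_lastRowMatrix, ← prod_X_sub_C_eq,
      show ∏ i, (Polynomial.X - Polynomial.C (z i)) =
        ((Finset.univ.val.map z).map fun a => Polynomial.X - Polynomial.C a).prod by
          rw [Multiset.map_map]; rfl, Polynomial.roots_multiset_prod_X_sub_C]
  rw [rootModulus, h, Multiset.map_map, orderStat]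
  rfl

theorem continuous_rootModulus {k : ℕ} (j : Fin k) : Continuous (rootModulus j) := by
  rw [isQuotientMap_coeffsOfRoots.continuous_iff]
  have : rootModulus j ∘ coeffsOfRoots = fun z : Fin k → ℂ => orderStat j fun i => ‖z i‖ :=
    funext fun z => rootModulus_coeffsOfRoots j z
  rw [this]
  exact (continuous_orderStat j).comp (by fun_prop)

theorem eigenModulus_eq_rootModulus (k : ℕ) (R : ℕ → ℝ) (j : Fin k) :
    eigenModulus k R j = rootModulus j fun b : Fin k => (companionCoeff R (k - b) : ℂ) := by
  rw [eigenModulus, rootModulus, companion_eq_lastRowMatrix]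

theorem abs_orderStat_le {k : ℕ} (j : Fin k) {x : Fin k → ℝ} {c : ℝ} (hx : ∀ i, |x i| ≤ c) :
    |orderStat j x| ≤ c := by
  rw [abs_le]
  constructor
  · rw [le_orderStat_iff, Finset.filter_true_of_mem fun i _ => (abs_le.1 (hx i)).1]
    simp
  · by_contra! h
    obtain ⟨d, hd1, hd2⟩ := exists_between h
    have h1 := (le_orderStat_iff j x d).1 hd2.le
    rw [Finset.filter_false_of_mem fun i _ => not_le.2 (((abs_le.1 (hx i)).2).trans_lt hd1)] at h1
    simp at h1

theorem abs_rootModulus_le {k : ℕ} (j : Fin k) {v : Fin k → ℂ} {C l : ℝ} (hC : 0 ≤ C)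
    (hl : 0 < l) (hv : ∀ b : Fin k, ‖v b‖ ≤ C * l ^ (k - b : ℕ)) :
    |rootModulus j v| ≤ (1 + k * C) * l := by
  obtain ⟨z, rfl⟩ := surjective_coeffsOfRoots v
  rw [rootModulus_coeffsOfRoots]
  refine abs_orderStat_le j fun i => ?_
  rw [abs_norm]
  exact norm_le_of_root hC hl hv (pow_eq_sum_coeffsOfRoots z i)


/-! ### Continuity, growth and values of the maps `M₂⁻¹` and `M₁⁻¹` -/

theorem continuous_powerSums (τ : ℕ) : Continuous fun t : ℕ → ℝ => powerSums t τ := by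
  induction τ using Nat.strong_induction_on with
  | _ τ ih =>
    rcases τ with _ | τ
    · simp only [powerSums]; exact continuous_const
    · rw [show (fun t : ℕ → ℝ => powerSums t (τ + 1)) = fun t =>
          t (τ + 1) / ((Nat.factorial τ : ℝ) * 2 ^ τ) - ∑ j : Fin τ,
            t (τ - j) * powerSums t (j + 1) / ((Nat.factorial (τ - j) : ℝ) * 2 ^ (τ - j)) from
        funext fun t => by rw [powerSums]]
      refine ((continuous_apply _).div_const _).sub (continuous_finsetSum _ fun j _ => ?_)
      exact (((continuous_apply _).mul (ih _ (by omega))).div_const _)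

theorem continuous_companionCoeff (i : ℕ) : Continuous fun R : ℕ → ℝ => companionCoeff R i := by
  induction i using Nat.strong_induction_on with
  | _ i ih =>
    rcases i with _ | i
    · simp only [companionCoeff]; exact continuous_const
    · rw [show (fun R : ℕ → ℝ => companionCoeff R (i + 1)) = fun R =>
          (R (i + 1) - ∑ j : Fin i, R (j + 1) * companionCoeff R (i - j)) / ((i : ℝ) + 1) from
        funext fun R => by rw [companionCoeff]]
      refine ((continuous_apply _).sub (continuous_finsetSum _ fun j _ => ?_)).div_const _
      exact (continuous_apply _).mul (ih _ (by omega))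

theorem continuous_eigenModulus_powerSums {k : ℕ} (j : Fin k) :
    Continuous fun t : ℕ → ℝ => eigenModulus k (powerSums t) j := by
  simp only [eigenModulus_eq_rootModulus]
  refine (continuous_rootModulus j).comp (continuous_pi fun b => ?_)
  exact Complex.continuous_ofReal.comp
    ((continuous_companionCoeff _).comp (continuous_pi fun τ => continuous_powerSums τ))

/-- The recursion is weighted homogeneous: with `t i` of weight `i`, every term has weight `τ`. The
denominators are at least one and are dropped. -/
theorem exists_bound_powerSums (k τ : ℕ) (hτ : τ ≤ k) : ∃ C : ℝ, 0 ≤ C ∧ ∀ (t : ℕ → ℝ) (l : ℝ), 0 < l →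
    (∀ i, 1 ≤ i → i ≤ k → |t i| ≤ l ^ i) → |powerSums t τ| ≤ C * l ^ τ := by
  induction τ using Nat.strong_induction_on with
  | _ τ ih =>
    rcases τ with _ | τ
    · exact ⟨0, le_rfl, fun t l _ _ => by simp [powerSums]⟩
    · choose! C hC0 hC using fun i (hi : i < τ + 1) => ih i hi (by omega)
      refine ⟨1 + ∑ j : Fin τ, C (j + 1),
        add_nonneg zero_le_one (Finset.sum_nonneg fun j _ => hC0 _ (by omega)),
        fun t l hl ht => ?_⟩
      have hden : ∀ i : ℕ, (1 : ℝ) ≤ (Nat.factorial i : ℝ) * 2 ^ i := fun i =>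
        one_le_mul_of_one_le_of_one_le (Nat.one_le_cast.2 (Nat.factorial_pos i))
          (one_le_pow₀ (by norm_num))
      have habs : ∀ (x : ℝ) (i : ℕ), |x / ((Nat.factorial i : ℝ) * 2 ^ i)| ≤ |x| := by
        intro x i
        rw [abs_div, abs_of_pos (zero_lt_one.trans_le (hden i))]
        exact div_le_self (abs_nonneg _) (hden i)
      rw [powerSums, add_mul, one_mul, Finset.sum_mul]
      refine (abs_sub _ _).trans (add_le_add ((habs _ _).trans (ht _ (by omega) hτ))
        ((Finset.abs_sum_le_sum_abs _ _).trans (Finset.sum_le_sum fun j _ => ?_)))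
      refine (habs _ _).trans ?_
      have hj := j.2
      rw [abs_mul]
      calc |t (τ - j)| * |powerSums t (j + 1)| ≤ l ^ (τ - j : ℕ) * (C (j + 1) * l ^ ((j : ℕ) + 1)) :=
            mul_le_mul (ht _ (by omega) (by omega)) (hC _ (by omega) t l hl ht) (abs_nonneg _)
              (by positivity)
        _ = C (j + 1) * l ^ (τ + 1) := by
            rw [show τ + 1 = (τ - j) + (j + 1) by omega, pow_add l]; ring

theorem exists_bound_companionCoeff (k i : ℕ) (hi : i ≤ k) : ∃ C : ℝ, 0 ≤ C ∧ ∀ (t : ℕ → ℝ) (l : ℝ),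
    0 < l → (∀ i, 1 ≤ i → i ≤ k → |t i| ≤ l ^ i) →
      |companionCoeff (powerSums t) i| ≤ C * l ^ i := by
  choose! D hD0 hD using exists_bound_powerSums k
  induction i using Nat.strong_induction_on with
  | _ i ih =>
    rcases i with _ | i
    · exact ⟨0, le_rfl, fun t l _ _ => by simp [companionCoeff]⟩
    · choose! C hC0 hC using fun j (hj : j < i + 1) => ih j hj (by omega)
      refine ⟨D (i + 1) + ∑ j : Fin i, D (j + 1) * C (i - j),
        add_nonneg (hD0 _ hi) (Finset.sum_nonneg fun j _ =>
          mul_nonneg (hD0 _ (by omega)) (hC0 _ (by omega))), fun t l hl ht => ?_⟩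
      have h1 : (1 : ℝ) ≤ (i : ℝ) + 1 := by linarith [Nat.cast_nonneg (α := ℝ) i]
      rw [companionCoeff, abs_div, abs_of_pos (zero_lt_one.trans_le h1)]
      refine (div_le_self (abs_nonneg _) h1).trans ?_
      rw [add_mul, Finset.sum_mul]
      refine (abs_sub _ _).trans (add_le_add (hD _ hi t l hl ht)
        ((Finset.abs_sum_le_sum_abs _ _).trans (Finset.sum_le_sum fun j _ => ?_)))
      have hj := j.2
      rw [abs_mul]
      calc |powerSums t (j + 1)| * |companionCoeff (powerSums t) (i - j)|
          ≤ (D (j + 1) * l ^ ((j : ℕ) + 1)) * (C (i - j) * l ^ (i - j : ℕ)) :=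
            mul_le_mul (hD _ (by omega) t l hl ht) (hC _ (by omega) t l hl ht) (abs_nonneg _)
              (mul_nonneg (hD0 _ (by omega)) (by positivity))
        _ = D (j + 1) * C (i - j) * l ^ (i + 1) := by
            rw [show i + 1 = (j + 1) + (i - j) by omega, pow_add l]; ring

/-- The coefficient of `X ^ b` has weight `k - b` in `t`, so the roots have weight one. This linear
growth is the reason why second moments of the stacked statistics control the mean squared error for
every `k`. -/
theorem exists_bound_eigenModulus {k : ℕ} (j : Fin k) : ∃ C : ℝ, 0 ≤ C ∧ ∀ (t : ℕ → ℝ) (l : ℝ),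
    0 < l → (∀ i, 1 ≤ i → i ≤ k → |t i| ≤ l ^ i) →
      |eigenModulus k (powerSums t) j| ≤ C * l := by
  choose! C hC0 hC using exists_bound_companionCoeff k
  have hsum : 0 ≤ ∑ b : Fin k, C (k - b) := Finset.sum_nonneg fun b _ => hC0 _ (by omega)
  refine ⟨1 + k * ∑ b : Fin k, C (k - b), by positivity, fun t l hl ht => ?_⟩
  rw [eigenModulus_eq_rootModulus]
  refine abs_rootModulus_le j hsum hl fun b => ?_
  rw [Complex.norm_real]
  refine (hC _ (by omega) t l hl ht).trans ?_
  gcongr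
  exact Finset.single_le_sum (f := fun b : Fin k => C (k - b)) (fun b _ => hC0 _ (by omega))
    (Finset.mem_univ b)

/-- Newton's identities: signed elementary symmetric functions satisfy the recursion that defines
`companionCoeff`. -/
theorem companionCoeff_sum_pow {k : ℕ} (r : Fin k → ℝ) (i : ℕ) (hi : 1 ≤ i) :
    companionCoeff (fun τ => ∑ a, r a ^ τ) i =
      (-1) ^ (i + 1) * (Finset.univ.val.map r).esymm i := by
  induction i using Nat.strong_induction_on with
  | _ i ih =>
    obtain ⟨i, rfl⟩ : ∃ j, i = j + 1 := ⟨i - 1, by omega⟩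
    have hN := congrArg (MvPolynomial.aeval r) (MvPolynomial.mul_esymm_eq_sum (Fin k) ℝ (i + 1))
    simp only [map_mul, map_natCast, map_pow, map_neg, map_one, map_sum,
      MvPolynomial.aeval_esymm_eq_multiset_esymm, MvPolynomial.psum, MvPolynomial.aeval_X] at hN
    -- The last index of the antidiagonal is excluded from Newton's identity, the index `0`
    -- contributes the power sum of order `i + 1`, and the rest, reversed, is the sum in
    -- `companionCoeff`.
    rw [Finset.sum_filter, Finset.Nat.sum_antidiagonal_eq_sum_range_succ_mk,
      Finset.sum_range_succ, if_neg (lt_irrefl _), add_zero, Finset.sum_range_succ',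
      ← Finset.sum_range_reflect] at hN
    have hi0 : ((i : ℝ) + 1) ≠ 0 := by positivity
    rw [companionCoeff, div_eq_iff hi0]
    have hsum : ∑ j ∈ Finset.range i, (if i - 1 - j + 1 < i + 1 then
          (-1 : ℝ) ^ (i - 1 - j + 1) * (Multiset.map r Finset.univ.val).esymm (i - 1 - j + 1) *
            ∑ a, r a ^ (i + 1 - (i - 1 - j + 1)) else 0) =
        - ∑ j : Fin i, (∑ a, r a ^ ((j : ℕ) + 1)) *
          companionCoeff (fun τ => ∑ a, r a ^ τ) (i - j) := by
      rw [Finset.sum_range, ← Finset.sum_neg_distrib]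
      refine Finset.sum_congr rfl fun j _ => ?_
      have hj := j.2
      rw [ih _ (by omega) (by omega), if_pos (by omega), show i - 1 - j + 1 = i - j by omega,
        show i + 1 - (i - j) = j + 1 by omega, pow_succ]
      ring
    rw [hsum] at hN
    push_cast at hN
    simp only [Nat.succ_pos, ↓reduceIte, pow_zero, one_mul] at hN
    have he0 : (Multiset.map r Finset.univ.val).esymm 0 = 1 := by simp [Multiset.esymm]
    have hsq : (-1 : ℝ) ^ (i + 1 + 1) * (-1) ^ (i + 1 + 1) = 1 := by rw [← mul_pow]; simp
    rw [he0] at hN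
    linear_combination (-(-1 : ℝ) ^ (i + 1 + 1)) * hN -
      (∑ a, r a ^ (i + 1) - ∑ j : Fin i, (∑ a, r a ^ ((j : ℕ) + 1)) *
          companionCoeff (fun τ => ∑ a, r a ^ τ) (i - j)) * hsq

/-- The companion polynomial of the power sums is `∏ (X - r_a)`. Nonnegativity makes the moduli
harmless, and monotonicity the sort. -/
theorem eigenModulus_sum_pow {k : ℕ} (j : Fin k) {r : Fin k → ℝ} (hr : Antitone r)
    (h0 : ∀ a, 0 ≤ r a) : eigenModulus k (fun τ => ∑ a, r a ^ τ) j = r j := by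
  have h : (fun b : Fin k => (companionCoeff (fun τ => ∑ a, r a ^ τ) (k - b) : ℂ)) =
      coeffsOfRoots fun a => (r a : ℂ) := by
    funext b
    have hb := b.2
    have h1 := Multiset.prod_X_sub_C_coeff (Finset.univ.val.map r) (k := b) (by simp [hb.le])
    have h2 : ∏ a, (Polynomial.X - Polynomial.C (r a : ℂ)) =
        (∏ a, (Polynomial.X - Polynomial.C (r a))).map (algebraMap ℝ ℂ) := by
      rw [Polynomial.map_prod]
      simp
    rw [coeffsOfRoots, h2, Polynomial.coeff_map, companionCoeff_sum_pow r _ (by omega)]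
    simp only [Multiset.map_map, Multiset.card_map, Finset.card_val, Finset.card_univ,
      Fintype.card_fin] at h1
    rw [show (∏ a, (Polynomial.X - Polynomial.C (r a))) =
      (Multiset.map ((fun t => Polynomial.X - Polynomial.C t) ∘ r) Finset.univ.val).prod from rfl, h1]
    simp [pow_succ]
  rw [eigenModulus_eq_rootModulus, h, rootModulus_coeffsOfRoots]
  simp only [Complex.norm_real, Real.norm_eq_abs, abs_of_nonneg (h0 _)]
  exact orderStat_of_antitone j hr


/-! ### Gaussian quadratic statistics -/

theorem integrable_of_polynomial_growth {E : Type*} [NormedAddCommGroup E] [NormedSpace ℝ E]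
    [CompleteSpace E] [SecondCountableTopology E] [MeasurableSpace E] [BorelSpace E]
    (μ : Measure E) [IsGaussian μ] {f : E → ℝ} (hf : Continuous f) {C : ℝ} {n : ℕ}
    (h : ∀ x, |f x| ≤ C * (1 + ‖x‖) ^ n) : Integrable f μ := by
  have h0 : MemLp (fun x : E => ‖x‖) n μ := (IsGaussian.memLp_id μ n (by simp)).norm
  have h1 : MemLp (fun x : E => 1 + ‖x‖) n μ := (memLp_const (1 : ℝ)).add h0
  have h2 : Integrable (fun x : E => C * (1 + ‖x‖) ^ n) μ := by
    refine Integrable.const_mul ?_ C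
    have := h1.integrable_norm_pow'
    refine this.congr (ae_of_all _ fun x => ?_)
    simp only [Real.norm_eq_abs]
    rw [abs_of_nonneg (by positivity)]
  exact h2.mono' hf.aestronglyMeasurable (ae_of_all _ h)

/-- The quadratic form `∑ r_a x_a²`. -/
def quadForm {k : ℕ} (r : Fin k → ℝ) (x : EuclideanSpace ℝ (Fin k)) : ℝ :=
  ∑ a, r a * x a ^ 2

theorem continuous_quadForm {k : ℕ} (r : Fin k → ℝ) : Continuous (quadForm r) := by
  unfold quadForm
  fun_prop

theorem abs_quadForm_le {k : ℕ} (r : Fin k → ℝ) (x : EuclideanSpace ℝ (Fin k)) :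
    |quadForm r x| ≤ (∑ a, |r a|) * ‖x‖ ^ 2 := by
  rw [quadForm, Finset.sum_mul]
  refine (Finset.abs_sum_le_sum_abs _ _).trans (Finset.sum_le_sum fun a _ => ?_)
  rw [abs_mul, abs_of_nonneg (sq_nonneg (x a))]
  have h : x a ^ 2 ≤ ‖x‖ ^ 2 := sq_le_sq.2 (by rw [abs_norm]; exact PiLp.norm_apply_le x a)
  exact mul_le_mul_of_nonneg_left h (abs_nonneg _)

/-- The law of `m` independent standard Gaussian vectors in `ℝ^k`. -/
abbrev stdGaussians (ι : Type*) [Fintype ι] (k : ℕ) : Measure (ι → EuclideanSpace ℝ (Fin k)) :=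
  Measure.pi fun _ => stdGaussian (EuclideanSpace ℝ (Fin k))

theorem integral_exp_inner_stdGaussians {ι : Type*} [Fintype ι] {k : ℕ}
    (u : ι → EuclideanSpace ℝ (Fin k)) :
    ∫ z, Complex.exp (((∑ i, inner ℝ (z i) (u i) : ℝ) : ℂ) * Complex.I) ∂(stdGaussians ι k) =
      Complex.exp (-((∑ i, ‖u i‖ ^ 2 : ℝ) : ℂ) / 2) := by
  simp_rw [Complex.ofReal_sum, Finset.sum_mul, Complex.exp_sum]
  rw [integral_fintype_prod_eq_prod
    (f := fun i x => Complex.exp ((inner ℝ x (u i) : ℝ) * Complex.I))]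
  simp_rw [← charFun_apply, charFun_stdGaussian, ← Complex.exp_sum]
  simp [neg_div, Finset.sum_div]

theorem sum_norm_sq_add {ι : Type*} [Fintype ι] {k : ℕ} (a b : ι → ℝ)
    (s t : EuclideanSpace ℝ (Fin k)) : ∑ i, ‖a i • s + b i • t‖ ^ 2 =
      (∑ i, a i ^ 2) * ‖s‖ ^ 2 + 2 * (∑ i, a i * b i) * inner ℝ s t +
        (∑ i, b i ^ 2) * ‖t‖ ^ 2 := by
  simp only [Finset.mul_sum, Finset.sum_mul, ← Finset.sum_add_distrib]
  refine Finset.sum_congr rfl fun i _ => ?_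
  rw [norm_add_sq_real, norm_smul, norm_smul, real_inner_smul_left, real_inner_smul_right, mul_pow,
    mul_pow, Real.norm_eq_abs, Real.norm_eq_abs, sq_abs, sq_abs]
  ring

theorem charFunDual_map_pair_stdGaussians {ι : Type*} [Fintype ι] {k : ℕ} (a b : ι → ℝ)
    (L : StrongDual ℝ (EuclideanSpace ℝ (Fin k) × EuclideanSpace ℝ (Fin k)))
    {s t : EuclideanSpace ℝ (Fin k)} (hs : ∀ x, inner ℝ x s = L (x, 0))
    (ht : ∀ x, inner ℝ x t = L (0, x)) :
    charFunDual ((stdGaussians ι k).map (fun z => (∑ i, a i • z i, ∑ i, b i • z i))) L =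
      Complex.exp (-(((∑ i, a i ^ 2) * ‖s‖ ^ 2 + 2 * (∑ i, a i * b i) * inner ℝ s t +
        (∑ i, b i ^ 2) * ‖t‖ ^ 2 : ℝ) : ℂ) / 2) := by
  rw [← sum_norm_sq_add, ← integral_exp_inner_stdGaussians, charFunDual_apply,
    integral_map (Measurable.aemeasurable (by fun_prop))
      (Continuous.aestronglyMeasurable (by fun_prop))]
  refine integral_congr_ae (ae_of_all _ fun z => ?_)
  dsimp only
  congr 3
  rw [← L.comp_inl_add_comp_inr]
  simp only [inner_add_right, real_inner_smul_right, Finset.sum_add_distrib, hs, ht, map_sum,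
    map_smul, smul_eq_mul]
  rfl

/-- Two linear combinations of independent standard Gaussian vectors are jointly Gaussian and
centred, so their law depends only on the Gram matrix of `a` and `b`. This reduces computations with
`m` vectors to two vectors. -/
theorem map_pair_stdGaussians_congr {ι κ : Type*} [Fintype ι] [Fintype κ] {k : ℕ}
    {a b : ι → ℝ} {a' b' : κ → ℝ} (haa : ∑ i, a i ^ 2 = ∑ i, a' i ^ 2)
    (hbb : ∑ i, b i ^ 2 = ∑ i, b' i ^ 2) (hab : ∑ i, a i * b i = ∑ i, a' i * b' i) :
    (stdGaussians ι k).map (fun z => (∑ i, a i • z i, ∑ i, b i • z i)) =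
      (stdGaussians κ k).map (fun z => (∑ i, a' i • z i, ∑ i, b' i • z i)) := by
  refine Measure.ext_of_charFunDual (funext fun L => ?_)
  have hs := fun x => (real_inner_comm _ _).trans (InnerProductSpace.toDual_symm_apply (𝕜 := ℝ)
    (x := x) (y := L.comp (.inl ℝ _ _)))
  have ht := fun x => (real_inner_comm _ _).trans (InnerProductSpace.toDual_symm_apply (𝕜 := ℝ)
    (x := x) (y := L.comp (.inr ℝ _ _)))
  rw [charFunDual_map_pair_stdGaussians a b L hs ht,
    charFunDual_map_pair_stdGaussians a' b' L hs ht, haa, hbb, hab]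

theorem integral_pair_stdGaussians_congr {ι κ : Type*} [Fintype ι] [Fintype κ] {k : ℕ}
    {a b : ι → ℝ} {a' b' : κ → ℝ} (haa : ∑ i, a i ^ 2 = ∑ i, a' i ^ 2)
    (hbb : ∑ i, b i ^ 2 = ∑ i, b' i ^ 2) (hab : ∑ i, a i * b i = ∑ i, a' i * b' i)
    {f : EuclideanSpace ℝ (Fin k) × EuclideanSpace ℝ (Fin k) → ℝ} (hf : Continuous f) :
    ∫ z, f (∑ i, a i • z i, ∑ i, b i • z i) ∂(stdGaussians ι k) =
      ∫ z, f (∑ i, a' i • z i, ∑ i, b' i • z i) ∂(stdGaussians κ k) := by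
  have h := map_pair_stdGaussians_congr (k := k) haa hbb hab
  have h1 := congrArg (fun μ => ∫ x, f x ∂μ) h
  rwa [integral_map (Measurable.aemeasurable (by fun_prop)) hf.aestronglyMeasurable,
    integral_map (Measurable.aemeasurable (by fun_prop)) hf.aestronglyMeasurable] at h1

/-! ### Moments -/

/-- Integration by parts against the Gaussian density, whose derivative is `-x` times itself. -/
theorem integral_gaussian_even_moment (i : ℕ) :
    ∫ x, x ^ (2 * (i + 1)) ∂(gaussianReal 0 1) = (2 * i + 1) * ∫ x, x ^ (2 * i) ∂(gaussianReal 0 1) := by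
  have hint : ∀ n : ℕ, Integrable (fun x : ℝ => gaussianPDFReal 0 1 x * x ^ n) := by
    intro n
    have h := integrable_of_polynomial_growth (gaussianReal 0 1) (f := fun x : ℝ => x ^ n)
      (by fun_prop) (C := 1) (n := n) (fun x => by
        rw [abs_pow, one_mul]
        gcongr
        simp)
    rw [gaussianReal_of_var_ne_zero _ one_ne_zero,
      integrable_withDensity_iff_integrable_smul' (measurable_gaussianPDF 0 1) (by simp [gaussianPDF])] at h
    simpa [toReal_gaussianPDF] using h
  rw [integral_gaussianReal_eq_integral_smul one_ne_zero,
    integral_gaussianReal_eq_integral_smul one_ne_zero]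
  simp only [smul_eq_mul]
  have hd : ∀ x : ℝ, HasDerivAt (gaussianPDFReal 0 1) (-x * gaussianPDFReal 0 1 x) x := by
    intro x
    have h1 : HasDerivAt (fun x : ℝ => (√(2 * Real.pi * (1 : NNReal)))⁻¹ *
        Real.exp (-(x - 0) ^ 2 / (2 * (1 : NNReal)))) _ x :=
      ((((((hasDerivAt_id x).sub_const 0).pow 2).neg).div_const _).exp).const_mul _
    convert! h1 using 1
    simp [gaussianPDFReal]
    ring
  have hu : ∀ x : ℝ, HasDerivAt (fun x : ℝ => x ^ (2 * i + 1)) ((2 * i + 1 : ℝ) * x ^ (2 * i)) x := by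
    intro x
    simpa using hasDerivAt_pow (2 * i + 1) x
  have hparts := integral_mul_deriv_eq_deriv_mul_of_integrable
    (u := fun x : ℝ => x ^ (2 * i + 1)) (v := gaussianPDFReal 0 1)
    (fun x _ => hu x) (fun x _ => hd x)
    ((hint (2 * (i + 1))).neg.congr (ae_of_all _ fun x => by simp; ring))
    (((hint (2 * i)).const_mul (2 * i + 1 : ℝ)).congr (ae_of_all _ fun x => by simp; ring))
    ((hint (2 * i + 1)).congr (ae_of_all _ fun x => by simp; ring))
  have e1 : ∫ x : ℝ, x ^ (2 * i + 1) * (-x * gaussianPDFReal 0 1 x) =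
      - ∫ x, gaussianPDFReal 0 1 x * x ^ (2 * (i + 1)) := by
    rw [← integral_neg]; congr 1; funext x; ring
  have e2 : ∫ x : ℝ, (2 * i + 1 : ℝ) * x ^ (2 * i) * gaussianPDFReal 0 1 x =
      (2 * i + 1) * ∫ x, gaussianPDFReal 0 1 x * x ^ (2 * i) := by
    rw [← integral_const_mul]; congr 1; funext x; ring
  rw [e1, e2] at hparts
  exact neg_injective hparts


theorem integral_mul_add_pow {α : Type*} [MeasurableSpace α] {μ : Measure α} {U W : α → ℝ}
    (hind : IndepFun U W μ)
    (hUi : ∀ i : ℕ, Integrable (fun x => U x ^ i) μ)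
    (hWi : ∀ i : ℕ, Integrable (fun x => W x ^ i) μ) (d s : ℕ) :
    ∫ x, U x ^ d * (U x + W x) ^ s ∂μ = ∑ i ∈ Finset.range (s + 1),
      (∫ x, U x ^ (d + i) ∂μ) * (∫ x, W x ^ (s - i) ∂μ) * (s.choose i : ℝ) := by
  have hmul : ∀ i j : ℕ, IndepFun (fun x => U x ^ i) (fun x => W x ^ j) μ := fun i j =>
    hind.comp (measurable_id.pow_const i) (measurable_id.pow_const j)
  have h1 : ∀ x, U x ^ d * (U x + W x) ^ s = ∑ i ∈ Finset.range (s + 1),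
      (U x ^ (d + i) * W x ^ (s - i)) * (s.choose i : ℝ) := by
    intro x
    rw [add_pow, Finset.mul_sum]
    refine Finset.sum_congr rfl fun i _ => ?_
    rw [pow_add]; ring
  simp_rw [h1]
  rw [integral_finsetSum]
  · refine Finset.sum_congr rfl fun i _ => ?_
    rw [integral_mul_const, (hmul _ _).integral_fun_mul_eq_mul_integral (hUi _).aestronglyMeasurable
      (hWi _).aestronglyMeasurable]
  · exact fun i _ => ((hmul _ _).integrable_mul (hUi _) (hWi _)).mul_const _

/-- `hmom` is the moment recursion of `c` times the square of a standard normal variable. After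
binomial expansion the factor `2 i + 1` splits: the part `1` gives the first term, and the part `2
i` is absorbed into the binomial coefficient and lowers the power by one. This is Gaussian
integration by parts in one summand of a quadratic form. -/
theorem integral_mul_add_pow_succ {α : Type*} [MeasurableSpace α] {μ : Measure α} {U W : α → ℝ}
    (hind : IndepFun U W μ)
    (hUi : ∀ i : ℕ, Integrable (fun x => U x ^ i) μ)
    (hWi : ∀ i : ℕ, Integrable (fun x => W x ^ i) μ) {c : ℝ}
    (hmom : ∀ i : ℕ, ∫ x, U x ^ (i + 1) ∂μ = c * (2 * i + 1) * ∫ x, U x ^ i ∂μ) (s : ℕ) :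
    ∫ x, U x * (U x + W x) ^ (s + 1) ∂μ = c * ∫ x, (U x + W x) ^ (s + 1) ∂μ +
      2 * c * (s + 1) * ∫ x, U x * (U x + W x) ^ s ∂μ := by
  have h0 := integral_mul_add_pow hind hUi hWi 0 (s + 1)
  have h1 := integral_mul_add_pow hind hUi hWi 1 (s + 1)
  have h2 := integral_mul_add_pow hind hUi hWi 1 s
  simp only [pow_zero, one_mul, pow_one, zero_add] at h0 h1 h2
  have h3 : ∀ i : ℕ, ∫ x, U x ^ (1 + i) ∂μ = c * (2 * i + 1) * ∫ x, U x ^ i ∂μ := fun i => by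
    rw [add_comm 1 i, hmom]
  rw [h0, h1, h2]
  have h4 : ∑ i ∈ Finset.range (s + 1 + 1), (∫ x, U x ^ (1 + i) ∂μ) *
      (∫ x, W x ^ (s + 1 - i) ∂μ) * ((s + 1).choose i : ℝ) =
      c * ∑ i ∈ Finset.range (s + 1 + 1), (∫ x, U x ^ i ∂μ) *
      (∫ x, W x ^ (s + 1 - i) ∂μ) * ((s + 1).choose i : ℝ) +
      2 * c * ∑ i ∈ Finset.range (s + 1 + 1), (∫ x, U x ^ i ∂μ) *
      (∫ x, W x ^ (s + 1 - i) ∂μ) * (i * (s + 1).choose i : ℝ) := by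
    rw [Finset.mul_sum, Finset.mul_sum, ← Finset.sum_add_distrib]
    refine Finset.sum_congr rfl fun i _ => ?_
    rw [h3]; ring
  rw [h4, add_right_inj, Finset.sum_range_succ']
  simp only [Nat.cast_zero, zero_mul, mul_zero, add_zero, Finset.mul_sum]
  refine Finset.sum_congr rfl fun i _ => ?_
  have h5 : ((s : ℝ) + 1) * (s.choose i : ℝ) = ((s + 1).choose (i + 1) : ℝ) * ((i : ℝ) + 1) := by
    exact_mod_cast Nat.add_one_mul_choose_eq s i
  rw [add_comm 1 i, show s + 1 - (i + 1) = s - i by omega]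
  push_cast
  linear_combination (-2 * c * (∫ x, U x ^ (i + 1) ∂μ) * ∫ x, W x ^ (s - i) ∂μ) * h5

/-- The moments of `∑ r_a x_a²` for independent standard normal `x_a`. -/
def quadMoment {k : ℕ} (r : Fin k → ℝ) (s : ℕ) : ℝ :=
  ∫ x, quadForm r x ^ s ∂(stdGaussian (EuclideanSpace ℝ (Fin k)))

theorem quadMoment_zero {k : ℕ} (r : Fin k → ℝ) : quadMoment r 0 = 1 := by simp [quadMoment]

theorem quadMoment_eq {k : ℕ} (r : Fin k → ℝ) (s : ℕ) :
    quadMoment r s = ∫ x : Fin k → ℝ, (∑ a, r a * x a ^ 2) ^ s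
      ∂(Measure.pi fun _ => gaussianReal 0 1) := by
  rw [quadMoment, ← map_pi_eq_stdGaussian, integral_map (by fun_prop)
    (f := fun x => quadForm r x ^ s) ((continuous_quadForm r).pow s).aestronglyMeasurable]
  rfl

/-- Needed to integrate functions of polynomial growth against the product laws used below. -/
instance isGaussian_pi {ι : Type*} [Fintype ι] {E : ι → Type*} [∀ i, NormedAddCommGroup (E i)]
    [∀ i, NormedSpace ℝ (E i)] [∀ i, MeasurableSpace (E i)] [∀ i, BorelSpace (E i)]
    [∀ i, SecondCountableTopology (E i)] [∀ i, CompleteSpace (E i)] (μ : ∀ i, Measure (E i))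
    [∀ i, IsGaussian (μ i)] : IsGaussian (Measure.pi μ) := by
  have h := iIndepFun.hasGaussianLaw (P := Measure.pi μ) (X := fun i x => x i)
    (fun i => ⟨by
      rw [(measurePreserving_eval μ i).map_eq]
      infer_instance⟩) (iIndepFun_pi (X := fun _ y => y) fun i => aemeasurable_id)
  have := h.isGaussian_map
  rwa [show (fun (ω : ∀ i, E i) i => ω i) = id from rfl, Measure.map_id] at this

theorem integrable_prod_pow_pi {k : ℕ} {f : (Fin k → ℝ) → ℝ} (hf : Continuous f) {C : ℝ} {n : ℕ}
    (h : ∀ x, |f x| ≤ C * (1 + ‖x‖) ^ n) :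
    Integrable f (Measure.pi fun _ : Fin k => gaussianReal 0 1) :=
  integrable_of_polynomial_growth _ hf h

theorem abs_sum_mul_sq_pow_le {k : ℕ} (r : Fin k → ℝ) (A : Finset (Fin k)) (x : Fin k → ℝ) (s : ℕ) :
    |(∑ a ∈ A, r a * x a ^ 2) ^ s| ≤ (∑ a ∈ A, |r a|) ^ s * (1 + ‖x‖) ^ (2 * s) := by
  rw [abs_pow, pow_mul, ← mul_pow]
  gcongr
  rw [Finset.sum_mul]
  refine (Finset.abs_sum_le_sum_abs _ _).trans (Finset.sum_le_sum fun a _ => ?_)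
  rw [abs_mul, abs_pow]
  gcongr
  have := norm_le_pi_norm x a
  rw [Real.norm_eq_abs] at this
  linarith

theorem integrable_sum_mul_sq_pow {k : ℕ} (r : Fin k → ℝ) (A : Finset (Fin k)) (s : ℕ) :
    Integrable (fun x : Fin k → ℝ => (∑ a ∈ A, r a * x a ^ 2) ^ s)
      (Measure.pi fun _ : Fin k => gaussianReal 0 1) :=
  integrable_prod_pow_pi (by fun_prop) (fun x => abs_sum_mul_sq_pow_le r A x s)

theorem quadMoment_step {k : ℕ} (r : Fin k → ℝ) (a : Fin k) (s : ℕ) :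
    ∫ x : Fin k → ℝ, (r a * x a ^ 2) * (∑ a, r a * x a ^ 2) ^ (s + 1)
      ∂(Measure.pi fun _ => gaussianReal 0 1) =
    r a * quadMoment r (s + 1) + 2 * r a * (s + 1) *
      ∫ x : Fin k → ℝ, (r a * x a ^ 2) * (∑ a, r a * x a ^ 2) ^ s
        ∂(Measure.pi fun _ => gaussianReal 0 1) := by
  have hindep : iIndepFun (fun (b : Fin k) (x : Fin k → ℝ) => r b * x b ^ 2)
      (Measure.pi fun _ : Fin k => gaussianReal 0 1) :=
    iIndepFun_pi (X := fun b (y : ℝ) => r b * y ^ 2) (fun b => by fun_prop)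
  have hind := (hindep.indepFun_finsetSum_of_notMem (fun b => by fun_prop)
    (Finset.notMem_erase a Finset.univ)).symm
  have hsum : (∑ b ∈ Finset.univ.erase a, fun x : Fin k → ℝ => r b * x b ^ 2) =
      fun x => ∑ b ∈ Finset.univ.erase a, r b * x b ^ 2 := by
    funext x; simp
  rw [hsum] at hind
  have hsplit : ∀ x : Fin k → ℝ, ∑ b, r b * x b ^ 2 =
      r a * x a ^ 2 + ∑ b ∈ Finset.univ.erase a, r b * x b ^ 2 := fun x =>
    (Finset.add_sum_erase _ _ (Finset.mem_univ a)).symm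
  have hmom : ∀ i : ℕ, ∫ x : Fin k → ℝ, (r a * x a ^ 2) ^ i
      ∂(Measure.pi fun _ => gaussianReal 0 1) = r a ^ i * ∫ y, y ^ (2 * i) ∂(gaussianReal 0 1) := by
    intro i
    rw [← integral_const_mul]
    have h := integral_comp_eval (μ := fun _ : Fin k => gaussianReal 0 1) (i := a)
      (f := fun y : ℝ => (r a * y ^ 2) ^ i) (by fun_prop)
    rw [h]
    congr 1
    funext y
    rw [mul_pow, pow_mul]
  rw [quadMoment_eq]
  simp_rw [hsplit]
  refine integral_mul_add_pow_succ hind ?_ ?_ ?_ s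
  · intro i
    simpa using integrable_sum_mul_sq_pow r {a} i
  · exact fun i => integrable_sum_mul_sq_pow r _ i
  · intro i
    rw [hmom, hmom, integral_gaussian_even_moment]
    ring

/-- The relation between moments and cumulants: the cumulant of order `i + 1` is `i! 2^i ∑
r_a^(i+1)`. It is obtained by splitting off one factor of the power as `∑_a r_a x_a²` and iterating
the integration by parts in each coordinate `a`. -/
theorem quadMoment_succ {k : ℕ} (r : Fin k → ℝ) (s : ℕ) :
    quadMoment r (s + 1) / ((Nat.factorial s : ℝ) * 2 ^ s) = ∑ i ∈ Finset.range (s + 1),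
      (∑ a, r a ^ (i + 1)) * (quadMoment r (s - i) / ((Nat.factorial (s - i) : ℝ) * 2 ^ (s - i))) := by
  set G : Fin k → ℕ → ℝ := fun a s => ∫ x : Fin k → ℝ, (r a * x a ^ 2) *
    (∑ a, r a * x a ^ 2) ^ s ∂(Measure.pi fun _ => gaussianReal 0 1) with hG
  have hG0 : ∀ a, G a 0 = r a := by
    intro a
    have h := integral_comp_eval (μ := fun _ : Fin k => gaussianReal 0 1) (i := a)
      (f := fun y : ℝ => r a * y ^ 2) (by fun_prop)
    simp only [hG, pow_zero, mul_one]
    rw [h, integral_const_mul]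
    have := integral_gaussian_even_moment 0
    simp at this
    rw [this, mul_one]
  have hGs : ∀ a s, G a (s + 1) = r a * quadMoment r (s + 1) + 2 * r a * (s + 1) * G a s :=
    fun a s => quadMoment_step r a s
  have hclosed : ∀ a s, G a s / ((Nat.factorial s : ℝ) * 2 ^ s) = ∑ i ∈ Finset.range (s + 1),
      r a ^ (i + 1) * (quadMoment r (s - i) / ((Nat.factorial (s - i) : ℝ) * 2 ^ (s - i))) := by
    intro a s
    induction s with
    | zero => simp [hG0, quadMoment_zero]
    | succ s ih =>
      rw [Finset.sum_range_succ']
      have h1 : ∑ i ∈ Finset.range (s + 1), r a ^ (i + 1 + 1) * (quadMoment r (s + 1 - (i + 1)) /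
          ((Nat.factorial (s + 1 - (i + 1)) : ℝ) * 2 ^ (s + 1 - (i + 1)))) =
          r a * (G a s / ((Nat.factorial s : ℝ) * 2 ^ s)) := by
        rw [ih, Finset.mul_sum]
        refine Finset.sum_congr rfl fun i _ => ?_
        rw [show s + 1 - (i + 1) = s - i by omega, pow_succ]
        ring
      rw [h1, hGs, Nat.factorial_succ]
      have h2 : (Nat.factorial s : ℝ) ≠ 0 := by positivity
      push_cast
      simp only [pow_one, Nat.factorial_succ]
      push_cast
      field_simp
      ring
  have hM : quadMoment r (s + 1) = ∑ a, G a s := by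
    simp only [hG]
    rw [← integral_finsetSum, quadMoment_eq]
    · congr 1; funext x; rw [← Finset.sum_mul, pow_succ']
    · intro a _
      refine integrable_prod_pow_pi (C := (∑ b ∈ {a}, |r b|) ^ 1 * (∑ b, |r b|) ^ s)
        (n := 2 * 1 + 2 * s) (by fun_prop) fun x => ?_
      rw [abs_mul, pow_add]
      have h1 := abs_sum_mul_sq_pow_le r {a} x 1
      have h2 := abs_sum_mul_sq_pow_le r Finset.univ x s
      simp only [Finset.sum_singleton, pow_one] at h1 ⊢
      calc _ ≤ _ := mul_le_mul h1 h2 (abs_nonneg _) (by positivity)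
        _ = _ := by ring
  rw [hM, Finset.sum_div]
  simp_rw [hclosed, Finset.sum_mul]
  rw [Finset.sum_comm]

/-- The recursion for `powerSums` is `quadMoment_succ` solved for its last term, in which the moment
of order zero equals one. -/
theorem powerSums_quadMoment {k : ℕ} (r : Fin k → ℝ) (τ : ℕ) (hτ : 1 ≤ τ) :
    powerSums (quadMoment r) τ = ∑ a, r a ^ τ := by
  induction τ using Nat.strong_induction_on with
  | _ τ ih =>
    obtain ⟨s, rfl⟩ : ∃ s, τ = s + 1 := ⟨τ - 1, by omega⟩
    rw [powerSums, quadMoment_succ, Finset.sum_range_succ, Finset.sum_range]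
    have h : ∀ j : Fin s, quadMoment r (s - j) * powerSums (quadMoment r) (j + 1) /
        ((Nat.factorial (s - j) : ℝ) * 2 ^ (s - j : ℕ)) = (∑ a, r a ^ ((j : ℕ) + 1)) *
        (quadMoment r (s - j) / ((Nat.factorial (s - j) : ℝ) * 2 ^ (s - j : ℕ))) := by
      intro j
      rw [ih _ (by omega) (by omega)]
      ring
    simp_rw [h]
    simp [quadMoment_zero]

theorem companionCoeff_congr {R R' : ℕ → ℝ} (h : ∀ τ, 1 ≤ τ → R τ = R' τ) (i : ℕ) :
    companionCoeff R i = companionCoeff R' i := by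
  induction i using Nat.strong_induction_on with
  | _ i ih =>
    rcases i with _ | i
    · simp [companionCoeff]
    · rw [companionCoeff, companionCoeff, h _ (by omega)]
      congr 2
      refine Finset.sum_congr rfl fun j _ => ?_
      rw [h _ (by omega), ih _ (by omega)]

theorem eigenModulus_powerSums_quadMoment {k : ℕ} (j : Fin k) {r : Fin k → ℝ} (hr : Antitone r)
    (h0 : ∀ a, 0 ≤ r a) : eigenModulus k (powerSums (quadMoment r)) j = r j := by
  rw [← eigenModulus_sum_pow j hr h0, eigenModulus_eq_rootModulus, eigenModulus_eq_rootModulus]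
  congr 1
  funext b
  rw [companionCoeff_congr (R' := fun τ => ∑ a, r a ^ τ) (powerSums_quadMoment r)]


/-! ### Functions of polynomial growth -/

/-- Continuous functions of polynomial growth. -/
def PolyGrowth {E : Type*} [NormedAddCommGroup E] (f : E → ℝ) : Prop :=
  Continuous f ∧ ∃ (C : ℝ) (n : ℕ), ∀ x, |f x| ≤ C * (1 + ‖x‖) ^ n

namespace PolyGrowth

variable {E : Type*} [NormedAddCommGroup E] {f g : E → ℝ}

theorem integrable [NormedSpace ℝ E] [CompleteSpace E] [SecondCountableTopology E]
    [MeasurableSpace E] [BorelSpace E] (hf : PolyGrowth f) (μ : Measure E) [IsGaussian μ] :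
    Integrable f μ := by
  obtain ⟨hc, C, n, h⟩ := hf
  exact integrable_of_polynomial_growth μ hc h

theorem const (c : ℝ) : PolyGrowth (fun _ : E => c) :=
  ⟨continuous_const, |c|, 0, fun x => by simp⟩

theorem mul (hf : PolyGrowth f) (hg : PolyGrowth g) : PolyGrowth (fun x => f x * g x) := by
  obtain ⟨hfc, C, n, hf⟩ := hf
  obtain ⟨hgc, D, l, hg⟩ := hg
  refine ⟨hfc.mul hgc, C * D, n + l, fun x => ?_⟩
  rw [abs_mul, pow_add]
  calc |f x| * |g x| ≤ (C * (1 + ‖x‖) ^ n) * (D * (1 + ‖x‖) ^ l) :=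
        mul_le_mul (hf x) (hg x) (abs_nonneg _) ((abs_nonneg _).trans (hf x))
    _ = _ := by ring

theorem add (hf : PolyGrowth f) (hg : PolyGrowth g) : PolyGrowth (fun x => f x + g x) := by
  obtain ⟨hfc, C, n, hf⟩ := hf
  obtain ⟨hgc, D, l, hg⟩ := hg
  refine ⟨hfc.add hgc, |C| + |D|, n + l, fun x => ?_⟩
  have h1 : (1 : ℝ) ≤ 1 + ‖x‖ := by linarith [norm_nonneg x]
  have h2 : (1 + ‖x‖) ^ n ≤ (1 + ‖x‖) ^ (n + l) := pow_le_pow_right₀ h1 (by omega)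
  have h3 : (1 + ‖x‖) ^ l ≤ (1 + ‖x‖) ^ (n + l) := pow_le_pow_right₀ h1 (by omega)
  have h4 : C * (1 + ‖x‖) ^ n ≤ |C| * (1 + ‖x‖) ^ (n + l) :=
    mul_le_mul (le_abs_self C) h2 (by positivity) (abs_nonneg _)
  have h5 : D * (1 + ‖x‖) ^ l ≤ |D| * (1 + ‖x‖) ^ (n + l) :=
    mul_le_mul (le_abs_self D) h3 (by positivity) (abs_nonneg _)
  linarith [abs_add_le (f x) (g x), hf x, hg x]

theorem sub (hf : PolyGrowth f) (hg : PolyGrowth g) : PolyGrowth (fun x => f x - g x) := by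
  have h := hf.add ((const (-1)).mul hg)
  simpa [sub_eq_add_neg] using h

theorem pow (hf : PolyGrowth f) (s : ℕ) : PolyGrowth (fun x => f x ^ s) := by
  induction s with
  | zero => simpa using const (E := E) 1
  | succ s ih => simpa [pow_succ] using ih.mul hf

theorem sum {ι : Type*} (A : Finset ι) {f : ι → E → ℝ} (hf : ∀ i ∈ A, PolyGrowth (f i)) :
    PolyGrowth (fun x => ∑ i ∈ A, f i x) := by
  classical
  induction A using Finset.induction_on with
  | empty => simpa using const (E := E) 0
  | insert i A hi ih =>
    simp only [Finset.sum_insert hi]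
    exact (hf i (Finset.mem_insert_self i A)).add
      (ih fun l hl => hf l (Finset.mem_insert_of_mem hl))

end PolyGrowth

theorem polyGrowth_quadForm {ι : Type*} [Fintype ι] {k : ℕ} (r : Fin k → ℝ) (w : ι → ℝ) :
    PolyGrowth fun z : ι → EuclideanSpace ℝ (Fin k) => quadForm r (∑ l, w l • z l) := by
  refine ⟨(continuous_quadForm r).comp (by fun_prop), (∑ a, |r a|) * (∑ l, |w l|) ^ 2, 2,
    fun z => (abs_quadForm_le r _).trans ?_⟩
  rw [mul_assoc, ← mul_pow]
  have h : ‖∑ l, w l • z l‖ ≤ (∑ l, |w l|) * (1 + ‖z‖) := by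
    rw [Finset.sum_mul]
    refine norm_sum_le_of_le _ fun l _ => ?_
    rw [norm_smul, Real.norm_eq_abs]
    gcongr
    linarith [norm_le_pi_norm z l]
  gcongr

/-! ### Weights of pairs of subsets -/

/-- The difference of the averaging weights of `S₁` and of `S₂`. -/
def rawWeight {m : ℕ} (S : Finset (Fin m) × Finset (Fin m)) (l : Fin m) : ℝ :=
  (if l ∈ S.1 then (S.1.card : ℝ)⁻¹ else 0) - (if l ∈ S.2 then (S.2.card : ℝ)⁻¹ else 0)

/-- The normalized difference of the averaging weights of `S₁` and of `S₂`. -/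
def unitWeight {m : ℕ} (S : Finset (Fin m) × Finset (Fin m)) (l : Fin m) : ℝ :=
  rawWeight S l / √(∑ l, rawWeight S l ^ 2)

/-- The squared length by which the prefactor in `THat` normalizes the quadratic form in the
difference of the two means. -/
theorem sum_rawWeight_sq {m : ℕ} {S : Finset (Fin m) × Finset (Fin m)} (h1 : S.1.Nonempty)
    (h2 : S.2.Nonempty) : ∑ l, rawWeight S l ^ 2 =
      ((S.1.card : ℝ) + S.2.card - 2 * (S.1 ∩ S.2).card) / (S.1.card * S.2.card) := by
  have c1 : (S.1.card : ℝ) ≠ 0 := by exact_mod_cast h1.card_pos.ne'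
  have c2 : (S.2.card : ℝ) ≠ 0 := by exact_mod_cast h2.card_pos.ne'
  have h : ∀ l, rawWeight S l ^ 2 = (if l ∈ S.1 then ((S.1.card : ℝ)⁻¹) ^ 2 else 0) +
      (if l ∈ S.2 then ((S.2.card : ℝ)⁻¹) ^ 2 else 0) -
      (if l ∈ S.1 ∩ S.2 then 2 * ((S.1.card : ℝ)⁻¹ * (S.2.card : ℝ)⁻¹) else 0) := by
    intro l
    by_cases a : l ∈ S.1 <;> by_cases b : l ∈ S.2 <;> simp [rawWeight, a, b]
    ring
  simp_rw [h, Finset.sum_sub_distrib, Finset.sum_add_distrib]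
  simp only [Finset.sum_ite_mem, Finset.univ_inter, Finset.sum_const, nsmul_eq_mul]
  field_simp
  ring

/-- The quantity is the cardinality of the symmetric difference. -/
theorem card_add_card_sub_pos {m : ℕ} {S₁ S₂ : Finset (Fin m)} (h : S₁ ≠ S₂) :
    0 < (S₁.card : ℝ) + S₂.card - 2 * (S₁ ∩ S₂).card := by
  have a := Finset.card_sdiff_add_card_inter S₁ S₂
  have b := Finset.card_sdiff_add_card_inter S₂ S₁
  rw [Finset.inter_comm] at b
  have c : 0 < (S₁ \ S₂).card + (S₂ \ S₁).card := by
    by_contra! hc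
    have e1 : S₁ \ S₂ = ∅ := Finset.card_eq_zero.1 (by omega)
    have e2 : S₂ \ S₁ = ∅ := Finset.card_eq_zero.1 (by omega)
    exact h (Finset.Subset.antisymm (Finset.sdiff_eq_empty_iff_subset.1 e1)
      (Finset.sdiff_eq_empty_iff_subset.1 e2))
  have d : S₁.card + S₂.card = 2 * (S₁ ∩ S₂).card + ((S₁ \ S₂).card + (S₂ \ S₁).card) := by omega
  have d' : (S₁.card : ℝ) + S₂.card =
      2 * (S₁ ∩ S₂).card + (((S₁ \ S₂).card + (S₂ \ S₁).card : ℕ) : ℝ) := by exact_mod_cast d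
  have c' : (0 : ℝ) < (((S₁ \ S₂).card + (S₂ \ S₁).card : ℕ) : ℝ) := by exact_mod_cast c
  linarith

theorem sum_rawWeight_sq_pos {m : ℕ} {S : Finset (Fin m) × Finset (Fin m)} (h1 : S.1.Nonempty)
    (h2 : S.2.Nonempty) (h : S.1 ≠ S.2) : 0 < ∑ l, rawWeight S l ^ 2 := by
  rw [sum_rawWeight_sq h1 h2]
  have c1 : (0 : ℝ) < S.1.card := by exact_mod_cast h1.card_pos
  have c2 : (0 : ℝ) < S.2.card := by exact_mod_cast h2.card_pos
  exact div_pos (card_add_card_sub_pos h) (mul_pos c1 c2)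

theorem unitWeight_mul_unitWeight {m : ℕ} (S : Finset (Fin m) × Finset (Fin m)) (a b : Fin m) :
    unitWeight S a * unitWeight S b = rawWeight S a * rawWeight S b / ∑ l, rawWeight S l ^ 2 := by
  rw [unitWeight, unitWeight, div_mul_div_comm,
    Real.mul_self_sqrt (Finset.sum_nonneg fun l _ => sq_nonneg _)]

theorem sum_unitWeight_sq {m : ℕ} {S : Finset (Fin m) × Finset (Fin m)} (h1 : S.1.Nonempty)
    (h2 : S.2.Nonempty) (h : S.1 ≠ S.2) : ∑ l, unitWeight S l ^ 2 = 1 := by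
  simp_rw [sq, unitWeight_mul_unitWeight, ← sq, ← Finset.sum_div]
  exact div_self (sum_rawWeight_sq_pos h1 h2 h).ne'

theorem SelectionRule.mem_pairs {m : ℕ} (hm : 2 ≤ m) (rule : SelectionRule)
    {S : Finset (Fin m) × Finset (Fin m)} (hS : S ∈ rule.pairs m) :
    S.1.Nonempty ∧ S.2.Nonempty ∧ S.1 ≠ S.2 := by
  cases rule with
  | jackknife =>
    simp only [SelectionRule.pairs, Finset.mem_image, Finset.mem_univ, true_and] at hS
    obtain ⟨l, rfl⟩ := hS
    have : ({l}ᶜ : Finset (Fin m)).Nonempty := by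
      rw [← Finset.card_pos, Finset.card_compl]; simp; omega
    refine ⟨Finset.singleton_nonempty l, this, fun h => ?_⟩
    have h1 : l ∈ ({l} : Finset (Fin m)) := Finset.mem_singleton_self l
    simp only at h
    rw [h] at h1
    simp at h1
  | full =>
    simp only [SelectionRule.pairs, Finset.mem_image, Finset.mem_univ, true_and] at hS
    obtain ⟨l, rfl⟩ := hS
    refine ⟨Finset.singleton_nonempty l, ⟨l, Finset.mem_univ l⟩, fun h => ?_⟩
    have := congrArg Finset.card h
    simp at this
    omega
  | pair =>
    simp only [SelectionRule.pairs, Finset.mem_image, Finset.mem_filter, Finset.mem_univ,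
      true_and] at hS
    obtain ⟨e, he, rfl⟩ := hS
    exact ⟨Finset.singleton_nonempty _, Finset.singleton_nonempty _, fun h =>
      he.ne (Finset.singleton_injective h)⟩

theorem sum_indicator_quadratic {m : ℕ} (a b : Fin m) :
    ∑ l : Fin m, ((m : ℝ) * (if a = l then 1 else 0) - 1) * ((m : ℝ) * (if b = l then 1 else 0) - 1) =
      m * ((m : ℝ) * (if a = b then 1 else 0) - 1) := by
  have h : ∀ l : Fin m, ((m : ℝ) * (if a = l then 1 else 0) - 1) *
      ((m : ℝ) * (if b = l then 1 else 0) - 1) =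
      m ^ 2 * (if a = l then (if b = l then 1 else 0) else 0) - m * (if a = l then 1 else 0) -
        m * (if b = l then 1 else 0) + 1 := by
    intro l; split_ifs <;> ring
  simp_rw [h, Finset.sum_add_distrib, Finset.sum_sub_distrib, ← Finset.mul_sum]
  simp only [Finset.sum_ite_eq, Finset.sum_ite_eq', Finset.mem_univ, if_true, Finset.sum_const, Finset.card_univ,
    Fintype.card_fin, nsmul_eq_mul, eq_comm (a := b)]
  ring

/-- Common to the jackknife and the full rule: both have raw weights proportional to `m e_l - 1`,
and the factor `κ` disappears in the normalization. -/
theorem sum_unitWeight_of_singleton {m : ℕ} (hm : 2 ≤ m) {T : Fin m → Finset (Fin m)} {κ : ℝ}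
    (hκ : 0 < κ) (hw : ∀ l a, rawWeight ({l}, T l) a = κ * ((m : ℝ) * (if a = l then 1 else 0) - 1))
    (a b : Fin m) : ∑ S ∈ Finset.univ.image (fun l : Fin m => (({l} : Finset (Fin m)), T l)),
      unitWeight S a * unitWeight S b = ((m : ℝ) - 1)⁻¹ * ((m : ℝ) * (if a = b then 1 else 0) - 1) := by
  have hm' : (2 : ℝ) ≤ m := by exact_mod_cast hm
  rw [Finset.sum_image]
  · have hsq : ∀ l : Fin m, ∑ c, rawWeight ({l}, T l) c ^ 2 = κ ^ 2 * (m * ((m : ℝ) - 1)) := by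
      intro l
      have h := sum_indicator_quadratic l l
      simp_rw [hw, mul_pow, ← Finset.mul_sum, sq]
      simp only [↓reduceIte, mul_one] at h
      rw [← h]
      simp_rw [eq_comm]
    simp_rw [unitWeight_mul_unitWeight, hsq, ← Finset.sum_div, hw]
    have h := sum_indicator_quadratic a b
    have hm0 : (m : ℝ) - 1 ≠ 0 := by linarith
    have hm1 : (m : ℝ) ≠ 0 := by positivity
    rw [div_eq_iff (mul_ne_zero (pow_ne_zero 2 hκ.ne') (mul_ne_zero hm1 hm0)), show ∀ x y : Fin m → ℝ, ∑ l, κ * x l * (κ * y l) =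
      κ ^ 2 * ∑ l, x l * y l from fun x y => by
        rw [Finset.mul_sum]; exact Finset.sum_congr rfl fun _ _ => by ring, h]
    field_simp
  · intro l _ l' _ h
    exact Finset.singleton_injective (Prod.ext_iff.1 h).1

/-- The weights sum to zero and each rule treats the imputations symmetrically, so `∑ u uᵀ` is a
multiple of `m I - 1 1ᵀ`: the unit weights form a tight frame of the hyperplane orthogonal to the
constants. Only the multiple depends on the rule. -/
theorem exists_sum_unitWeight {m : ℕ} (hm : 2 ≤ m) (rule : SelectionRule) :
    ∃ κ : ℝ, 0 < κ ∧ ∀ a b : Fin m, ∑ S ∈ rule.pairs m, unitWeight S a * unitWeight S b =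
      κ * ((m : ℝ) * (if a = b then 1 else 0) - 1) := by
  have hm' : (2 : ℝ) ≤ m := by exact_mod_cast hm
  have hm1 : (0 : ℝ) < (m : ℝ) - 1 := by linarith
  cases rule with
  | jackknife =>
    refine ⟨_, inv_pos.2 hm1, sum_unitWeight_of_singleton hm (κ := ((m : ℝ) - 1)⁻¹)
      (inv_pos.2 hm1) fun l a => ?_⟩
    have hc : ((m - 1 : ℕ) : ℝ) = (m : ℝ) - 1 := by push_cast [Nat.cast_sub (by omega : 1 ≤ m)]; ring
    simp only [rawWeight, Finset.card_singleton, Finset.mem_singleton, Finset.mem_compl,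
      Finset.card_compl, Fintype.card_fin, hc]
    split_ifs
    · simp; field_simp
    · simp
  | full =>
    refine ⟨_, inv_pos.2 hm1, sum_unitWeight_of_singleton hm (κ := (m : ℝ)⁻¹)
      (by positivity) fun l a => ?_⟩
    have : (m : ℝ) ≠ 0 := by positivity
    simp only [rawWeight, Finset.card_singleton, Finset.mem_singleton, Finset.mem_univ, if_true,
      Finset.card_univ, Fintype.card_fin]
    split_ifs
    · simp; field_simp
    · simp
  | pair =>
    refine ⟨1 / 2, by norm_num, fun a b => ?_⟩
    simp only [SelectionRule.pairs]
    rw [Finset.sum_image]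
    -- `F` is symmetric in its two indices and vanishes on the diagonal, so the sum over increasing
    -- pairs is half of the sum over all pairs. The further division by two in `h1` is the squared
    -- length of `e_l - e_l'`.
    · set F : Fin m × Fin m → ℝ := fun e => ((if a = e.1 then 1 else 0) - (if a = e.2 then 1 else 0)) *
        ((if b = e.1 then 1 else 0) - (if b = e.2 then 1 else 0)) with hF
      have h1 : ∀ e ∈ Finset.univ.filter fun e : Fin m × Fin m => e.1 < e.2,
          unitWeight ({e.1}, {e.2}) a * unitWeight ({e.1}, {e.2}) b = F e / 2 := by
        intro e he
        simp only [Finset.mem_filter, Finset.mem_univ, true_and] at he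
        rw [unitWeight_mul_unitWeight, sum_rawWeight_sq (by simp) (by simp)]
        have : ({e.1} : Finset (Fin m)) ∩ {e.2} = ∅ := by
          rw [Finset.singleton_inter_of_notMem]; simpa using he.ne
        simp only [this, rawWeight, Finset.mem_singleton, Finset.card_singleton, hF]
        norm_num
      rw [Finset.sum_congr rfl h1, ← Finset.sum_div]
      have hall : ∑ e : Fin m × Fin m, F e = 2 * ((m : ℝ) * (if a = b then 1 else 0) - 1) := by
        rw [Fintype.sum_prod_type]
        have h2 : ∀ x y : Fin m, F (x, y) = (if a = x then (if b = x then 1 else 0) else 0) -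
            (if a = x then 1 else 0) * (if b = y then 1 else 0) -
            (if b = x then 1 else 0) * (if a = y then 1 else 0) +
            (if a = y then (if b = y then 1 else 0) else 0) := by
          intro x y; simp only [hF]; split_ifs <;> ring
        simp_rw [h2, Finset.sum_add_distrib, Finset.sum_sub_distrib, ← Finset.mul_sum]
        simp [eq_comm]
        ring
      have hsplit : ∑ e : Fin m × Fin m, F e =
          2 * ∑ e ∈ Finset.univ.filter fun e : Fin m × Fin m => e.1 < e.2, F e := by
        have hswap : ∑ e ∈ Finset.univ.filter (fun e : Fin m × Fin m => e.2 < e.1), F e =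
            ∑ e ∈ Finset.univ.filter fun e : Fin m × Fin m => e.1 < e.2, F e := by
          refine Finset.sum_nbij' Prod.swap Prod.swap ?_ ?_ ?_ ?_ ?_
          · simp
          · simp
          · simp
          · simp
          · intro e _; simp only [hF, Prod.fst_swap, Prod.snd_swap]; ring
        rw [two_mul]
        nth_rw 1 [← hswap]
        rw [Finset.sum_filter, Finset.sum_filter, ← Finset.sum_add_distrib]
        refine Finset.sum_congr rfl fun e _ => ?_
        rcases lt_trichotomy e.1 e.2 with h | h | h
        · simp [h, h.not_gt]
        · simp [h, hF]
        · simp [h, h.not_gt]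
      rw [hsplit] at hall
      linarith
    · intro e _ e' _ h
      have h1 := Prod.ext_iff.1 h
      exact Prod.ext (Finset.singleton_injective h1.1) (Finset.singleton_injective h1.2)

/-- With `G = ∑ u uᵀ = κ (m I - 1 1ᵀ)` the number of pairs is `tr G` and the sum of the squared
inner products is `tr G²`. Since `G` is a multiple of a projection of rank `m - 1`, the quotient `tr
G² / (tr G)²` is the inverse of the rank. -/
theorem sum_sq_inner_unitWeight {m : ℕ} (hm : 2 ≤ m) (rule : SelectionRule) :
    0 < (rule.pairs m).card ∧
    ((rule.pairs m).card : ℝ)⁻¹ ^ 2 * ∑ S ∈ rule.pairs m, ∑ S' ∈ rule.pairs m,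
      (∑ l, unitWeight S l * unitWeight S' l) ^ 2 = ((m : ℝ) - 1)⁻¹ := by
  have hm' : (2 : ℝ) ≤ m := by exact_mod_cast hm
  have hm1 : (0 : ℝ) < (m : ℝ) - 1 := by linarith
  obtain ⟨κ, hκ, h⟩ := exists_sum_unitWeight hm rule
  have hcard : ((rule.pairs m).card : ℝ) = κ * (m * ((m : ℝ) - 1)) := by
    have h1 : ((rule.pairs m).card : ℝ) = ∑ S ∈ rule.pairs m, ∑ l, unitWeight S l ^ 2 := by
      rw [Finset.sum_congr rfl fun S hS => sum_unitWeight_sq (rule.mem_pairs hm hS).1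
        (rule.mem_pairs hm hS).2.1 (rule.mem_pairs hm hS).2.2]
      simp
    rw [h1, Finset.sum_comm]
    simp_rw [sq, h]
    simp
    ring
  have hsum : ∑ S ∈ rule.pairs m, ∑ S' ∈ rule.pairs m, (∑ l, unitWeight S l * unitWeight S' l) ^ 2 =
      ∑ a : Fin m, ∑ b : Fin m, (κ * ((m : ℝ) * (if a = b then 1 else 0) - 1)) ^ 2 := by
    simp_rw [← h, sq, Finset.sum_mul_sum]
    calc _ = ∑ S ∈ rule.pairs m, ∑ a, ∑ S' ∈ rule.pairs m, ∑ b, unitWeight S a * unitWeight S' a *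
          (unitWeight S b * unitWeight S' b) := Finset.sum_congr rfl fun S _ => Finset.sum_comm
      _ = ∑ a, ∑ S ∈ rule.pairs m, ∑ S' ∈ rule.pairs m, ∑ b, unitWeight S a * unitWeight S' a *
          (unitWeight S b * unitWeight S' b) := Finset.sum_comm
      _ = ∑ a, ∑ S ∈ rule.pairs m, ∑ b, ∑ S' ∈ rule.pairs m, unitWeight S a * unitWeight S' a *
          (unitWeight S b * unitWeight S' b) :=
        Finset.sum_congr rfl fun a _ => Finset.sum_congr rfl fun S _ => Finset.sum_comm
      _ = ∑ a, ∑ b, ∑ S ∈ rule.pairs m, ∑ S' ∈ rule.pairs m, unitWeight S a * unitWeight S' a *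
          (unitWeight S b * unitWeight S' b) := Finset.sum_congr rfl fun a _ => Finset.sum_comm
      _ = _ := by
        refine Finset.sum_congr rfl fun a _ => Finset.sum_congr rfl fun b _ =>
          Finset.sum_congr rfl fun S _ => Finset.sum_congr rfl fun S' _ => ?_
        ring
  constructor
  · have : (0 : ℝ) < (rule.pairs m).card := by rw [hcard]; positivity
    exact_mod_cast this
  · rw [hsum, hcard]
    have h3 : ∀ a b : Fin m, (κ * ((m : ℝ) * (if a = b then 1 else 0) - 1)) ^ 2 =
        κ ^ 2 * ((m ^ 2 - 2 * m) * (if a = b then 1 else 0) + 1) := by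
      intro a b; split_ifs <;> ring
    simp_rw [h3, ← Finset.mul_sum, Finset.sum_add_distrib, ← Finset.mul_sum]
    simp
    field_simp
    ring


/-! ### The limiting statistics -/

/-- The limit of `T̂_{S₁,S₂}` as a function of independent standard Gaussian vectors. -/
def limStat {k m : ℕ} (r : Fin k → ℝ) (S : Finset (Fin m) × Finset (Fin m))
    (z : Fin m → EuclideanSpace ℝ (Fin k)) : ℝ :=
  quadForm r (∑ l, unitWeight S l • z l)

theorem polyGrowth_limStat {k m : ℕ} (r : Fin k → ℝ) (S : Finset (Fin m) × Finset (Fin m)) :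
    PolyGrowth (limStat r S) := polyGrowth_quadForm r (unitWeight S)

/-- The average of the `τ`-th powers. -/
def powerMean {ι : Type*} (A : Finset ι) (x : ι → ℝ) (τ : ℕ) : ℝ :=
  (A.card : ℝ)⁻¹ * ∑ i ∈ A, x i ^ τ

/-- The squared error of `M₁⁻¹ ∘ M₂⁻¹` at `t`. -/
def sqError {k : ℕ} (r : Fin k → ℝ) (j : Fin k) (t : ℕ → ℝ) : ℝ :=
  (eigenModulus k (powerSums t) j - r j) ^ 2

/-- The asymptotic mean squared error. -/
def limMSE {k : ℕ} (r : Fin k → ℝ) (rule : SelectionRule) (j : Fin k) (m : ℕ) : ℝ :=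
  ∫ z, sqError r j (powerMean (rule.pairs m) fun S => limStat r S z) ∂(stdGaussians (Fin m) k)

/-- The covariance of the centred powers of `∑ r_a x_a²` and `∑ r_a y_a²`, for standard Gaussian
vectors `x` and `y` with correlation `ρ`. -/
def quadCov {k : ℕ} (r : Fin k → ℝ) (τ : ℕ) (ρ : ℝ) : ℝ :=
  ∫ z, (quadForm r (z 0) ^ τ - quadMoment r τ) *
    (quadForm r (ρ • z 0 + √(1 - ρ ^ 2) • z 1) ^ τ - quadMoment r τ) ∂(stdGaussians (Fin 2) k)

theorem integral_quadForm_cov {ι : Type*} [Fintype ι] {k : ℕ} (r : Fin k → ℝ) (τ : ℕ) {w w' : ι → ℝ}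
    (hw : ∑ l, w l ^ 2 = 1) (hw' : ∑ l, w' l ^ 2 = 1) :
    ∫ z, (quadForm r (∑ l, w l • z l) ^ τ - quadMoment r τ) *
      (quadForm r (∑ l, w' l • z l) ^ τ - quadMoment r τ) ∂(stdGaussians ι k) =
      quadCov r τ (∑ l, w l * w' l) := by
  set ρ := ∑ l, w l * w' l with hρ
  have hρ1 : ρ ^ 2 ≤ 1 := by
    have := Finset.sum_mul_sq_le_sq_mul_sq Finset.univ w w'
    rwa [hw, hw', one_mul] at this
  -- The vectors `(1, 0)` and `(ρ, √(1 - ρ²))` have the same Gram matrix as `w` and `w'`.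
  have h := integral_pair_stdGaussians_congr (k := k) (a := w) (b := w') (a' := ![1, 0])
    (b' := ![ρ, √(1 - ρ ^ 2)]) (by simpa using hw)
    (by
      simp [Fin.sum_univ_two, hw']
      rw [Real.sq_sqrt (by linarith)]; ring)
    (by simp [Fin.sum_univ_two, hρ])
    (f := fun x => (quadForm r x.1 ^ τ - quadMoment r τ) * (quadForm r x.2 ^ τ - quadMoment r τ))
    (((((continuous_quadForm r).comp continuous_fst).pow τ).sub continuous_const).mul
      ((((continuous_quadForm r).comp continuous_snd).pow τ).sub continuous_const))
  simp only at h
  rw [h, quadCov]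
  simp [Fin.sum_univ_two]

/-- At correlation zero the two factors are independent and centred. -/
theorem quadCov_zero {k : ℕ} (r : Fin k → ℝ) (τ : ℕ) : quadCov r τ 0 = 0 := by
  have h : ∀ z : Fin 2 → EuclideanSpace ℝ (Fin k), (quadForm r (z 0) ^ τ - quadMoment r τ) *
      (quadForm r ((0 : ℝ) • z 0 + √(1 - 0 ^ 2) • z 1) ^ τ - quadMoment r τ) =
      ∏ i, (quadForm r (z i) ^ τ - quadMoment r τ) := by
    intro z; simp [Fin.prod_univ_two]
  rw [quadCov]
  simp_rw [h]
  rw [integral_fintype_prod_eq_prod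
    (f := fun _ x => quadForm r x ^ τ - quadMoment r τ), Fin.prod_univ_two]
  have h1 : ∫ x, (quadForm r x ^ τ - quadMoment r τ) ∂(stdGaussian (EuclideanSpace ℝ (Fin k))) = 0 := by
    rw [integral_sub _ (integrable_const _)]
    · simp [quadMoment]
    · refine PolyGrowth.integrable (PolyGrowth.pow ?_ τ) _
      exact ⟨continuous_quadForm r, ∑ a, |r a|, 2, fun x => (abs_quadForm_le r x).trans (by
        gcongr; linarith [norm_nonneg x])⟩
  rw [h1, zero_mul]

theorem continuousOn_quadCov {k : ℕ} (r : Fin k → ℝ) (τ : ℕ) :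
    ContinuousOn (quadCov r τ) (Set.Icc (-1) 1) := by
  set R := ∑ a, |r a| with hR
  have hR0 : 0 ≤ R := Finset.sum_nonneg fun _ _ => abs_nonneg _
  have hpg : ∀ i : Fin 2, PolyGrowth fun z : Fin 2 → EuclideanSpace ℝ (Fin k) => quadForm r (z i) :=
    fun i => by simpa using polyGrowth_quadForm r (Pi.single i (1 : ℝ))
  have hnorm : PolyGrowth fun z : Fin 2 → EuclideanSpace ℝ (Fin k) => ‖z‖ :=
    ⟨continuous_norm, 1, 1, fun z => by simp⟩
  have hdom : PolyGrowth fun z : Fin 2 → EuclideanSpace ℝ (Fin k) =>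
      ((R * (2 * ‖z‖) ^ 2) ^ τ + |quadMoment r τ|) * ((R * (2 * ‖z‖) ^ 2) ^ τ + |quadMoment r τ|) := by
    have h1 := (((PolyGrowth.const R).mul (((PolyGrowth.const 2).mul hnorm).pow 2)).pow τ).add
      (PolyGrowth.const |quadMoment r τ|)
    exact h1.mul h1
  have hbound : ∀ (x : EuclideanSpace ℝ (Fin k)) (z : Fin 2 → EuclideanSpace ℝ (Fin k)),
      ‖x‖ ≤ 2 * ‖z‖ → |quadForm r x ^ τ - quadMoment r τ| ≤
        (R * (2 * ‖z‖) ^ 2) ^ τ + |quadMoment r τ| := by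
    intro x z hx
    refine (abs_sub _ _).trans (add_le_add ?_ le_rfl)
    rw [abs_pow]
    gcongr
    exact (abs_quadForm_le r x).trans (by gcongr)
  refine continuousOn_of_dominated (bound := fun z : Fin 2 → EuclideanSpace ℝ (Fin k) =>
      ((R * (2 * ‖z‖) ^ 2) ^ τ + |quadMoment r τ|) * ((R * (2 * ‖z‖) ^ 2) ^ τ + |quadMoment r τ|))
    ?_ ?_ (hdom.integrable _) ?_
  · intro ρ _
    have := continuous_quadForm r
    exact Continuous.aestronglyMeasurable (by fun_prop)
  · intro ρ hρ
    refine ae_of_all _ fun z => ?_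
    rw [norm_mul, Real.norm_eq_abs, Real.norm_eq_abs]
    have hz0 := norm_le_pi_norm z 0
    have hz1 := norm_le_pi_norm z 1
    refine mul_le_mul (hbound _ z (by linarith [norm_nonneg z])) (hbound _ z ?_) (abs_nonneg _)
      (by positivity)
    refine (norm_add_le _ _).trans ?_
    rw [norm_smul, norm_smul, Real.norm_eq_abs, Real.norm_eq_abs, two_mul]
    refine add_le_add ?_ ?_
    · exact (mul_le_of_le_one_left (norm_nonneg _) (abs_le.2 hρ)).trans hz0
    · refine (mul_le_of_le_one_left (norm_nonneg _) ?_).trans hz1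
      rw [abs_of_nonneg (Real.sqrt_nonneg _), Real.sqrt_le_one]
      nlinarith [sq_nonneg ρ]
  · refine ae_of_all _ fun z => Continuous.continuousOn ?_
    have := continuous_quadForm r
    fun_prop

/-- Continuity at `0`, where the covariance vanishes, settles `|ρ| < δ`, and boundedness settles the
rest with `C = |B| / δ ^ 2`. No formula for the covariance is needed. The bound is quadratic in `ρ`
because the mean of `ρ ^ 2` over all couples of pairs is known. -/
theorem exists_quadCov_bound {k : ℕ} (r : Fin k → ℝ) (τ : ℕ) {ε : ℝ} (hε : 0 < ε) :
    ∃ C, 0 ≤ C ∧ ∀ ρ ∈ Set.Icc (-1 : ℝ) 1, quadCov r τ ρ ≤ ε + C * ρ ^ 2 := by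
  obtain ⟨B, hB⟩ := isCompact_Icc.exists_bound_of_continuousOn (continuousOn_quadCov r τ)
  have h0 := (continuousOn_quadCov r τ) 0 (by norm_num)
  rw [Metric.continuousWithinAt_iff] at h0
  obtain ⟨δ, hδ, h⟩ := h0 ε hε
  refine ⟨|B| / δ ^ 2, by positivity, fun ρ hρ => ?_⟩
  by_cases hρδ : |ρ| < δ
  · have := h hρ (by simpa [Real.dist_eq] using hρδ)
    rw [quadCov_zero, Real.dist_eq, sub_zero] at this
    have h1 : 0 ≤ |B| / δ ^ 2 * ρ ^ 2 := by positivity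
    linarith [le_abs_self (quadCov r τ ρ)]
  · push Not at hρδ
    have h1 : |B| ≤ |B| / δ ^ 2 * ρ ^ 2 := by
      rw [div_mul_eq_mul_div, le_div_iff₀ (by positivity), ← sq_abs ρ]
      gcongr
    have h2 := hB ρ hρ
    rw [Real.norm_eq_abs] at h2
    linarith [le_abs_self (quadCov r τ ρ), le_abs_self B]

theorem polyGrowth_powerMean {k m : ℕ} (r : Fin k → ℝ) (A : Finset (Finset (Fin m) × Finset (Fin m)))
    (τ : ℕ) : PolyGrowth fun z => powerMean A (fun S => limStat r S z) τ :=
  (PolyGrowth.const _).mul (PolyGrowth.sum A fun S _ => (polyGrowth_limStat r S).pow τ)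

/-- The variance of the average is the mean of the covariances, which depend only on the
correlations of the unit weights. Their mean square is `1 / (m - 1)`. -/
theorem exists_variance_powerMean_bound {k : ℕ} (r : Fin k → ℝ) (rule : SelectionRule) (τ : ℕ) {ε : ℝ}
    (hε : 0 < ε) : ∃ C, 0 ≤ C ∧ ∀ m, 2 ≤ m →
      ∫ z, (powerMean (rule.pairs m) (fun S => limStat r S z) τ - quadMoment r τ) ^ 2
        ∂(stdGaussians (Fin m) k) ≤ ε + C * ((m : ℝ) - 1)⁻¹ := by
  obtain ⟨C, hC0, hC⟩ := exists_quadCov_bound r τ hε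
  refine ⟨C, hC0, fun m hm => ?_⟩
  obtain ⟨hcard, hsum⟩ := sum_sq_inner_unitWeight hm rule
  set A := rule.pairs m with hA
  have hc : (A.card : ℝ) ≠ 0 := by exact_mod_cast hcard.ne'
  have hunit : ∀ S ∈ A, ∑ l, unitWeight S l ^ 2 = 1 := fun S hS =>
    sum_unitWeight_sq (rule.mem_pairs hm hS).1 (rule.mem_pairs hm hS).2.1 (rule.mem_pairs hm hS).2.2
  have hexp : ∀ z, (powerMean A (fun S => limStat r S z) τ - quadMoment r τ) ^ 2 =
      (A.card : ℝ)⁻¹ ^ 2 * ∑ S ∈ A, ∑ S' ∈ A, (limStat r S z ^ τ - quadMoment r τ) *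
        (limStat r S' z ^ τ - quadMoment r τ) := by
    intro z
    rw [← Finset.sum_mul_sum, powerMean, Finset.sum_sub_distrib, Finset.sum_const, nsmul_eq_mul]
    field_simp
  have hpg : ∀ S : Finset (Fin m) × Finset (Fin m), PolyGrowth fun z =>
      limStat r S z ^ τ - quadMoment r τ := fun S =>
    ((polyGrowth_limStat r S).pow τ).sub (PolyGrowth.const (quadMoment r τ))
  simp_rw [hexp]
  rw [integral_const_mul, integral_finsetSum]
  swap
  · exact fun S _ => PolyGrowth.integrable
      (PolyGrowth.sum A fun S' _ => (hpg S).mul (hpg S')) _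
  have hint : ∀ S ∈ A, ∫ z, ∑ S' ∈ A, (limStat r S z ^ τ - quadMoment r τ) *
        (limStat r S' z ^ τ - quadMoment r τ) ∂(stdGaussians (Fin m) k) =
        ∑ S' ∈ A, quadCov r τ (∑ l, unitWeight S l * unitWeight S' l) := by
    intro S hS
    rw [integral_finsetSum]
    · exact Finset.sum_congr rfl fun S' hS' => integral_quadForm_cov r τ (hunit S hS) (hunit S' hS')
    · exact fun S' _ => PolyGrowth.integrable ((hpg S).mul (hpg S')) _
  rw [Finset.sum_congr rfl hint]
  calc (A.card : ℝ)⁻¹ ^ 2 * ∑ S ∈ A, ∑ S' ∈ A, quadCov r τ (∑ l, unitWeight S l * unitWeight S' l)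
      ≤ (A.card : ℝ)⁻¹ ^ 2 * ∑ S ∈ A, ∑ S' ∈ A,
        (ε + C * (∑ l, unitWeight S l * unitWeight S' l) ^ 2) := by
        gcongr with S hS S' hS'
        refine hC _ (abs_le.1 ?_)
        rw [← sq_le_one_iff_abs_le_one]
        have := Finset.sum_mul_sq_le_sq_mul_sq Finset.univ (unitWeight S) (unitWeight S')
        rwa [hunit S hS, hunit S' hS', one_mul] at this
    _ = ε + C * ((m : ℝ) - 1)⁻¹ := by
        rw [← hsum]
        simp_rw [Finset.sum_add_distrib, ← Finset.mul_sum]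
        simp only [Finset.sum_const, nsmul_eq_mul]
        field_simp

theorem tendsto_variance_powerMean {k : ℕ} (r : Fin k → ℝ) (rule : SelectionRule) (τ : ℕ) :
    Tendsto (fun m : ℕ => ∫ z, (powerMean (rule.pairs m) (fun S => limStat r S z) τ -
      quadMoment r τ) ^ 2 ∂(stdGaussians (Fin m) k)) atTop (𝓝 0) := by
  rw [Metric.tendsto_atTop']
  intro ε hε
  obtain ⟨C, hC0, hC⟩ := exists_variance_powerMean_bound r rule τ (half_pos hε)
  have h1 : Tendsto (fun m : ℕ => ε / 2 + C * ((m : ℝ) - 1)⁻¹) atTop (𝓝 (ε / 2 + C * 0)) :=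
    tendsto_const_nhds.add (tendsto_const_nhds.mul (tendsto_inv_atTop_zero.comp
      (tendsto_atTop_add_const_right _ _ tendsto_natCast_atTop_atTop)))
  have h2 := (h1.eventually_lt_const (by linarith : ε / 2 + C * 0 < ε)).and (eventually_ge_atTop 2)
  obtain ⟨N, hN⟩ := eventually_atTop.1 h2
  refine ⟨N, fun m hm => ?_⟩
  rw [Real.dist_eq, sub_zero, abs_of_nonneg (integral_nonneg fun z => sq_nonneg _)]
  exact (hC m (hN m hm.le).2).trans_lt (hN m hm.le).1

theorem continuous_sqError {k : ℕ} (r : Fin k → ℝ) (j : Fin k) : Continuous (sqError r j) :=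
  ((continuous_eigenModulus_powerSums j).sub continuous_const).pow 2

theorem sqError_nonneg {k : ℕ} (r : Fin k → ℝ) (j : Fin k) (t : ℕ → ℝ) : 0 ≤ sqError r j t :=
  sq_nonneg _

theorem exists_sqError_growth {k : ℕ} (r : Fin k → ℝ) (j : Fin k) : ∃ C, 0 ≤ C ∧
    ∀ (t : ℕ → ℝ) (l : ℝ), 0 < l → (∀ i, 1 ≤ i → i ≤ k → |t i| ≤ l ^ i) →
      sqError r j t ≤ C * (1 + l ^ 2) := by
  obtain ⟨C, hC0, hC⟩ := exists_bound_eigenModulus j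
  refine ⟨2 * C ^ 2 + 2 * r j ^ 2, by positivity, fun t l hl ht => ?_⟩
  have h := hC t l hl ht
  have h1 : eigenModulus k (powerSums t) j ^ 2 ≤ (C * l) ^ 2 := sq_le_sq.2 (by
    rwa [abs_of_nonneg (by positivity : 0 ≤ C * l)])
  rw [sqError]
  nlinarith [sq_nonneg (eigenModulus k (powerSums t) j + r j), sq_nonneg (r j), sq_nonneg C,
    sq_nonneg l, mul_nonneg (sq_nonneg (r j)) (sq_nonneg l)]

theorem exists_sqError_quadratic {k : ℕ} (r : Fin k → ℝ) (j : Fin k) (μ : ℕ → ℝ) : ∃ C, 0 ≤ C ∧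
    ∀ t : ℕ → ℝ, sqError r j t ≤ C * (1 + ∑ i ∈ Finset.Icc 1 k, (t i - μ i) ^ 2) := by
  obtain ⟨C, hC0, hC⟩ := exists_sqError_growth r j
  refine ⟨C * (2 + 2 * (k + 1) * (1 + 2 * (k + 1) * (1 + ∑ i ∈ Finset.Icc 1 k, μ i ^ 2))),
    by positivity, fun t => ?_⟩
  set D := ∑ i ∈ Finset.Icc 1 k, (t i - μ i) ^ 2 with hD
  set M := ∑ i ∈ Finset.Icc 1 k, μ i ^ 2 with hM
  have hD0 : 0 ≤ D := Finset.sum_nonneg fun _ _ => sq_nonneg _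
  have hM0 : 0 ≤ M := Finset.sum_nonneg fun _ _ => sq_nonneg _
  set T := ∑ i ∈ Finset.Icc 1 k, |t i| with hT
  have hT0 : 0 ≤ T := Finset.sum_nonneg fun _ _ => abs_nonneg _
  -- The scale `1 + T` is at least one and at least `|t i|`, hence its `i`-th power is at least `|t
  -- i|` too.
  have h1 := hC t (1 + T) (by linarith) fun i hi1 hi2 => by
    have h2 : |t i| ≤ T := Finset.single_le_sum (f := fun i => |t i|) (fun _ _ => abs_nonneg _)
      (Finset.mem_Icc.2 ⟨hi1, hi2⟩)
    exact (h2.trans (by linarith)).trans (le_self_pow₀ (by linarith) (by omega))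
  have hTsq : T ^ 2 ≤ k * (2 * D + 2 * M) := by
    have h3 := sq_sum_le_card_mul_sum_sq (s := Finset.Icc 1 k) (f := fun i => |t i|)
    rw [Nat.card_Icc, Nat.add_sub_cancel] at h3
    refine h3.trans ?_
    gcongr
    rw [hD, hM, Finset.mul_sum, Finset.mul_sum, ← Finset.sum_add_distrib]
    refine Finset.sum_le_sum fun i _ => ?_
    rw [sq_abs]
    nlinarith [sq_nonneg (t i - 2 * μ i)]
  have hk : (0 : ℝ) ≤ k := Nat.cast_nonneg k
  refine h1.trans ?_
  rw [mul_assoc C]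
  refine mul_le_mul_of_nonneg_left ?_ hC0
  have h4 : 1 + (1 + T) ^ 2 ≤ 3 + 4 * k * (D + M) := by nlinarith [sq_nonneg (T - 1)]
  refine h4.trans ?_
  nlinarith [mul_nonneg hk hD0, mul_nonneg hk hM0, mul_nonneg (mul_nonneg hk hM0) hD0,
    mul_nonneg hM0 hD0, mul_nonneg (mul_nonneg hk hk) hM0, mul_nonneg (mul_nonneg hk hk) hD0,
    mul_nonneg (mul_nonneg (mul_nonneg hk hk) hM0) hD0, mul_nonneg hk hk]

/-- Near `μ` continuity gives `ε`. Away from `μ` one of the coordinates in a finite set deviates by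
at least `d`, so the constant term of the quadratic growth bound is absorbed into the sum of
squares. Finitely many coordinates suffice because a neighbourhood in the product topology restricts
no more; `Icc 1 k` is added for the growth bound. -/
theorem exists_sqError_small {k : ℕ} (r : Fin k → ℝ) (j : Fin k) (μ : ℕ → ℝ)
    (hμ : sqError r j μ = 0) {ε : ℝ} (hε : 0 < ε) : ∃ (I : Finset ℕ) (C : ℝ), 0 ≤ C ∧
      ∀ t : ℕ → ℝ, sqError r j t ≤ ε + C * ∑ i ∈ I, (t i - μ i) ^ 2 := by
  obtain ⟨C, hC0, hC⟩ := exists_sqError_quadratic r j μ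
  have hopen : {t | sqError r j t < ε} ∈ 𝓝 μ :=
    (continuous_sqError r j).continuousAt.eventually_lt_const (by rw [hμ]; exact hε)
  rw [nhds_pi, Filter.mem_pi] at hopen
  obtain ⟨I, hI, U, hU, hsub⟩ := hopen
  choose! δ hδ hball using fun i => Metric.mem_nhds_iff.1 (hU i)
  set J := hI.toFinset ∪ Finset.Icc 1 k with hJ
  obtain ⟨d, hd0, hd⟩ : ∃ d > 0, ∀ i ∈ I, d ≤ δ i := by
    rcases hI.toFinset.eq_empty_or_nonempty with h | h
    · exact ⟨1, one_pos, fun i hi => by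
        have := hI.mem_toFinset.2 hi; rw [h] at this; simp at this⟩
    · refine ⟨hI.toFinset.inf' h δ, (Finset.lt_inf'_iff h).2 fun i _ => hδ i, fun i hi =>
        Finset.inf'_le _ (hI.mem_toFinset.2 hi)⟩
  refine ⟨J, C + C / d ^ 2, by positivity, fun t => ?_⟩
  set D := ∑ i ∈ J, (t i - μ i) ^ 2 with hD
  have hD0 : 0 ≤ D := Finset.sum_nonneg fun _ _ => sq_nonneg _
  by_cases ht : ∀ i ∈ I, |t i - μ i| < d
  · have : sqError r j t < ε := hsub fun i hi => hball i (by
      rw [Metric.mem_ball, Real.dist_eq]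
      exact (ht i hi).trans_le (hd i hi))
    have : 0 ≤ (C + C / d ^ 2) * D := by positivity
    linarith
  · push Not at ht
    obtain ⟨i, hi, hti⟩ := ht
    have h1 : d ^ 2 ≤ D := by
      calc d ^ 2 ≤ |t i - μ i| ^ 2 := by gcongr
        _ = (t i - μ i) ^ 2 := sq_abs _
        _ ≤ D := Finset.single_le_sum (f := fun i => (t i - μ i) ^ 2) (fun _ _ => sq_nonneg _)
          (Finset.mem_union_left _ (hI.mem_toFinset.2 hi))
    have h2 : ∑ i ∈ Finset.Icc 1 k, (t i - μ i) ^ 2 ≤ D :=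
      Finset.sum_le_sum_of_subset_of_nonneg Finset.subset_union_right fun _ _ _ => sq_nonneg _
    have h3 : C ≤ C / d ^ 2 * D := by
      rw [div_mul_eq_mul_div, le_div_iff₀ (by positivity)]
      gcongr
    have h4 := hC t
    have h5 : C * ∑ i ∈ Finset.Icc 1 k, (t i - μ i) ^ 2 ≤ C * D := by gcongr
    nlinarith

/-- The error vanishes at the exact moments, and the averaged powers converge to them in mean
square. -/
theorem tendsto_limMSE {k : ℕ} {r : Fin k → ℝ} (hr : Antitone r) (h0 : ∀ a, 0 ≤ r a)
    (rule : SelectionRule) (j : Fin k) : Tendsto (limMSE r rule j) atTop (𝓝 0) := by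
  have hμ : sqError r j (quadMoment r) = 0 := by
    rw [sqError, eigenModulus_powerSums_quadMoment j hr h0, sub_self]; simp
  rw [Metric.tendsto_atTop']
  intro ε hε
  obtain ⟨I, C, hC0, hC⟩ := exists_sqError_small r j (quadMoment r) hμ (half_pos hε)
  have h1 : Tendsto (fun m : ℕ => ε / 2 + C * ∑ i ∈ I, ∫ z, (powerMean (rule.pairs m)
      (fun S => limStat r S z) i - quadMoment r i) ^ 2 ∂(stdGaussians (Fin m) k)) atTop
      (𝓝 (ε / 2 + C * ∑ i ∈ I, (0 : ℝ))) :=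
    tendsto_const_nhds.add (tendsto_const_nhds.mul
      (tendsto_finsetSum _ fun i _ => tendsto_variance_powerMean r rule i))
  have h2 := h1.eventually_lt_const (show ε / 2 + C * ∑ i ∈ I, (0 : ℝ) < ε by simp; linarith)
  obtain ⟨N, hN⟩ := eventually_atTop.1 h2
  refine ⟨N, fun m hm => ?_⟩
  rw [Real.dist_eq, sub_zero, limMSE, abs_of_nonneg (integral_nonneg fun z => sqError_nonneg _ _ _)]
  refine lt_of_le_of_lt ?_ (hN m hm.le)
  have hpg : ∀ i, PolyGrowth fun z => (powerMean (rule.pairs m) (fun S => limStat r S z) i -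
      quadMoment r i) ^ 2 := fun i =>
    ((polyGrowth_powerMean r _ i).sub (PolyGrowth.const _)).pow 2
  have hdom : PolyGrowth fun z => ε / 2 + C * ∑ i ∈ I, (powerMean (rule.pairs m)
      (fun S => limStat r S z) i - quadMoment r i) ^ 2 :=
    (PolyGrowth.const _).add ((PolyGrowth.const _).mul (PolyGrowth.sum I fun i _ => hpg i))
  calc ∫ z, sqError r j (powerMean (rule.pairs m) fun S => limStat r S z) ∂(stdGaussians (Fin m) k)
      ≤ ∫ z, (ε / 2 + C * ∑ i ∈ I, (powerMean (rule.pairs m) (fun S => limStat r S z) i -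
        quadMoment r i) ^ 2) ∂(stdGaussians (Fin m) k) := by
        refine integral_mono_of_nonneg (ae_of_all _ fun z => sqError_nonneg _ _ _)
          (hdom.integrable _) (ae_of_all _ fun z => hC _)
    _ = _ := by
        rw [integral_add (integrable_const _)
          (PolyGrowth.integrable ((PolyGrowth.const C).mul (PolyGrowth.sum I fun i _ => hpg i)) _),
          integral_const_mul, integral_finsetSum _ fun i _ => (hpg i).integrable _]
        simp


/-! ### The filter of events whose probability tends to one -/

section ProbFilter

variable {Ω : ℕ → Type*} [∀ n, MeasurableSpace (Ω n)] (P : ∀ n, Measure (Ω n))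

/-- The filter generated by the events whose probability tends to one: convergence along it is
convergence in probability. -/
def probFilter : Filter (Σ n, Ω n) where
  sets := {s | Tendsto (fun n => P n {ω | (⟨n, ω⟩ : Σ n, Ω n) ∉ s}) atTop (𝓝 0)}
  univ_sets := by simp
  sets_of_superset := by
    intro s t hs hst
    exact tendsto_of_tendsto_of_tendsto_of_le_of_le tendsto_const_nhds hs (fun n => zero_le)
      fun n => measure_mono fun ω hω h => hω (hst h)
  inter_sets := by
    intro s t hs ht
    have h := Tendsto.add (show Tendsto _ _ _ from hs) (show Tendsto _ _ _ from ht)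
    rw [add_zero] at h
    refine tendsto_of_tendsto_of_tendsto_of_le_of_le tendsto_const_nhds h (fun n => zero_le)
      fun n => ?_
    refine (measure_mono ?_).trans (measure_union_le _ _)
    intro ω hω
    by_contra hc
    simp only [Set.mem_union, Set.mem_ofPred_eq, not_or, not_not] at hc
    exact hω ⟨hc.1, hc.2⟩

variable {P}

theorem eventually_probFilter {p : (Σ n, Ω n) → Prop} :
    (∀ᶠ x in probFilter P, p x) ↔ Tendsto (fun n => P n {ω | ¬ p ⟨n, ω⟩}) atTop (𝓝 0) :=
  Iff.rfl

theorem eventually_probFilter_of_ae {p : (Σ n, Ω n) → Prop} (h : ∀ n, ∀ᵐ ω ∂(P n), p ⟨n, ω⟩) :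
    ∀ᶠ x in probFilter P, p x := by
  rw [eventually_probFilter]
  have : ∀ n, P n {ω | ¬ p ⟨n, ω⟩} = 0 := fun n => h n
  simp [this]

theorem tendsto_fst_probFilter : Tendsto (Sigma.fst : (Σ n, Ω n) → ℕ) (probFilter P) atTop := by
  rw [tendsto_atTop]
  intro N
  rw [eventually_probFilter]
  refine tendsto_const_nhds.congr' ?_
  filter_upwards [eventually_ge_atTop N] with n hn
  simp [hn]

instance [∀ n, IsProbabilityMeasure (P n)] : (probFilter P).NeBot := by
  rw [neBot_iff]
  intro h
  have h1 : ∀ᶠ x in probFilter P, False := by rw [h]; trivial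
  rw [eventually_probFilter] at h1
  simp at h1

theorem tendsto_probFilter {β : Type*} [PseudoMetricSpace β] {f : (Σ n, Ω n) → β} {c : β} :
    Tendsto f (probFilter P) (𝓝 c) ↔
      ∀ ε > 0, Tendsto (fun n => P n {ω | ε ≤ dist (f ⟨n, ω⟩) c}) atTop (𝓝 0) := by
  rw [Metric.tendsto_nhds]
  simp only [eventually_probFilter, not_lt]

/-- Bounded convergence for convergence in probability to a constant. The integrands live on
different spaces, so the integral of the difference is split at distance `ε / 2`. -/
theorem tendsto_integral_of_tendsto_probFilter {𝕜 : Type*} [NormedAddCommGroup 𝕜] [NormedSpace ℝ 𝕜]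
    [CompleteSpace 𝕜] [MeasurableSpace 𝕜] [BorelSpace 𝕜]
    [∀ n, IsProbabilityMeasure (P n)] {f : (Σ n, Ω n) → 𝕜} {c : 𝕜} {M : ℝ}
    (hf : ∀ n, AEStronglyMeasurable (fun ω => f ⟨n, ω⟩) (P n)) (hM : ∀ n, ∀ᵐ ω ∂(P n), ‖f ⟨n, ω⟩‖ ≤ M)
    (h : Tendsto f (probFilter P) (𝓝 c)) :
    Tendsto (fun n => ∫ ω, f ⟨n, ω⟩ ∂(P n)) atTop (𝓝 c) := by
  rw [Metric.tendsto_nhds]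
  intro ε hε
  have h1 := tendsto_probFilter.1 h (ε / 2) (half_pos hε)
  have h1' : Tendsto (fun n => (P n).real {ω | ε / 2 ≤ dist (f ⟨n, ω⟩) c}) atTop (𝓝 0) := by
    have := (ENNReal.tendsto_toReal ENNReal.zero_ne_top).comp h1
    rw [ENNReal.toReal_zero] at this
    exact this
  have h2 : Tendsto (fun n => ε / 2 + (M + ‖c‖) *
      (P n).real {ω | ε / 2 ≤ dist (f ⟨n, ω⟩) c}) atTop (𝓝 (ε / 2 + (M + ‖c‖) * 0)) :=
    tendsto_const_nhds.add (tendsto_const_nhds.mul h1')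
  filter_upwards [h2.eventually_lt_const (show ε / 2 + (M + ‖c‖) * 0 < ε by linarith)] with n hn
  refine lt_of_le_of_lt ?_ hn
  have hint : Integrable (fun ω => f ⟨n, ω⟩) (P n) :=
    Integrable.of_bound (hf n) M (hM n)
  have hmeas : NullMeasurableSet {ω | ε / 2 ≤ dist (f ⟨n, ω⟩) c} (P n) :=
    nullMeasurableSet_le aemeasurable_const ((hf n).dist aestronglyMeasurable_const).aemeasurable
  rw [dist_eq_norm]
  have e1 : ∫ ω, f ⟨n, ω⟩ ∂(P n) - c = ∫ ω, (f ⟨n, ω⟩ - c) ∂(P n) := by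
    rw [integral_sub hint (integrable_const _)]; simp
  rw [e1]
  have hind : Integrable (fun ω => {ω | ε / 2 ≤ dist (f ⟨n, ω⟩) c}.indicator
      (fun _ => M + ‖c‖) ω) (P n) := (integrable_const _).indicator₀ hmeas
  calc ‖∫ ω, (f ⟨n, ω⟩ - c) ∂(P n)‖ ≤ ∫ ω, ‖f ⟨n, ω⟩ - c‖ ∂(P n) := norm_integral_le_integral_norm _
    _ ≤ ∫ ω, (ε / 2 + {ω | ε / 2 ≤ dist (f ⟨n, ω⟩) c}.indicator (fun _ => M + ‖c‖) ω) ∂(P n) := by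
        refine integral_mono_of_nonneg (ae_of_all _ fun _ => norm_nonneg _)
          ((integrable_const _).add hind) ?_
        filter_upwards [hM n] with ω hMω
        by_cases hω : ε / 2 ≤ dist (f ⟨n, ω⟩) c
        · rw [Set.indicator_of_mem (by exact hω)]
          have := norm_sub_le (f ⟨n, ω⟩) c
          linarith
        · rw [Set.indicator_of_notMem (by exact hω), add_zero, ← dist_eq_norm]
          exact (not_le.1 hω).le
    _ = ε / 2 + (M + ‖c‖) * (P n).real {ω | ε / 2 ≤ dist (f ⟨n, ω⟩) c} := by
        rw [integral_add (integrable_const _) hind, integral_indicator₀ hmeas]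
        simp [mul_comm]

end ProbFilter

/-! ### Conditional independence and the conditional expectation kernel -/

/-- Conditional independence supplies one null set for each choice of events. With countably many
generating events the null sets can be united. -/
theorem exists_countable_piSystem (E : Type*) [m : MeasurableSpace E]
    [MeasurableSpace.CountablyGenerated E] : ∃ C : Set (Set E), C.Countable ∧ IsPiSystem C ∧
      Set.univ ∈ C ∧ MeasurableSpace.generateFrom C = m := by
  have hcb := MeasurableSpace.countable_countableGeneratingSet (α := E)
  refine ⟨(fun s => ⋂₀ s) '' {s | s.Finite ∧ s ⊆ MeasurableSpace.countableGeneratingSet E},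
    (Set.countable_ofPred_finite_subset hcb).image _, ?_, ?_, ?_⟩
  · rintro _ ⟨s, hs, rfl⟩ _ ⟨t, ht, rfl⟩ _
    exact ⟨s ∪ t, ⟨hs.1.union ht.1, Set.union_subset hs.2 ht.2⟩, Set.sInter_union s t⟩
  · exact ⟨∅, ⟨Set.finite_empty, Set.empty_subset _⟩, Set.sInter_empty⟩
  · apply le_antisymm
    · refine MeasurableSpace.generateFrom_le ?_
      rintro _ ⟨s, hs, rfl⟩
      exact MeasurableSet.sInter hs.1.countable fun t ht =>
        MeasurableSpace.measurableSet_countableGeneratingSet (hs.2 ht)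
    · refine (MeasurableSpace.generateFrom_countableGeneratingSet (α := E)).symm.le.trans ?_
      refine MeasurableSpace.generateFrom_mono fun s hs => ?_
      exact ⟨{s}, ⟨Set.finite_singleton s, Set.singleton_subset_iff.2 hs⟩, Set.sInter_singleton s⟩

/-- Outside one null set the product formula holds on a countable generating π-system, and this
determines the conditional joint law. -/
theorem ae_map_condExpKernel_eq_pi {Ω E : Type*} {σ : MeasurableSpace Ω} [mΩ : MeasurableSpace Ω] [StandardBorelSpace Ω]
    [MeasurableSpace E] [MeasurableSpace.CountablyGenerated E] {μ : Measure Ω}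
    [IsFiniteMeasure μ] (hσ : σ ≤ mΩ) {ι : Type*} [Fintype ι]
    {X : ι → Ω → E} (hX : ∀ i, Measurable (X i)) (hind : iCondIndepFun σ hσ X μ) :
    ∀ᵐ ω ∂μ, (condExpKernel μ σ ω).map (fun ω' i => X i ω') =
      Measure.pi fun i => (condExpKernel μ σ ω).map (X i) := by
  obtain ⟨C, hCc, hCpi, hCuniv, hCgen⟩ := exists_countable_piSystem E
  have hCmeas : ∀ s ∈ C, MeasurableSet s := fun s hs => by
    rw [← hCgen]; exact MeasurableSpace.measurableSet_generateFrom hs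
  have : Countable C := hCc
  have h1 : ∀ s : ι → C, ∀ᵐ ω ∂μ, condExpKernel μ σ ω (⋂ i, X i ⁻¹' (s i : Set E)) =
      ∏ i, condExpKernel μ σ ω (X i ⁻¹' (s i : Set E)) := by
    intro s
    have h := (Kernel.iIndepFun_iff_measure_inter_preimage_eq_mul _ _).1 hind Finset.univ
      (sets := fun i => (s i : Set E)) fun i _ => hCmeas _ (s i).2
    simpa using ae_of_ae_trim hσ h
  filter_upwards [ae_all_iff.2 h1] with ω hω
  refine (Measure.pi_eq_generateFrom (fun _ => hCgen) (fun _ => hCpi) (fun i => ?_) ?_).symm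
  · exact ⟨fun _ => Set.univ, fun _ => hCuniv, fun _ => measure_lt_top _ _, Set.iUnion_const _⟩
  · intro s hs
    rw [Measure.map_apply (by fun_prop) (MeasurableSet.univ_pi fun i => hCmeas _ (hs i))]
    simp_rw [Measure.map_apply (hX _) (hCmeas _ (hs _))]
    rw [← hω fun i => ⟨s i, hs i⟩]
    congr 1
    ext; simp

/-- The trimmed measure composed with its conditional kernel is the law of `(ω, ω)`, so a
`σ`-measurable function takes the same value at both coordinates. Under the conditional law,
`θ̂_obs` may therefore be treated as a constant. -/
theorem ae_condExpKernel_eq {Ω E : Type*} {σ : MeasurableSpace Ω} [mΩ : MeasurableSpace Ω] [StandardBorelSpace Ω]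
    [MeasurableSpace E] [MeasurableEq E] {μ : Measure Ω}
    [IsFiniteMeasure μ] (hσ : σ ≤ mΩ) {c : Ω → E} (hc : Measurable[σ] c) :
    ∀ᵐ ω ∂μ, ∀ᵐ ω' ∂(condExpKernel μ σ ω), c ω' = c ω := by
  have h := compProd_trim_condExpKernel (μ := μ) hσ
  have h2 : ∀ᵐ x ∂((μ.trim hσ) ⊗ₘ (condExpKernel μ σ)), c x.2 = c x.1 := by
    rw [h]
    have hm2 : @Measurable _ _ (σ.prod mΩ) _ fun x : Ω × Ω => c x.2 :=
      (hc.mono hσ le_rfl).comp (@measurable_snd Ω Ω σ mΩ)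
    have hm1 : @Measurable _ _ (σ.prod mΩ) _ fun x : Ω × Ω => c x.1 :=
      hc.comp (@measurable_fst Ω Ω σ mΩ)
    have hdiag : @Measurable Ω (Ω × Ω) mΩ (σ.prod mΩ) Function.diag :=
      @Measurable.prodMk Ω mΩ Ω Ω σ mΩ _ _ (measurable_id'' hσ) measurable_id
    refine (@ae_map_iff Ω (Ω × Ω) mΩ (σ.prod mΩ) μ Function.diag (@Measurable.aemeasurable Ω (Ω × Ω) mΩ (σ.prod mΩ) _ μ hdiag) _ ?_).2 ?_
    · exact @measurableSet_eq_fun _ _ (σ.prod mΩ) _ _ _ _ hm2 hm1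
    · exact ae_of_all _ fun _ => rfl
  have h3 := Measure.ae_ae_of_ae_compProd h2
  exact ae_of_ae_trim hσ h3


/-! ### Joint weak convergence of conditionally independent vectors -/

/-- Cosine and sine are separated because conditional convergence is assumed for real test
functions. -/
theorem integral_cexp_inner {Ω E : Type*} [MeasurableSpace Ω] [NormedAddCommGroup E]
    [InnerProductSpace ℝ E] [MeasurableSpace E] [BorelSpace E] (κ : Measure Ω) [IsFiniteMeasure κ]
    {Z : Ω → E} (hZ : Measurable Z) (t : E) :
    ∫ ω, Complex.exp ((inner ℝ (Z ω) t : ℝ) * Complex.I) ∂κ =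
      ((∫ ω, Real.cos (inner ℝ (Z ω) t) ∂κ : ℝ) : ℂ) +
        ((∫ ω, Real.sin (inner ℝ (Z ω) t) ∂κ : ℝ) : ℂ) * Complex.I := by
  have hin : Measurable fun ω => inner ℝ (Z ω) t :=
    (show Continuous fun x : E => inner ℝ x t by fun_prop).measurable.comp hZ
  have hc : Integrable (fun ω => Real.cos (inner ℝ (Z ω) t)) κ :=
    Integrable.of_bound (Real.measurable_cos.comp hin).aestronglyMeasurable 1
      (ae_of_all _ fun ω => Real.abs_cos_le_one _)
  have hs : Integrable (fun ω => Real.sin (inner ℝ (Z ω) t)) κ :=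
    Integrable.of_bound (Real.measurable_sin.comp hin).aestronglyMeasurable 1
      (ae_of_all _ fun ω => Real.abs_sin_le_one _)
  simp_rw [Complex.exp_mul_I, ← Complex.ofReal_cos, ← Complex.ofReal_sin]
  rw [integral_add hc.ofReal (hs.ofReal.mul_const _), integral_mul_const]
  simp only [integral_complex_ofReal]

section CondIndep

variable {E : Type*} [NormedAddCommGroup E] [InnerProductSpace ℝ E] [FiniteDimensional ℝ E]
  [MeasurableSpace E] [BorelSpace E] {ι : Type*} [Fintype ι]

/-- Given `σ`, the centring `c` is constant and the variables are independent, so the conditional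
characteristic function factors. -/
theorem ae_integral_condExpKernel_eq_prod {Ω : Type*} {σ : MeasurableSpace Ω}
    [mΩ : MeasurableSpace Ω] [StandardBorelSpace Ω] {μ : Measure Ω} [IsProbabilityMeasure μ]
    (hσ : σ ≤ mΩ) {X : ι → Ω → E} (hX : ∀ i, Measurable (X i)) (hind : iCondIndepFun σ hσ X μ)
    {c : Ω → E} (hc : Measurable[σ] c) (s : ℝ) (t : ι → E) :
    ∀ᵐ ω ∂μ, ∫ ω', Complex.exp (((∑ i, inner ℝ (s • (X i ω' - c ω')) (t i) : ℝ) : ℂ) * Complex.I)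
        ∂(condExpKernel μ σ ω) =
      ∏ i, ∫ ω', Complex.exp ((inner ℝ (s • (X i ω' - c ω')) (t i) : ℝ) * Complex.I)
        ∂(condExpKernel μ σ ω) := by
  filter_upwards [ae_map_condExpKernel_eq_pi hσ hX hind, ae_condExpKernel_eq hσ hc] with ω h1 h2
  have e1 : ∀ i, ∫ ω', Complex.exp ((inner ℝ (s • (X i ω' - c ω')) (t i) : ℝ) * Complex.I)
        ∂(condExpKernel μ σ ω) =
      ∫ x, Complex.exp ((inner ℝ (s • (x - c ω)) (t i) : ℝ) * Complex.I)
        ∂((condExpKernel μ σ ω).map (X i)) := by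
    intro i
    rw [integral_map (hX i).aemeasurable (Continuous.aestronglyMeasurable (by fun_prop))]
    refine integral_congr_ae ?_
    filter_upwards [h2] with ω' hω'
    rw [hω']
  simp_rw [e1]
  have := fun i => Measure.isProbabilityMeasure_map (μ := condExpKernel μ σ ω) (hX i).aemeasurable
  rw [← integral_fintype_prod_eq_prod
    (f := fun i x => Complex.exp ((inner ℝ (s • (x - c ω)) (t i) : ℝ) * Complex.I)), ← h1,
    integral_map (Measurable.aemeasurable (by fun_prop))
      (Continuous.aestronglyMeasurable (by fun_prop))]
  refine integral_congr_ae ?_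
  filter_upwards [h2] with ω' hω'
  rw [hω', Complex.ofReal_sum, Finset.sum_mul, Complex.exp_sum]

variable {Ω : ℕ → Type*} {σ : ∀ n, MeasurableSpace (Ω n)} [mΩ : ∀ n, MeasurableSpace (Ω n)]
  [∀ n, StandardBorelSpace (Ω n)]
  {P : ∀ n, Measure (Ω n)} [∀ n, IsProbabilityMeasure (P n)]

/-- Each conditional characteristic function converges in probability to a constant, hence so does
their product. Being bounded by one, it may be integrated, and the tower property removes the
conditioning. -/
theorem tendsto_integral_cexp_of_iCondIndepFun (hσ : ∀ n, σ n ≤ mΩ n)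
    {X : ∀ n, ι → Ω n → E} (hX : ∀ n i, Measurable (X n i))
    (hind : ∀ n, iCondIndepFun (σ n) (hσ n) (X n) (P n))
    {c : ∀ n, Ω n → E} (hc : ∀ n, Measurable[σ n] (c n)) (s : ℕ → ℝ) {ν : Measure E}
    [IsProbabilityMeasure ν]
    (hlim : ∀ i, ∀ g : E →ᵇ ℝ, ∀ ε > 0, Tendsto (fun n => (P n) {ω | ε ≤
      |((P n)[fun ω' => g (s n • (X n i ω' - c n ω')) | σ n]) ω - ∫ z, g z ∂ν|}) atTop (𝓝 0))
    (t : ι → E) :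
    Tendsto (fun n => ∫ ω, Complex.exp (((∑ i, inner ℝ (s n • (X n i ω - c n ω)) (t i) : ℝ) : ℂ) *
      Complex.I) ∂(P n)) atTop (𝓝 (∏ i, charFun ν (t i))) := by
  have hc' : ∀ n, Measurable (c n) := fun n => (hc n).mono (hσ n) le_rfl
  have hZ : ∀ n i, Measurable fun ω => s n • (X n i ω - c n ω) := fun n i =>
    ((hX n i).sub (hc' n)).const_smul (s n)
  have hlim' : ∀ i, ∀ g : E →ᵇ ℝ, Tendsto (fun x : Σ n, Ω n =>
      ∫ ω', g (s x.1 • (X x.1 i ω' - c x.1 ω')) ∂(condExpKernel (P x.1) (σ x.1) x.2))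
      (probFilter P) (𝓝 (∫ z, g z ∂ν)) := by
    intro i g
    have h1 : Tendsto (fun x : Σ n, Ω n =>
        ((P x.1)[fun ω' => g (s x.1 • (X x.1 i ω' - c x.1 ω')) | σ x.1]) x.2)
        (probFilter P) (𝓝 (∫ z, g z ∂ν)) := tendsto_probFilter.2 (hlim i g)
    refine h1.congr' (eventually_probFilter_of_ae fun n => ?_)
    have hint : Integrable (fun ω' => g (s n • (X n i ω' - c n ω'))) (P n) :=
      Integrable.of_bound (g.continuous.measurable.comp (hZ n i)).aestronglyMeasurable ‖g‖
      (ae_of_all _ fun ω => g.norm_coe_le_norm _)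
    exact condExp_ae_eq_integral_condExpKernel (hσ n) hint
  let gc : E → (E →ᵇ ℝ) := fun u => BoundedContinuousFunction.ofNormedAddCommGroup
    (fun z => Real.cos (inner ℝ z u)) (by fun_prop) 1 fun z => Real.abs_cos_le_one _
  let gs : E → (E →ᵇ ℝ) := fun u => BoundedContinuousFunction.ofNormedAddCommGroup
    (fun z => Real.sin (inner ℝ z u)) (by fun_prop) 1 fun z => Real.abs_sin_le_one _
  have hfac : ∀ i, Tendsto (fun x : Σ n, Ω n => ∫ ω', Complex.exp
      ((inner ℝ (s x.1 • (X x.1 i ω' - c x.1 ω')) (t i) : ℝ) * Complex.I)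
        ∂(condExpKernel (P x.1) (σ x.1) x.2)) (probFilter P) (𝓝 (charFun ν (t i))) := by
    intro i
    have h1 := (hlim' i (gc (t i))).ofReal
    have h2 := (hlim' i (gs (t i))).ofReal
    have h3 := h1.add (h2.mul_const Complex.I)
    have e := integral_cexp_inner ν measurable_id (t i)
    rw [charFun_apply]
    simp only [id] at e
    rw [e]
    refine h3.congr fun x => ?_
    rw [integral_cexp_inner _ (hZ x.1 i)]
    rfl
  have hprod : Tendsto (fun x : Σ n, Ω n => ∏ i, ∫ ω', Complex.exp
      ((inner ℝ (s x.1 • (X x.1 i ω' - c x.1 ω')) (t i) : ℝ) * Complex.I)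
        ∂(condExpKernel (P x.1) (σ x.1) x.2)) (probFilter P) (𝓝 (∏ i, charFun ν (t i))) :=
    tendsto_finsetProd _ fun i _ => hfac i
  have hint : ∀ n, Integrable (fun ω => Complex.exp
      (((∑ i, inner ℝ (s n • (X n i ω - c n ω)) (t i) : ℝ) : ℂ) * Complex.I)) (P n) := by
    intro n
    refine Integrable.of_bound (Measurable.aestronglyMeasurable ?_) 1
      (ae_of_all _ fun ω => (Complex.norm_exp_ofReal_mul_I _).le)
    have h0 : Measurable fun ω => ∑ i, inner ℝ (s n • (X n i ω - c n ω)) (t i) :=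
      Finset.measurable_sum _ fun i _ =>
        (show Continuous fun x : E => inner ℝ x (t i) by fun_prop).measurable.comp (hZ n i)
    exact Complex.measurable_exp.comp ((Complex.measurable_ofReal.comp h0).mul_const _)
  have hae : ∀ n, (fun ω => ∏ i, ∫ ω', Complex.exp
      ((inner ℝ (s n • (X n i ω' - c n ω')) (t i) : ℝ) * Complex.I)
        ∂(condExpKernel (P n) (σ n) ω)) =ᵐ[P n] (P n)[fun ω => Complex.exp
      (((∑ i, inner ℝ (s n • (X n i ω - c n ω)) (t i) : ℝ) : ℂ) * Complex.I) | σ n] := by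
    intro n
    filter_upwards [condExp_ae_eq_integral_condExpKernel (hσ n) (hint n),
      ae_integral_condExpKernel_eq_prod (hσ n) (hX n) (hind n) (hc n) (s n) t] with ω h1 h2
    rw [h1, h2]
  have := tendsto_integral_of_tendsto_probFilter (M := 1) (fun n =>
    (stronglyMeasurable_condExp.mono (hσ n)).aestronglyMeasurable.congr (hae n).symm)
    (fun n => ae_of_all _ fun ω => ?_)
      hprod
  · refine this.congr fun n => ?_
    rw [integral_congr_ae (hae n), integral_condExp (hσ n)]
  · rw [norm_prod]
    refine Finset.prod_le_one (fun _ _ => norm_nonneg _) fun i _ => ?_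
    refine (norm_integral_le_integral_norm _).trans ?_
    simp_rw [Complex.norm_exp_ofReal_mul_I]
    simp

theorem tendsto_integral_of_iCondIndepFun (hσ : ∀ n, σ n ≤ mΩ n)
    {X : ∀ n, ι → Ω n → E} (hX : ∀ n i, Measurable (X n i))
    (hind : ∀ n, iCondIndepFun (σ n) (hσ n) (X n) (P n))
    {c : ∀ n, Ω n → E} (hc : ∀ n, Measurable[σ n] (c n)) (s : ℕ → ℝ) {ν : Measure E}
    [IsProbabilityMeasure ν]
    (hlim : ∀ i, ∀ g : E →ᵇ ℝ, ∀ ε > 0, Tendsto (fun n => (P n) {ω | ε ≤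
      |((P n)[fun ω' => g (s n • (X n i ω' - c n ω')) | σ n]) ω - ∫ z, g z ∂ν|}) atTop (𝓝 0))
    (g : (ι → E) →ᵇ ℝ) :
    Tendsto (fun n => ∫ ω, g (fun i => s n • (X n i ω - c n ω)) ∂(P n)) atTop
      (𝓝 (∫ z, g z ∂(Measure.pi fun _ : ι => ν))) := by
  have hc' : ∀ n, Measurable (c n) := fun n => (hc n).mono (hσ n) le_rfl
  have hZ : ∀ n, Measurable fun ω => fun i => s n • (X n i ω - c n ω) := fun n =>
    measurable_pi_lambda _ fun i => ((hX n i).sub (hc' n)).const_smul (s n)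
  -- Lévy's continuity theorem uses an inner product, so the product space is given its Euclidean
  -- norm, which induces the same topology.
  have hto : Measurable (WithLp.toLp 2 : (ι → E) → PiLp 2 fun _ : ι => E) :=
    (PiLp.continuous_toLp 2 _).measurable
  have hZ' := fun n => hto.comp (hZ n)
  let μs : ℕ → ProbabilityMeasure (PiLp 2 fun _ : ι => E) := fun n =>
    ⟨(P n).map (WithLp.toLp 2 ∘ fun ω i => s n • (X n i ω - c n ω)),
      Measure.isProbabilityMeasure_map (hZ' n).aemeasurable⟩
  let μ₀ : ProbabilityMeasure (PiLp 2 fun _ : ι => E) :=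
    ⟨(Measure.pi fun _ : ι => ν).map (WithLp.toLp 2),
      Measure.isProbabilityMeasure_map hto.aemeasurable⟩
  have h : Tendsto μs atTop (𝓝 μ₀) := by
    rw [ProbabilityMeasure.tendsto_iff_tendsto_charFun]
    intro t
    have e0 : charFun (μ₀ : Measure _) t = ∏ i, charFun ν (t i) :=
      charFun_pi (μ := fun _ => ν) t
    rw [e0]
    refine (tendsto_integral_cexp_of_iCondIndepFun hσ hX hind hc s hlim (fun i => t i)).congr
      fun n => ?_
    rw [charFun_apply]
    refine Eq.trans ?_ (integral_map (hZ' n).aemeasurable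
      (Continuous.aestronglyMeasurable (by fun_prop))).symm
    simp [PiLp.inner_apply]
  rw [ProbabilityMeasure.tendsto_iff_forall_integral_tendsto] at h
  have h1 := h (g.compContinuous ⟨WithLp.ofLp, PiLp.continuous_ofLp 2 _⟩)
  have e1 : ∫ z, (g.compContinuous ⟨WithLp.ofLp, PiLp.continuous_ofLp 2 _⟩) z ∂(μ₀ : Measure _) =
      ∫ z, g z ∂(Measure.pi fun _ : ι => ν) :=
    integral_map hto.aemeasurable (BoundedContinuousFunction.continuous _).aestronglyMeasurable
  rw [e1] at h1
  refine h1.congr fun n => ?_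
  exact integral_map (hZ' n).aemeasurable
    (BoundedContinuousFunction.continuous _).aestronglyMeasurable

end CondIndep

/-! ### Slutsky's lemma and convergence of moments -/

section Slutsky

variable {Ω : ℕ → Type*} [mΩ : ∀ n, MeasurableSpace (Ω n)] {P : ∀ n, Measure (Ω n)}
  [∀ n, IsProbabilityMeasure (P n)] {F : Type*} [PseudoMetricSpace F] [MeasurableSpace F]
  [BorelSpace F]

/-- Weak convergence may be tested on bounded Lipschitz functions. For these the two integrands
differ by a bounded quantity that tends to zero in probability. -/
theorem tendsto_integral_of_tendsto_dist {X Y : ∀ n, Ω n → F} (hX : ∀ n, Measurable (X n))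
    (hY : ∀ n, Measurable (Y n)) {ν : Measure F} [IsProbabilityMeasure ν]
    (hlim : ∀ g : F →ᵇ ℝ, Tendsto (fun n => ∫ ω, g (Y n ω) ∂(P n)) atTop (𝓝 (∫ z, g z ∂ν)))
    (hXY : Tendsto (fun x : Σ n, Ω n => dist (X x.1 x.2) (Y x.1 x.2)) (probFilter P) (𝓝 0))
    (g : F →ᵇ ℝ) :
    Tendsto (fun n => ∫ ω, g (X n ω) ∂(P n)) atTop (𝓝 (∫ z, g z ∂ν)) := by
  let μs : ℕ → ProbabilityMeasure F := fun n =>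
    ⟨(P n).map (X n), Measure.isProbabilityMeasure_map (hX n).aemeasurable⟩
  let μ₀ : ProbabilityMeasure F := ⟨ν, inferInstance⟩
  have hmap : ∀ (n : ℕ) (f : F → ℝ), Continuous f →
      ∫ x, f x ∂(μs n : Measure F) = ∫ ω, f (X n ω) ∂(P n) := fun n f hf =>
    integral_map (hX n).aemeasurable hf.aestronglyMeasurable
  suffices h : Tendsto μs atTop (𝓝 μ₀) by
    rw [ProbabilityMeasure.tendsto_iff_forall_integral_tendsto] at h
    exact (h g).congr fun n => hmap n g g.continuous
  rw [tendsto_iff_forall_lipschitz_integral_tendsto]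
  rintro f ⟨C, hC⟩ ⟨L, hL⟩
  let f' : F →ᵇ ℝ := ⟨⟨f, hL.continuous⟩, C, hC⟩
  have hbd : ∀ x, ‖f x‖ ≤ ‖f'‖ := fun x => f'.norm_coe_le_norm x
  have hfX : ∀ n, AEStronglyMeasurable (fun ω => f (X n ω)) (P n) := fun n =>
    (hL.continuous.measurable.comp (hX n)).aestronglyMeasurable
  have hfY : ∀ n, AEStronglyMeasurable (fun ω => f (Y n ω)) (P n) := fun n =>
    (hL.continuous.measurable.comp (hY n)).aestronglyMeasurable
  have hdiff : Tendsto (fun x : Σ n, Ω n => f (X x.1 x.2) - f (Y x.1 x.2)) (probFilter P)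
      (𝓝 0) := by
    have h := hXY.const_mul (L : ℝ)
    rw [mul_zero] at h
    refine squeeze_zero_norm (fun x => ?_) h
    rw [← dist_eq_norm]
    exact hL.dist_le_mul _ _
  have h1 := tendsto_integral_of_tendsto_probFilter (M := ‖f'‖ + ‖f'‖)
    (f := fun x : Σ n, Ω n => f (X x.1 x.2) - f (Y x.1 x.2))
    (fun n => (hfX n).sub (hfY n)) (fun n => ae_of_all _ fun ω => (norm_sub_le _ _).trans (add_le_add (hbd _) (hbd _)))
    hdiff
  have h2 := h1.add (hlim f')
  rw [zero_add] at h2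
  refine h2.congr fun n => ?_
  rw [hmap n f hL.continuous]
  have e := integral_sub (Integrable.of_bound (hfX n) _ (ae_of_all _ fun _ => hbd _))
    (Integrable.of_bound (hfY n) _ (ae_of_all _ fun _ => hbd _))
  dsimp only
  rw [e]
  simp [f']

end Slutsky

/-- If `h` exceeds the truncation level, the largest coordinate exceeds `L ≥ 1` in modulus, and its
square then dominates the whole quadratic bound. -/
theorem sub_min_le_sum_sq {ι : Type*} (A : Finset ι) {x : ι → ℝ} {h C L : ℝ} (hC : 0 ≤ C)
    (hL : 1 ≤ L) (hh : h ≤ C * (1 + ∑ i ∈ A, x i ^ 2)) :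
    h - min h (C * (1 + A.card * L ^ 2)) ≤
      C * (1 + A.card) * ∑ i ∈ A, {y : ℝ | L < |y|}.indicator (fun y => y ^ 2) (x i) := by
  have hsum0 : ∀ i ∈ A, 0 ≤ {y : ℝ | L < |y|}.indicator (fun y => y ^ 2) (x i) := fun i _ =>
    Set.indicator_nonneg (fun y _ => sq_nonneg y) _
  have hcard : (0 : ℝ) ≤ A.card := Nat.cast_nonneg _
  rcases le_or_gt h (C * (1 + A.card * L ^ 2)) with hle | hgt
  · rw [min_eq_left hle, sub_self]
    exact mul_nonneg (by positivity) (Finset.sum_nonneg hsum0)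
  · rw [min_eq_right hgt.le]
    have hK : 0 ≤ C * (1 + A.card * L ^ 2) := by positivity
    have hne : A.Nonempty := by
      rw [Finset.nonempty_iff_ne_empty]
      rintro rfl
      simp at hh hgt
      linarith
    obtain ⟨i, hi, hmax⟩ := A.exists_max_image (fun i => x i ^ 2) hne
    have hle : ∑ a ∈ A, x a ^ 2 ≤ A.card * x i ^ 2 := by
      simpa [nsmul_eq_mul] using Finset.sum_le_card_nsmul A (fun a => x a ^ 2) (x i ^ 2) hmax
    have hLx : L < |x i| := by
      by_contra hc
      have h1 : x i ^ 2 ≤ L ^ 2 := by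
        rw [← sq_abs (x i)]
        exact pow_le_pow_left₀ (abs_nonneg _) (not_lt.1 hc) 2
      have h2 : C * (1 + ∑ a ∈ A, x a ^ 2) ≤ C * (1 + A.card * L ^ 2) := by
        refine mul_le_mul_of_nonneg_left ?_ hC
        nlinarith
      linarith
    have hx1 : 1 ≤ x i ^ 2 := by
      rw [← sq_abs (x i)]
      nlinarith [abs_nonneg (x i)]
    have h3 : x i ^ 2 ≤ ∑ a ∈ A, {y : ℝ | L < |y|}.indicator (fun y => y ^ 2) (x a) := by
      refine le_trans (le_of_eq ?_) (Finset.single_le_sum hsum0 hi)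
      rw [Set.indicator_of_mem (by exact hLx)]
    calc h - C * (1 + A.card * L ^ 2) ≤ C * (1 + ∑ a ∈ A, x a ^ 2) := by linarith
      _ ≤ C * ((1 + A.card) * x i ^ 2) := by
          refine mul_le_mul_of_nonneg_left ?_ hC
          nlinarith
      _ ≤ C * ((1 + A.card) * ∑ a ∈ A, {y : ℝ | L < |y|}.indicator (fun y => y ^ 2) (x a)) := by
          gcongr
      _ = _ := by ring

section Moments

variable {Ω : ℕ → Type*} [mΩ : ∀ n, MeasurableSpace (Ω n)] {P : ∀ n, Measure (Ω n)}
  [∀ n, IsProbabilityMeasure (P n)] {ι : Type*} [Fintype ι]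

theorem tendsto_integral_min {T : Type*} [MeasurableSpace T] {ν : Measure T} {h : T → ℝ}
    (hν : Integrable h ν) (h0 : ∀ x, 0 ≤ h x) {K : ℕ → ℝ} (hK : Tendsto K atTop atTop) :
    Tendsto (fun L => ∫ x, min (h x) (K L) ∂ν) atTop (𝓝 (∫ x, h x ∂ν)) := by
  refine tendsto_integral_filter_of_dominated_convergence h ?_ ?_ hν ?_
  · exact Eventually.of_forall fun L => hν.aestronglyMeasurable.inf aestronglyMeasurable_const
  · filter_upwards [hK.eventually_ge_atTop 0] with L hL
    refine ae_of_all _ fun x => ?_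
    rw [Real.norm_of_nonneg (le_min (h0 x) hL)]
    exact min_le_left _ _
  · refine ae_of_all _ fun x => tendsto_const_nhds.congr' ?_
    filter_upwards [hK.eventually_ge_atTop (h x)] with L hL
    rw [min_eq_left hL]

/-- Weak convergence applies to the bounded continuous truncations of `h`. The truncation error is
small for all large `n` by uniform integrability of the squares, and small under `ν` by
integrability. -/
theorem tendsto_integral_of_uniformlyIntegrable {X : ∀ n, Ω n → ι → ℝ}
    (hX : ∀ n, Measurable (X n)) {ν : Measure (ι → ℝ)} [IsProbabilityMeasure ν]
    (hlim : ∀ g : (ι → ℝ) →ᵇ ℝ,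
      Tendsto (fun n => ∫ ω, g (X n ω) ∂(P n)) atTop (𝓝 (∫ z, g z ∂ν)))
    {A : Finset ι} (hui : ∀ i ∈ A, ∀ ε : ℝ≥0∞, 0 < ε → ∃ L : ℝ, ∀ᶠ n in atTop,
      ∫⁻ ω in {ω | L < |X n ω i|}, ENNReal.ofReal (X n ω i ^ 2) ∂(P n) ≤ ε)
    {h : (ι → ℝ) → ℝ} (hc : Continuous h) (h0 : ∀ x, 0 ≤ h x) {C : ℝ} (hC : 0 ≤ C)
    (hh : ∀ x, h x ≤ C * (1 + ∑ i ∈ A, x i ^ 2)) (hν : Integrable h ν) :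
    (∀ᶠ n in atTop, Integrable (fun ω => h (X n ω)) (P n)) ∧
      Tendsto (fun n => ∫ ω, h (X n ω) ∂(P n)) atTop (𝓝 (∫ z, h z ∂ν)) := by
  classical
  set K : ℝ → ℝ := fun L => C * (1 + A.card * L ^ 2) with hKdef
  have hK0 : ∀ L, 0 ≤ K L := fun L => by positivity
  have hmeas : ∀ n, Measurable fun ω => h (X n ω) := fun n => hc.measurable.comp (hX n)
  -- the tails are uniformly small
  have htail : ∀ ε : ℝ, 0 < ε → ∃ L₀ : ℝ, 1 ≤ L₀ ∧ ∀ L, L₀ ≤ L → ∀ᶠ n in atTop,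
      ∫⁻ ω, ENNReal.ofReal (h (X n ω) - min (h (X n ω)) (K L)) ∂(P n) ≤ ENNReal.ofReal ε := by
    intro ε hε
    set D : ℝ := C * (1 + A.card) with hD
    have hD0 : 0 ≤ D := by positivity
    -- The error `ε` is shared among `A.card` tails with common factor `D`; the added ones keep the
    -- denominator positive.
    set e : ℝ := ε / ((D + 1) * (A.card + 1)) with he
    have he0 : 0 < e := by positivity
    have h1 : ∀ i, ∃ L : ℝ, i ∈ A → ∀ᶠ n in atTop,
        ∫⁻ ω in {ω | L < |X n ω i|}, ENNReal.ofReal (X n ω i ^ 2) ∂(P n) ≤ ENNReal.ofReal e := by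
      intro i
      by_cases hi : i ∈ A
      · obtain ⟨L, hL⟩ := hui i hi (ENNReal.ofReal e) (ENNReal.ofReal_pos.2 he0)
        exact ⟨L, fun _ => hL⟩
      · exact ⟨0, fun h => absurd h hi⟩
    choose Li hLi using h1
    refine ⟨1 + ∑ i, |Li i|, le_add_of_nonneg_right (Finset.sum_nonneg fun _ _ => abs_nonneg _),
      fun L hL => ?_⟩
    have hL1 : 1 ≤ L := le_trans
      (le_add_of_nonneg_right (Finset.sum_nonneg fun _ _ => abs_nonneg _)) hL
    have hev : ∀ᶠ n in atTop, ∀ i ∈ A,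
        ∫⁻ ω in {ω | Li i < |X n ω i|}, ENNReal.ofReal (X n ω i ^ 2) ∂(P n) ≤ ENNReal.ofReal e :=
      (Finset.eventually_all A).2 fun i hi => hLi i hi
    filter_upwards [hev] with n hn
    have hXi : ∀ i, Measurable fun ω => X n ω i := fun i => (measurable_pi_apply i).comp (hX n)
    calc ∫⁻ ω, ENNReal.ofReal (h (X n ω) - min (h (X n ω)) (K L)) ∂(P n)
        ≤ ∫⁻ ω, ENNReal.ofReal D *
            ∑ i ∈ A, {ω | L < |X n ω i|}.indicator (fun ω => ENNReal.ofReal (X n ω i ^ 2)) ω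
              ∂(P n) := by
          refine lintegral_mono fun ω => ?_
          refine (ENNReal.ofReal_le_ofReal (sub_min_le_sum_sq A hC hL1 (hh (X n ω)))).trans ?_
          rw [ENNReal.ofReal_mul hD0, ENNReal.ofReal_sum_of_nonneg
            fun i _ => Set.indicator_nonneg (fun y _ => sq_nonneg y) _]
          gcongr with i hi
          by_cases hω : L < |X n ω i|
          · rw [Set.indicator_of_mem (by exact hω), Set.indicator_of_mem (by exact hω)]
          · rw [Set.indicator_of_notMem (by exact hω), Set.indicator_of_notMem (by exact hω)]
            simp
      _ = ENNReal.ofReal D * ∑ i ∈ A,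
            ∫⁻ ω in {ω | L < |X n ω i|}, ENNReal.ofReal (X n ω i ^ 2) ∂(P n) := by
          have hs : ∀ i, MeasurableSet {ω | L < |X n ω i|} := fun i =>
            measurableSet_lt measurable_const (hXi i).abs
          have hm : ∀ i, Measurable ({ω | L < |X n ω i|}.indicator
              (fun ω => ENNReal.ofReal (X n ω i ^ 2))) := fun i =>
            ((hXi i).pow_const 2).ennreal_ofReal.indicator (hs i)
          rw [lintegral_const_mul _ (Finset.measurable_fun_sum _ fun i _ => hm i),
            lintegral_finsetSum _ fun i _ => hm i]
          simp_rw [lintegral_indicator (hs _)]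
      _ ≤ ENNReal.ofReal D * ∑ i ∈ A, ENNReal.ofReal e := by
          gcongr with i hi
          refine le_trans (lintegral_mono_set ?_) (hn i hi)
          intro ω hω
          refine lt_of_le_of_lt ?_ (show L < _ from hω)
          have : |Li i| ≤ ∑ i, |Li i| :=
            Finset.single_le_sum (f := fun i => |Li i|) (fun _ _ => abs_nonneg _)
              (Finset.mem_univ i)
          linarith [le_abs_self (Li i)]
      _ ≤ ENNReal.ofReal ε := by
          rw [Finset.sum_const, nsmul_eq_mul, ← ENNReal.ofReal_natCast,
            ← ENNReal.ofReal_mul (by positivity), ← ENNReal.ofReal_mul hD0]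
          refine ENNReal.ofReal_le_ofReal ?_
          have hA : (0 : ℝ) ≤ A.card := Nat.cast_nonneg _
          rw [he, ← mul_assoc, mul_div_assoc', div_le_iff₀ (by positivity)]
          nlinarith [mul_nonneg hD0 hA, mul_nonneg (mul_nonneg hD0 hA) hε.le, mul_nonneg hD0 hε.le,
            mul_nonneg hA hε.le]
  have hminI : ∀ n L, Integrable (fun ω => min (h (X n ω)) (K L)) (P n) := fun n L =>
    Integrable.of_bound ((hmeas n).min measurable_const).aestronglyMeasurable (K L)
      (ae_of_all _ fun ω => by
        rw [Real.norm_of_nonneg (le_min (h0 _) (hK0 L))]; exact min_le_right _ _)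
  have hdI : ∀ n L, ∫⁻ ω, ENNReal.ofReal (h (X n ω) - min (h (X n ω)) (K L)) ∂(P n) < ⊤ →
      Integrable (fun ω => h (X n ω) - min (h (X n ω)) (K L)) (P n) := by
    intro n L hlt
    refine ⟨((hmeas n).sub ((hmeas n).min measurable_const)).aestronglyMeasurable, ?_⟩
    rw [hasFiniteIntegral_iff_ofReal (ae_of_all _ fun ω => sub_nonneg.2 (min_le_left _ _))]
    exact hlt
  have hI : ∀ n L, ∫⁻ ω, ENNReal.ofReal (h (X n ω) - min (h (X n ω)) (K L)) ∂(P n) < ⊤ →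
      Integrable (fun ω => h (X n ω)) (P n) := by
    intro n L hlt
    exact ((hdI n L hlt).add (hminI n L)).congr (ae_of_all _ fun ω => sub_add_cancel _ _)
  refine ⟨?_, ?_⟩
  · obtain ⟨L, -, hL⟩ := htail 1 one_pos
    filter_upwards [hL L le_rfl] with n hn
    exact hI n L (hn.trans_lt ENNReal.ofReal_lt_top)
  rcases hC.eq_or_lt with hC0 | hCpos
  · have hz : ∀ x, h x = 0 := fun x => le_antisymm (by simpa [← hC0] using hh x) (h0 x)
    simp [hz]
  by_cases hA : A = ∅
  · have hb : ∀ x, ‖h x‖ ≤ C := fun x => by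
      rw [Real.norm_of_nonneg (h0 x)]; simpa [hA] using hh x
    exact hlim (BoundedContinuousFunction.ofNormedAddCommGroup h hc C hb)
  have hcard : (0 : ℝ) < A.card :=
    Nat.cast_pos.2 (Finset.card_pos.2 (Finset.nonempty_iff_ne_empty.2 hA))
  have hKtop : Tendsto (fun L : ℕ => K L) atTop atTop := by
    refine Tendsto.const_mul_atTop hCpos (tendsto_atTop_add_const_left _ _ ?_)
    exact Tendsto.const_mul_atTop hcard
      ((tendsto_pow_atTop two_ne_zero).comp tendsto_natCast_atTop_atTop)
  rw [Metric.tendsto_nhds]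
  intro ε hε
  obtain ⟨L₀, -, hL₀⟩ := htail (ε / 3) (by positivity)
  have hmin := tendsto_integral_min hν h0 hKtop
  obtain ⟨L, hL, hLd⟩ := ((tendsto_natCast_atTop_atTop.eventually_ge_atTop L₀).and
    ((Metric.tendsto_nhds.1 hmin) (ε / 3) (by positivity))).exists
  have hg : ∀ x, ‖min (h x) (K L)‖ ≤ K L := fun x => by
    rw [Real.norm_of_nonneg (le_min (h0 _) (hK0 L))]; exact min_le_right _ _
  have hlimL := hlim (BoundedContinuousFunction.ofNormedAddCommGroup
    (fun x => min (h x) (K L)) (hc.min continuous_const) (K L) hg)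
  filter_upwards [hL₀ L hL, (Metric.tendsto_nhds.1 hlimL) (ε / 3) (by positivity)] with n h1 h2
  have hlt := h1.trans_lt ENNReal.ofReal_lt_top
  have h3 : ∫ ω, (h (X n ω) - min (h (X n ω)) (K L)) ∂(P n) ≤ ε / 3 := by
    rw [integral_eq_lintegral_of_nonneg_ae (ae_of_all _ fun ω => sub_nonneg.2 (min_le_left _ _))
      (hdI n L hlt).aestronglyMeasurable]
    exact ENNReal.toReal_le_of_le_ofReal (by positivity) h1
  have h4 : 0 ≤ ∫ ω, (h (X n ω) - min (h (X n ω)) (K L)) ∂(P n) :=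
    integral_nonneg fun ω => sub_nonneg.2 (min_le_left _ _)
  rw [integral_sub (hI n L hlt) (hminI n L)] at h3 h4
  simp only [BoundedContinuousFunction.coe_ofNormedAddCommGroup, Real.dist_eq, abs_lt] at h2 hLd ⊢
  constructor <;> linarith [h2.1, h2.2, hLd.1, hLd.2]

end Moments

/-! ### Local quadratic expansion of a smooth function -/

section Expansion

variable {k q : ℕ}

theorem fderiv_apply_eq_sum (φ : Param k q →L[ℝ] ℝ) (v : Param k q) :
    φ v = ∑ a, v a * φ (EuclideanSpace.single a 1) := by
  conv_lhs => rw [← (EuclideanSpace.basisFun (Fin k ⊕ Fin q) ℝ).sum_repr v]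
  simp [map_sum]

theorem abs_sum_mul_le (v : Param k q) {c : Fin k ⊕ Fin q → ℝ} {ε : ℝ} (hc : ∀ a, |c a| ≤ ε) :
    |∑ a, v a * c a| ≤ (k + q : ℝ) * ε * ‖v‖ := by
  refine (Finset.abs_sum_le_sum_abs _ _).trans ?_
  have h : ∀ a ∈ Finset.univ, |v a * c a| ≤ ε * ‖v‖ := fun a _ => by
    rw [abs_mul, mul_comm]
    exact mul_le_mul (hc a) (PiLp.norm_apply_le v a) (abs_nonneg _) ((abs_nonneg _).trans (hc a))
  refine (Finset.sum_le_card_nsmul _ _ _ h).trans (le_of_eq ?_)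
  simp [mul_assoc]

/-- Mean value inequality for a partial derivative plus the linear form `Λ` given by a row of `J`:
the derivative of this sum has the entries of `hess g + J`, which are small. -/
theorem abs_grad_sub_le {g : Param k q → ℝ} {s : Set (Param k q)} (ho : IsOpen s)
    (hs : Convex ℝ s) (hg : ContDiffOn ℝ 2 g s) {J : Matrix (Fin k ⊕ Fin q) (Fin k ⊕ Fin q) ℝ}
    (hJ : J.IsSymm) {ε : ℝ} (hε : 0 ≤ ε) (h : ∀ ψ ∈ s, ∀ a b, |hess g ψ a b + J a b| ≤ ε)
    {ψ ψ' : Param k q} (hψ : ψ ∈ s) (hψ' : ψ' ∈ s) (b : Fin k ⊕ Fin q) :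
    |grad g ψ' b - grad g ψ b + (J *ᵥ (ψ' - ψ).ofLp) b| ≤ (k + q : ℝ) * ε * ‖ψ' - ψ‖ := by
  let Λ : Param k q →L[ℝ] ℝ := ∑ a, J b a • EuclideanSpace.proj a
  have hΛ : ∀ y : Param k q, Λ y = (J *ᵥ y.ofLp) b := fun y => by
    simp [Λ, Matrix.mulVec, dotProduct]
  have hd : ∀ y ∈ s, HasFDerivAt (fderiv ℝ g) (fderiv ℝ (fderiv ℝ g) y) y := fun y hy =>
    (((hg.contDiffAt (ho.mem_nhds hy)).fderiv_right (m := 1) (by norm_num)).differentiableAt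
      (by norm_num)).hasFDerivAt
  have hφ : ∀ y ∈ s, HasFDerivAt (fun y => fderiv ℝ g y (EuclideanSpace.single b 1) + Λ y)
      ((fderiv ℝ (fderiv ℝ g) y).flip (EuclideanSpace.single b 1) + Λ) y := by
    intro y hy
    have h1 := (hd y hy).clm_apply (hasFDerivAt_const (EuclideanSpace.single b (1 : ℝ)) y)
    refine HasFDerivAt.add ?_ Λ.hasFDerivAt
    simpa using h1
  have hbd : ∀ y ∈ s, ‖(fderiv ℝ (fderiv ℝ g) y).flip (EuclideanSpace.single b 1) + Λ‖ ≤
      (k + q : ℝ) * ε := by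
    intro y hy
    refine ContinuousLinearMap.opNorm_le_bound _ (by positivity) fun v => ?_
    rw [fderiv_apply_eq_sum]
    refine abs_sum_mul_le v fun a => ?_
    have h2 := h y hy a b
    rw [hess, Matrix.of_apply, iteratedFDeriv_two_apply] at h2
    have h3 : Λ (EuclideanSpace.single a 1) = J a b := by
      rw [hΛ, ← hJ.apply a b]
      simp
    simpa [h3] using h2
  have := hs.norm_image_sub_le_of_norm_hasFDerivWithin_le
    (fun y hy => (hφ y hy).hasFDerivWithinAt) hbd hψ hψ'
  rw [Real.norm_eq_abs] at this
  refine le_trans (le_of_eq ?_) this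
  congr 1
  rw [← hΛ, map_sub, grad, grad]
  ring

/-- Mean value inequality along the segment, where the derivative of the second order remainder is a
first order remainder of the gradient. The constants are crude, as `ε` is arbitrary. -/
theorem abs_value_sub_le {g : Param k q → ℝ} {s : Set (Param k q)} (ho : IsOpen s)
    (hs : Convex ℝ s) (hg : ContDiffOn ℝ 2 g s) {J : Matrix (Fin k ⊕ Fin q) (Fin k ⊕ Fin q) ℝ}
    (hJ : J.IsSymm) {ε : ℝ} (hε : 0 ≤ ε) (h : ∀ ψ ∈ s, ∀ a b, |hess g ψ a b + J a b| ≤ ε)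
    {ψ ψ' : Param k q} (hψ : ψ ∈ s) (hψ' : ψ' ∈ s) :
    |g ψ' - g ψ - grad g ψ ⬝ᵥ (ψ' - ψ).ofLp +
      (1 / 2) * ((ψ' - ψ).ofLp ⬝ᵥ (J *ᵥ (ψ' - ψ).ofLp))| ≤
      (k + q : ℝ) * ((k + q : ℝ) * ε) * ‖ψ' - ψ‖ ^ 2 := by
  set v := ψ' - ψ with hv
  set Q := v.ofLp ⬝ᵥ (J *ᵥ v.ofLp) with hQ
  have hseg : ∀ t ∈ Set.Icc (0 : ℝ) 1, ψ + t • v ∈ s := fun t ht =>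
    hs.add_smul_sub_mem hψ hψ' ht
  have hγ : ∀ t : ℝ, HasDerivAt (fun t : ℝ => ψ + t • v) v t := fun t => by
    simpa using ((hasDerivAt_id t).smul_const v).const_add ψ
  have hp : ∀ t ∈ Set.Icc (0 : ℝ) 1, HasDerivWithinAt
      (fun t : ℝ => g (ψ + t • v) - t * (grad g ψ ⬝ᵥ v.ofLp) + (1 / 2) * (t ^ 2 * Q))
      (fderiv ℝ g (ψ + t • v) v - grad g ψ ⬝ᵥ v.ofLp + t * Q) (Set.Icc 0 1) t := by
    intro t ht
    have hdg : HasFDerivAt g (fderiv ℝ g (ψ + t • v)) (ψ + t • v) :=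
      ((hg.contDiffAt (ho.mem_nhds (hseg t ht))).differentiableAt (by norm_num)).hasFDerivAt
    have h1 := hdg.comp_hasDerivAt t (hγ t)
    have h2 := (hasDerivAt_id t).mul_const (grad g ψ ⬝ᵥ v.ofLp)
    have h3 := (((hasDerivAt_id t).pow 2).mul_const Q).const_mul (1 / 2)
    refine ((h1.sub h2).add h3).hasDerivWithinAt.congr_deriv ?_
    simp
    ring
  have hbd : ∀ t ∈ Set.Icc (0 : ℝ) 1,
      ‖fderiv ℝ g (ψ + t • v) v - grad g ψ ⬝ᵥ v.ofLp + t * Q‖ ≤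
        (k + q : ℝ) * ((k + q : ℝ) * ε * ‖v‖) * ‖v‖ := by
    intro t ht
    have e : fderiv ℝ g (ψ + t • v) v - grad g ψ ⬝ᵥ v.ofLp + t * Q =
        ∑ a, v a * (grad g (ψ + t • v) a - grad g ψ a + (J *ᵥ (ψ + t • v - ψ).ofLp) a) := by
      rw [fderiv_apply_eq_sum]
      simp only [add_sub_cancel_left, WithLp.ofLp_smul, Matrix.mulVec_smul, Pi.smul_apply,
        smul_eq_mul, hQ, dotProduct, Finset.mul_sum, ← Finset.sum_sub_distrib,
        ← Finset.sum_add_distrib, grad]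
      refine Finset.sum_congr rfl fun a _ => ?_
      ring
    rw [e, Real.norm_eq_abs]
    refine abs_sum_mul_le v fun a => ?_
    refine (abs_grad_sub_le ho hs hg hJ hε h hψ (hseg t ht) a).trans ?_
    rw [add_sub_cancel_left, norm_smul, Real.norm_eq_abs, abs_of_nonneg ht.1]
    have : t * ‖v‖ ≤ ‖v‖ := mul_le_of_le_one_left (norm_nonneg _) ht.2
    gcongr
  have := (convex_Icc (0 : ℝ) 1).norm_image_sub_le_of_norm_hasDerivWithin_le hp hbd
    (Set.left_mem_Icc.2 zero_le_one) (Set.right_mem_Icc.2 zero_le_one)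
  rw [Real.norm_eq_abs] at this
  refine le_trans (le_of_eq ?_) (this.trans (le_of_eq ?_))
  · congr 1
    simp [hv]
    ring
  · simp
    ring

end Expansion

/-! ### Convergence in probability on large events -/

/-- A stochastically bounded sequence need not be `O(1)` along `probFilter`, because its bound
depends on the exceptional probability. It is `O(1)` on events of probability at least `1 - ε`, and
a limit established on such events for every `ε` is a limit in probability. -/
theorem tendsto_probFilter_of_inf_principal {Ω : ℕ → Type*} [∀ n, MeasurableSpace (Ω n)]
    {P : ∀ n, Measure (Ω n)} {β : Type*} {l : Filter β} {f : (Σ n, Ω n) → β}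
    (h : ∀ ε : ℝ≥0∞, 0 < ε → ∃ A : Set (Σ n, Ω n),
      (∀ᶠ n in atTop, P n {ω | (⟨n, ω⟩ : Σ n, Ω n) ∉ A} ≤ ε) ∧
        Tendsto f (probFilter P ⊓ 𝓟 A) l) :
    Tendsto f (probFilter P) l := by
  intro s hs
  change Tendsto (fun n => P n {ω | (⟨n, ω⟩ : Σ n, Ω n) ∉ f ⁻¹' s}) atTop (𝓝 0)
  rw [ENNReal.tendsto_nhds_zero]
  intro ε hε
  obtain ⟨A, hA, hf⟩ := h (ε / 2) (ENNReal.half_pos hε.ne')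
  have h1 : ∀ᶠ x in probFilter P, x ∈ A → f x ∈ s :=
    eventually_inf_principal.1 (hf.eventually hs)
  have h2 := ENNReal.tendsto_nhds_zero.1 (eventually_probFilter.1 h1) (ε / 2)
    (ENNReal.half_pos hε.ne')
  filter_upwards [hA, h2] with n hn1 hn2
  calc P n {ω | (⟨n, ω⟩ : Σ n, Ω n) ∉ f ⁻¹' s}
      ≤ P n ({ω | (⟨n, ω⟩ : Σ n, Ω n) ∉ A} ∪
          {ω | ¬ ((⟨n, ω⟩ : Σ n, Ω n) ∈ A → f ⟨n, ω⟩ ∈ s)}) := by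
        refine measure_mono fun ω hω => ?_
        by_cases hωA : (⟨n, ω⟩ : Σ n, Ω n) ∈ A
        · exact Or.inr fun h => hω (h hωA)
        · exact Or.inl hωA
    _ ≤ ε / 2 + ε / 2 := (measure_union_le _ _).trans (add_le_add hn1 hn2)
    _ = ε := ENNReal.add_halves ε

/-! ### Asymptotics of maximum likelihood estimators under local quadratic expansions -/

section Asymptotics

open Asymptotics

variable {α : Type*} {𝓖 : Filter α} {ι κ : Type*} [Fintype ι]

theorem isBigO_one_mulVec [Fintype κ] {v : α → ι → ℝ} (M : Matrix κ ι ℝ)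
    (hv : v =O[𝓖] fun _ => (1 : ℝ)) : (fun x => M *ᵥ v x) =O[𝓖] fun _ => (1 : ℝ) :=
  ((LinearMap.toContinuousLinearMap M.mulVecLin).isBigO_comp v 𝓖).trans hv

theorem tendsto_mulVec_zero {v : α → ι → ℝ} (M : Matrix κ ι ℝ) (hv : Tendsto v 𝓖 (𝓝 0)) :
    Tendsto (fun x => M *ᵥ v x) 𝓖 (𝓝 0) := by
  have h := ((LinearMap.toContinuousLinearMap M.mulVecLin).continuous.tendsto 0).comp hv
  rwa [map_zero] at h

theorem isBigO_one_pi {v : α → ι → ℝ} :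
    (v =O[𝓖] fun _ => (1 : ℝ)) ↔ ∀ a, (fun x => v x a) =O[𝓖] fun _ => (1 : ℝ) :=
  isBigO_pi

theorem tendsto_dotProduct_zero {v w : α → ι → ℝ} (hv : v =O[𝓖] fun _ => (1 : ℝ))
    (hw : Tendsto w 𝓖 (𝓝 0)) : Tendsto (fun x => v x ⬝ᵥ w x) 𝓖 (𝓝 0) := by
  have h : ∀ a ∈ Finset.univ, Tendsto (fun x => v x a * w x a) 𝓖 (𝓝 0) := fun a _ => by
    rw [← isLittleO_one_iff ℝ]
    have hwa : (fun x => w x a) =o[𝓖] fun _ => (1 : ℝ) :=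
      (isLittleO_one_iff ℝ).2 (tendsto_pi_nhds.1 hw a)
    simpa using (isBigO_one_pi.1 hv a).mul_isLittleO hwa
  simpa [dotProduct] using tendsto_finsetSum Finset.univ h

/-- The equation is `K h = y + o(‖h‖)`. After multiplication by `K⁻¹` the error is at most half of
`‖h‖` and is absorbed, which bounds `h`; the error is then `o(1)`. -/
theorem isBigO_of_mulVec_sub_le [DecidableEq ι] {K : Matrix ι ι ℝ} (hK : IsUnit K.det)
    {h y : α → ι → ℝ} (hy : y =O[𝓖] fun _ => (1 : ℝ))
    (hh : ∀ ε > 0, ∀ᶠ x in 𝓖, ‖K *ᵥ h x - y x‖ ≤ ε * ‖h x‖) :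
    (h =O[𝓖] fun _ => (1 : ℝ)) ∧ Tendsto (fun x => K *ᵥ h x - y x) 𝓖 (𝓝 0) := by
  have h1 : h =O[𝓖] fun _ => (1 : ℝ) := by
    set C := ‖LinearMap.toContinuousLinearMap K⁻¹.mulVecLin‖ + 1 with hC
    have hC0 : 0 < C := by positivity
    refine IsBigO.trans ?_ hy
    refine IsBigO.of_bound (2 * C) ?_
    filter_upwards [hh (1 / (2 * C)) (by positivity)] with x hx
    have e : h x = LinearMap.toContinuousLinearMap K⁻¹.mulVecLin (K *ᵥ h x) := by
      simp [Matrix.nonsing_inv_mul _ hK]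
    have h2 : ‖h x‖ ≤ C * ‖K *ᵥ h x‖ := by
      conv_lhs => rw [e]
      refine (ContinuousLinearMap.le_opNorm _ _).trans ?_
      gcongr
      linarith
    have h3 : ‖K *ᵥ h x‖ ≤ ‖y x‖ + 1 / (2 * C) * ‖h x‖ := by
      have := norm_add_le (K *ᵥ h x - y x) (y x)
      rw [sub_add_cancel] at this
      linarith
    have h4 : C * (1 / (2 * C) * ‖h x‖) = ‖h x‖ / 2 := by field_simp
    have h5 := h2.trans (mul_le_mul_of_nonneg_left h3 hC0.le)
    rw [mul_add, h4] at h5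
    linarith
  refine ⟨h1, ?_⟩
  rw [← isLittleO_one_iff ℝ]
  exact (isLittleO_iff.2 fun ε hε => hh ε hε).trans_isBigO h1

variable {k q : ℕ}

/-- Along `𝓖`, the functions `f x` with gradients `G x` have near `ψlim` uniform second order
expansions with the Hessian `-J`. -/
structure LocallyQuadratic (𝓖 : Filter α) (ψlim : Param k q)
    (J : Matrix (Fin k ⊕ Fin q) (Fin k ⊕ Fin q) ℝ) (G : α → Param k q → Fin k ⊕ Fin q → ℝ)
    (f : α → Param k q → ℝ) : Prop where
  grad : ∀ ε > 0, ∃ ρ > 0, ∀ᶠ x in 𝓖, ∀ ψ ∈ Metric.ball ψlim ρ, ∀ ψ' ∈ Metric.ball ψlim ρ,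
    ‖G x ψ' - G x ψ + J *ᵥ (ψ' - ψ).ofLp‖ ≤ ε * ‖(ψ' - ψ).ofLp‖
  value : ∀ ε > 0, ∃ ρ > 0, ∀ᶠ x in 𝓖, ∀ ψ ∈ Metric.ball ψlim ρ, ∀ ψ' ∈ Metric.ball ψlim ρ,
    |f x ψ' - f x ψ - G x ψ ⬝ᵥ (ψ' - ψ).ofLp +
      (1 / 2) * ((ψ' - ψ).ofLp ⬝ᵥ (J *ᵥ (ψ' - ψ).ofLp))| ≤ ε * ‖(ψ' - ψ).ofLp‖ ^ 2

namespace LocallyQuadratic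

variable {ψlim : Param k q} {J J' : Matrix (Fin k ⊕ Fin q) (Fin k ⊕ Fin q) ℝ}
  {G G' : α → Param k q → Fin k ⊕ Fin q → ℝ} {f f' : α → Param k q → ℝ}

theorem zero : LocallyQuadratic 𝓖 ψlim (0 : Matrix (Fin k ⊕ Fin q) (Fin k ⊕ Fin q) ℝ)
    (fun _ _ => 0) fun _ _ => 0 := by
  constructor
  all_goals
    intro ε hε
    refine ⟨1, one_pos, Eventually.of_forall fun x ψ _ ψ' _ => ?_⟩
    simp
    positivity

theorem add (h : LocallyQuadratic 𝓖 ψlim J G f) (h' : LocallyQuadratic 𝓖 ψlim J' G' f') :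
    LocallyQuadratic 𝓖 ψlim (J + J') (fun x ψ => G x ψ + G' x ψ) fun x ψ => f x ψ + f' x ψ := by
  constructor
  · intro ε hε
    obtain ⟨ρ, hρ, h1⟩ := h.grad (ε / 2) (half_pos hε)
    obtain ⟨ρ', hρ', h1'⟩ := h'.grad (ε / 2) (half_pos hε)
    refine ⟨min ρ ρ', lt_min hρ hρ', ?_⟩
    filter_upwards [h1, h1'] with x hx hx' ψ hψ ψ' hψ'
    have b1 := hx ψ (Metric.ball_subset_ball (min_le_left _ _) hψ) ψ'
      (Metric.ball_subset_ball (min_le_left _ _) hψ')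
    have b2 := hx' ψ (Metric.ball_subset_ball (min_le_right _ _) hψ) ψ'
      (Metric.ball_subset_ball (min_le_right _ _) hψ')
    have e : G x ψ' + G' x ψ' - (G x ψ + G' x ψ) + (J + J') *ᵥ (ψ' - ψ).ofLp =
        (G x ψ' - G x ψ + J *ᵥ (ψ' - ψ).ofLp) + (G' x ψ' - G' x ψ + J' *ᵥ (ψ' - ψ).ofLp) := by
      rw [Matrix.add_mulVec]
      abel
    rw [e]
    refine (norm_add_le _ _).trans ((add_le_add b1 b2).trans (le_of_eq ?_))
    ring
  · intro ε hε
    obtain ⟨ρ, hρ, h1⟩ := h.value (ε / 2) (half_pos hε)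
    obtain ⟨ρ', hρ', h1'⟩ := h'.value (ε / 2) (half_pos hε)
    refine ⟨min ρ ρ', lt_min hρ hρ', ?_⟩
    filter_upwards [h1, h1'] with x hx hx' ψ hψ ψ' hψ'
    have b1 := hx ψ (Metric.ball_subset_ball (min_le_left _ _) hψ) ψ'
      (Metric.ball_subset_ball (min_le_left _ _) hψ')
    have b2 := hx' ψ (Metric.ball_subset_ball (min_le_right _ _) hψ) ψ'
      (Metric.ball_subset_ball (min_le_right _ _) hψ')
    refine le_trans (le_trans (le_of_eq ?_) (abs_add_le _ _))
      ((add_le_add b1 b2).trans (le_of_eq (by ring)))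
    congr 1
    rw [Matrix.add_mulVec, dotProduct_add, add_dotProduct]
    ring

theorem sum {m : ℕ} {G : Fin m → α → Param k q → Fin k ⊕ Fin q → ℝ}
    {f : Fin m → α → Param k q → ℝ} (h : ∀ ℓ, LocallyQuadratic 𝓖 ψlim J (G ℓ) (f ℓ))
    (S : Multiset (Fin m)) :
    LocallyQuadratic 𝓖 ψlim ((Multiset.card S : ℝ) • J)
      (fun x ψ => (S.map fun ℓ => G ℓ x ψ).sum) fun x ψ => (S.map fun ℓ => f ℓ x ψ).sum := by
  induction S using Multiset.induction_on with
  | empty => simpa using zero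
  | cons a S ih =>
    simp only [Multiset.map_cons, Multiset.sum_cons, Multiset.card_cons, Nat.cast_add, Nat.cast_one,
      add_smul, one_smul]
    rw [add_comm]
    exact (h a).add ih

theorem mono {𝓖' : Filter α} (h : LocallyQuadratic 𝓖 ψlim J G f) (hle : 𝓖' ≤ 𝓖) :
    LocallyQuadratic 𝓖' ψlim J G f where
  grad ε hε := by
    obtain ⟨ρ, hρ, h1⟩ := h.grad ε hε
    exact ⟨ρ, hρ, h1.filter_mono hle⟩
  value ε hε := by
    obtain ⟨ρ, hρ, h1⟩ := h.value ε hε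
    exact ⟨ρ, hρ, h1.filter_mono hle⟩

theorem scaled_grad (h : LocallyQuadratic 𝓖 ψlim J G f) {ψ ψ' : α → Param k q}
    (hψ : Tendsto ψ 𝓖 (𝓝 ψlim)) (hψ' : Tendsto ψ' 𝓖 (𝓝 ψlim)) (s : α → ℝ) {ε : ℝ} (hε : 0 < ε) :
    ∀ᶠ x in 𝓖, ‖s x • G x (ψ' x) - s x • G x (ψ x) + J *ᵥ (s x • (ψ' x - ψ x).ofLp)‖ ≤
      ε * ‖s x • (ψ' x - ψ x).ofLp‖ := by
  obtain ⟨ρ, hρ, h1⟩ := h.grad ε hε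
  filter_upwards [h1, hψ (Metric.ball_mem_nhds _ hρ), hψ' (Metric.ball_mem_nhds _ hρ)]
    with x hx h2 h3
  have := hx _ h2 _ h3
  rw [Matrix.mulVec_smul, ← smul_sub, ← smul_add, norm_smul, norm_smul, mul_left_comm]
  gcongr

theorem scaled_value (h : LocallyQuadratic 𝓖 ψlim J G f) {ψ ψ' : α → Param k q}
    (hψ : Tendsto ψ 𝓖 (𝓝 ψlim)) (hψ' : Tendsto ψ' 𝓖 (𝓝 ψlim)) {s : α → ℝ}
    (hb : (fun x => s x • (ψ' x - ψ x).ofLp) =O[𝓖] fun _ => (1 : ℝ)) :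
    Tendsto (fun x => s x ^ 2 * (f x (ψ' x) - f x (ψ x)) -
      (s x • G x (ψ x)) ⬝ᵥ (s x • (ψ' x - ψ x).ofLp) +
      (1 / 2) * ((s x • (ψ' x - ψ x).ofLp) ⬝ᵥ (J *ᵥ (s x • (ψ' x - ψ x).ofLp)))) 𝓖 (𝓝 0) := by
  rw [← isLittleO_one_iff ℝ]
  have hb2 : (fun x => ‖s x • (ψ' x - ψ x).ofLp‖ ^ 2) =O[𝓖] fun _ => (1 : ℝ) := by
    simpa using hb.norm_left.pow 2
  refine IsLittleO.trans_isBigO (isLittleO_iff.2 fun ε hε => ?_) hb2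
  obtain ⟨ρ, hρ, h1⟩ := h.value ε hε
  filter_upwards [h1, hψ (Metric.ball_mem_nhds _ hρ), hψ' (Metric.ball_mem_nhds _ hρ)]
    with x hx h2 h3
  have := hx _ h2 _ h3
  have e : s x ^ 2 * (f x (ψ' x) - f x (ψ x)) -
      (s x • G x (ψ x)) ⬝ᵥ (s x • (ψ' x - ψ x).ofLp) +
      (1 / 2) * ((s x • (ψ' x - ψ x).ofLp) ⬝ᵥ (J *ᵥ (s x • (ψ' x - ψ x).ofLp))) =
      s x ^ 2 * (f x (ψ' x) - f x (ψ x) - G x (ψ x) ⬝ᵥ (ψ' x - ψ x).ofLp +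
      (1 / 2) * ((ψ' x - ψ x).ofLp ⬝ᵥ (J *ᵥ (ψ' x - ψ x).ofLp))) := by
    simp only [Matrix.mulVec_smul, smul_dotProduct, dotProduct_smul, smul_eq_mul]
    ring
  rw [e, Real.norm_eq_abs, abs_mul, abs_of_nonneg (sq_nonneg _), Real.norm_of_nonneg (by positivity),
    norm_smul, mul_pow, Real.norm_eq_abs, sq_abs, mul_left_comm]
  gcongr

end LocallyQuadratic

theorem det_toBlocks₂₂_pos {J : Matrix (Fin k ⊕ Fin q) (Fin k ⊕ Fin q) ℝ} (hJ : J.PosDef) :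
    0 < J.toBlocks₂₂.det := (hJ.submatrix Sum.inr_injective).det_pos

end Asymptotics

/-! ### Estimators and test statistics as quadratic forms in the error of `θ` -/

section MLE

open Asymptotics

variable {α : Type*} {𝓖 : Filter α} {k q : ℕ} {ψlim : Param k q}
  {J : Matrix (Fin k ⊕ Fin q) (Fin k ⊕ Fin q) ℝ} {G : α → Param k q → Fin k ⊕ Fin q → ℝ}
  {f : α → Param k q → ℝ} {s : α → ℝ} {ψ₀ ψ₁ ψ₂ : α → Param k q}

theorem mulVec_eq_elim (J : Matrix (Fin k ⊕ Fin q) (Fin k ⊕ Fin q) ℝ) (v : Fin k ⊕ Fin q → ℝ) :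
    J *ᵥ v = Sum.elim (J.toBlocks₁₁ *ᵥ (v ∘ Sum.inl) + J.toBlocks₁₂ *ᵥ (v ∘ Sum.inr))
      (J.toBlocks₂₁ *ᵥ (v ∘ Sum.inl) + J.toBlocks₂₂ *ᵥ (v ∘ Sum.inr)) := by
  conv_lhs => rw [← J.fromBlocks_toBlocks, Matrix.fromBlocks_mulVec]

theorem isSymm_of_posDef {ι : Type*} [Fintype ι] {J : Matrix ι ι ℝ} (hJ : J.PosDef) : J.IsSymm := by
  have := hJ.isHermitian.eq
  rwa [Matrix.conjTranspose_eq_transpose_of_trivial] at this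

theorem tendsto_matrix_inv {ι : Type*} [Fintype ι] [DecidableEq ι] {A : α → Matrix ι ι ℝ}
    {B : Matrix ι ι ℝ} (hB : IsUnit B.det) (hA : Tendsto A 𝓖 (𝓝 B)) :
    Tendsto (fun x => (A x)⁻¹) 𝓖 (𝓝 B⁻¹) := by
  have h : ContinuousAt (fun M : Matrix ι ι ℝ => M⁻¹) B := by
    simp_rw [Matrix.inv_def, Ring.inverse_eq_inv']
    exact (Continuous.matrix_det continuous_id).continuousAt.inv₀ hB.ne_zero |>.smul
      (Continuous.matrix_adjugate continuous_id).continuousAt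
  exact h.tendsto.comp hA

theorem tendsto_inv_sub_mulVec {ι : Type*} [Fintype ι] [DecidableEq ι] {A : α → Matrix ι ι ℝ}
    {B : Matrix ι ι ℝ} {v : α → ι → ℝ} (hB : IsUnit B.det) (hA : Tendsto A 𝓖 (𝓝 B))
    (hv : v =O[𝓖] fun _ => (1 : ℝ)) : Tendsto (fun x => ((A x)⁻¹ - B⁻¹) *ᵥ v x) 𝓖 (𝓝 0) := by
  refine tendsto_pi_nhds.2 fun a => ?_
  have h1 : Tendsto (fun x => ((A x)⁻¹ - B⁻¹) a) 𝓖 (𝓝 0) := by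
    have h2 := (tendsto_matrix_inv hB hA).sub_const B⁻¹
    rw [sub_self] at h2
    exact tendsto_pi_nhds.1 h2 a
  refine (tendsto_dotProduct_zero hv h1).congr fun x => ?_
  rw [dotProduct_comm]
  rfl

namespace LocallyQuadratic

theorem isBigO_score (h : LocallyQuadratic 𝓖 ψlim J G f) (h₀ : Tendsto ψ₀ 𝓖 (𝓝 ψlim))
    (h₁ : Tendsto ψ₁ 𝓖 (𝓝 ψlim)) (hs : (fun x => s x • G x (ψ₀ x)) =O[𝓖] fun _ => (1 : ℝ))
    (hd : (fun x => s x • (ψ₁ x - ψ₀ x).ofLp) =O[𝓖] fun _ => (1 : ℝ)) :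
    (fun x => s x • G x (ψ₁ x)) =O[𝓖] fun _ => (1 : ℝ) := by
  have h1 : (fun x => s x • G x (ψ₁ x) - s x • G x (ψ₀ x) + J *ᵥ (s x • (ψ₁ x - ψ₀ x).ofLp))
      =O[𝓖] fun _ => (1 : ℝ) := by
    refine IsBigO.trans (IsBigO.of_bound 1 ?_) hd
    exact h.scaled_grad h₀ h₁ s one_pos
  have h2 := (h1.sub (isBigO_one_mulVec J hd)).add hs
  refine h2.congr_left fun x => ?_
  abel

/-- A root of the score is asymptotically linear. -/
theorem unrestricted (h : LocallyQuadratic 𝓖 ψlim J G f) (hJ : J.PosDef)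
    (h₀ : Tendsto ψ₀ 𝓖 (𝓝 ψlim)) (h₁ : Tendsto ψ₁ 𝓖 (𝓝 ψlim))
    (hs : (fun x => s x • G x (ψ₀ x)) =O[𝓖] fun _ => (1 : ℝ)) (hroot : ∀ᶠ x in 𝓖, G x (ψ₁ x) = 0) :
    ((fun x => s x • (ψ₁ x - ψ₀ x).ofLp) =O[𝓖] fun _ => (1 : ℝ)) ∧
      Tendsto (fun x => J *ᵥ (s x • (ψ₁ x - ψ₀ x).ofLp) - s x • G x (ψ₀ x)) 𝓖 (𝓝 0) := by
  refine isBigO_of_mulVec_sub_le hJ.det_pos.ne'.isUnit hs fun ε hε => ?_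
  filter_upwards [h.scaled_grad h₀ h₁ s hε, hroot] with x hx hr
  rw [hr, smul_zero] at hx
  refine le_trans (le_of_eq ?_) hx
  congr 1
  abel

/-- A root of the nuisance score under the restriction is asymptotically linear. -/
theorem restricted (h : LocallyQuadratic 𝓖 ψlim J G f) (hJ : J.PosDef)
    (h₀ : Tendsto ψ₀ 𝓖 (𝓝 ψlim)) (h₂ : Tendsto ψ₂ 𝓖 (𝓝 ψlim))
    (hs : (fun x => s x • G x (ψ₀ x)) =O[𝓖] fun _ => (1 : ℝ))
    (hθ : ∀ᶠ x in 𝓖, thetaPart (ψ₂ x) = thetaPart (ψ₀ x))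
    (hroot : ∀ᶠ x in 𝓖, ∀ b, G x (ψ₂ x) (Sum.inr b) = 0) :
    ((fun x => s x • (ψ₂ x - ψ₀ x).ofLp) =O[𝓖] fun _ => (1 : ℝ)) ∧
      ∀ b, Tendsto (fun x => (J *ᵥ (s x • (ψ₂ x - ψ₀ x).ofLp) - s x • G x (ψ₀ x)) (Sum.inr b))
        𝓖 (𝓝 0) := by
  -- The `θ`-rows of `J` are replaced by those of the identity: the restriction fixes the `θ`-part,
  -- and only the nuisance score vanishes. This `K` is invertible because `J.toBlocks₂₂` is positive
  -- definite.
  set K : Matrix (Fin k ⊕ Fin q) (Fin k ⊕ Fin q) ℝ :=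
    Matrix.fromBlocks 1 0 J.toBlocks₂₁ J.toBlocks₂₂ with hK
  have hdet : IsUnit K.det := by
    rw [hK, Matrix.det_fromBlocks_zero₁₂, Matrix.det_one, one_mul]
    exact (det_toBlocks₂₂_pos hJ).ne'.isUnit
  set y : α → Fin k ⊕ Fin q → ℝ := fun x =>
    Sum.elim 0 fun b => (s x • G x (ψ₀ x)) (Sum.inr b) with hy
  have hyO : y =O[𝓖] fun _ => (1 : ℝ) := by
    refine isBigO_one_pi.2 fun a => ?_
    rcases a with a | b
    · exact isBigO_zero (fun _ : α => (1 : ℝ)) 𝓖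
    · exact isBigO_one_pi.1 hs (Sum.inr b)
  have hKJ : ∀ (v : Fin k ⊕ Fin q → ℝ) b, (K *ᵥ v) (Sum.inr b) = (J *ᵥ v) (Sum.inr b) := by
    intro v b
    rw [hK, Matrix.fromBlocks_mulVec, mulVec_eq_elim J]
    rfl
  have key : ∀ ε > 0, ∀ᶠ x in 𝓖, ‖K *ᵥ (s x • (ψ₂ x - ψ₀ x).ofLp) - y x‖ ≤
      ε * ‖s x • (ψ₂ x - ψ₀ x).ofLp‖ := by
    intro ε hε
    filter_upwards [h.scaled_grad h₀ h₂ s hε, hθ, hroot] with x hx hθx hr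
    refine (pi_norm_le_iff_of_nonneg (by positivity)).2 fun a => ?_
    rcases a with a | b
    · have e : (ψ₂ x) (Sum.inl a) = (ψ₀ x) (Sum.inl a) :=
        congrArg (fun v : EuclideanSpace ℝ (Fin k) => v a) hθx
      rw [Pi.sub_apply, hK, Matrix.fromBlocks_mulVec]
      simp only [hy, Sum.elim_inl, Matrix.one_mulVec, Matrix.zero_mulVec, add_zero, Pi.zero_apply,
        Function.comp_apply, Pi.smul_apply, WithLp.ofLp_sub, Pi.sub_apply, e, sub_self, smul_zero,
        norm_zero]
      positivity
    · have h1 := (norm_le_pi_norm _ (Sum.inr b)).trans hx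
      refine le_trans (le_of_eq ?_) h1
      rw [Pi.sub_apply, hKJ]
      simp only [hy, Sum.elim_inr, Pi.add_apply, Pi.sub_apply, Pi.smul_apply, hr b, smul_zero]
      congr 1
      ring
  obtain ⟨h1, h2⟩ := isBigO_of_mulVec_sub_le hdet hyO key
  refine ⟨h1, fun b => ?_⟩
  have h3 := tendsto_pi_nhds.1 h2 (Sum.inr b)
  refine h3.congr fun x => ?_
  rw [Pi.sub_apply, hKJ]
  rfl

/-- Asymptotically, the difference of the two estimators is the least favourable direction. -/
theorem tendsto_mulVec_diff (h : LocallyQuadratic 𝓖 ψlim J G f) (hJ : J.PosDef)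
    (h₀ : Tendsto ψ₀ 𝓖 (𝓝 ψlim)) (h₁ : Tendsto ψ₁ 𝓖 (𝓝 ψlim)) (h₂ : Tendsto ψ₂ 𝓖 (𝓝 ψlim))
    (hs : (fun x => s x • G x (ψ₀ x)) =O[𝓖] fun _ => (1 : ℝ)) (hroot₁ : ∀ᶠ x in 𝓖, G x (ψ₁ x) = 0)
    (hθ : ∀ᶠ x in 𝓖, thetaPart (ψ₂ x) = thetaPart (ψ₀ x))
    (hroot₂ : ∀ᶠ x in 𝓖, ∀ b, G x (ψ₂ x) (Sum.inr b) = 0) :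
    Tendsto (fun x => J *ᵥ (s x • (ψ₁ x - ψ₀ x).ofLp - s x • (ψ₂ x - ψ₀ x).ofLp) -
      Sum.elim (thetaInfo J *ᵥ (s x • (thetaPart (ψ₁ x) - thetaPart (ψ₀ x)).ofLp)) 0) 𝓖 (𝓝 0) := by
  obtain ⟨-, t1⟩ := h.unrestricted hJ h₀ h₁ hs hroot₁
  obtain ⟨-, t2⟩ := h.restricted hJ h₀ h₂ hs hθ hroot₂
  set e : α → Fin k ⊕ Fin q → ℝ := fun x =>
    s x • (ψ₁ x - ψ₀ x).ofLp - s x • (ψ₂ x - ψ₀ x).ofLp with he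
  set w : α → Fin k → ℝ := fun x => s x • (thetaPart (ψ₁ x) - thetaPart (ψ₀ x)).ofLp with hw
  have heθ : ∀ᶠ x in 𝓖, e x ∘ Sum.inl = w x := by
    filter_upwards [hθ] with x hx
    funext a
    have e2 : (ψ₂ x) (Sum.inl a) = (ψ₀ x) (Sum.inl a) :=
      congrArg (fun v : EuclideanSpace ℝ (Fin k) => v a) hx
    simp [he, hw, e2, thetaPart]
  -- Both estimators annihilate the nuisance score, so the nuisance rows of `J e` tend to zero. This
  -- determines the nuisance part of `e` from its `θ`-part, and its elimination from the `θ`-rows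
  -- leaves the Schur complement `thetaInfo J`.
  have hη : Tendsto (fun x => J.toBlocks₂₁ *ᵥ w x + J.toBlocks₂₂ *ᵥ (e x ∘ Sum.inr)) 𝓖 (𝓝 0) := by
    refine tendsto_pi_nhds.2 fun b => ?_
    have h3 := (tendsto_pi_nhds.1 t1 (Sum.inr b)).sub (t2 b)
    rw [Pi.zero_apply, sub_zero] at h3
    refine h3.congr' ?_
    filter_upwards [heθ] with x hx
    have h4 : (J *ᵥ e x) (Sum.inr b) =
        (J.toBlocks₂₁ *ᵥ w x + J.toBlocks₂₂ *ᵥ (e x ∘ Sum.inr)) b := by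
      rw [mulVec_eq_elim, hx]
      rfl
    rw [← h4, he, Matrix.mulVec_sub]
    simp only [Pi.sub_apply]
    ring
  have hunit : IsUnit J.toBlocks₂₂.det := (det_toBlocks₂₂_pos hJ).ne'.isUnit
  have hη' := tendsto_mulVec_zero (J.toBlocks₁₂ * J.toBlocks₂₂⁻¹) hη
  refine tendsto_pi_nhds.2 fun a => ?_
  rcases a with a | b
  · refine (tendsto_pi_nhds.1 hη' a).congr' ?_
    filter_upwards [heθ] with x hx
    rw [Pi.sub_apply, mulVec_eq_elim, hx, Matrix.mulVec_add, Matrix.mulVec_mulVec,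
      Matrix.mulVec_mulVec, Matrix.mul_assoc J.toBlocks₁₂ _ J.toBlocks₂₂,
      Matrix.nonsing_inv_mul _ hunit, Matrix.mul_one, thetaInfo, Matrix.sub_mulVec]
    simp only [Pi.add_apply, Sum.elim_inl, Pi.sub_apply]
    ring
  · refine (tendsto_pi_nhds.1 hη b).congr' ?_
    filter_upwards [heθ] with x hx
    rw [Pi.sub_apply, mulVec_eq_elim, hx]
    simp only [Sum.elim_inr, Pi.zero_apply, sub_zero]
    rfl

theorem isBigO_diff (h : LocallyQuadratic 𝓖 ψlim J G f) (hJ : J.PosDef)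
    (h₀ : Tendsto ψ₀ 𝓖 (𝓝 ψlim)) (h₁ : Tendsto ψ₁ 𝓖 (𝓝 ψlim))
    (hs : (fun x => s x • G x (ψ₀ x)) =O[𝓖] fun _ => (1 : ℝ))
    (hroot₁ : ∀ᶠ x in 𝓖, G x (ψ₁ x) = 0) :
    (fun x => s x • (thetaPart (ψ₁ x) - thetaPart (ψ₀ x)).ofLp) =O[𝓖] fun _ => (1 : ℝ) := by
  obtain ⟨b1, -⟩ := h.unrestricted hJ h₀ h₁ hs hroot₁
  exact isBigO_one_pi.2 fun a => (isBigO_one_pi.1 b1 (Sum.inl a)).congr_left fun x => by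
    simp [thetaPart]

/-- The quadratic form of the difference of the estimators. -/
theorem tendsto_diff_quadratic (h : LocallyQuadratic 𝓖 ψlim J G f) (hJ : J.PosDef)
    (h₀ : Tendsto ψ₀ 𝓖 (𝓝 ψlim)) (h₁ : Tendsto ψ₁ 𝓖 (𝓝 ψlim)) (h₂ : Tendsto ψ₂ 𝓖 (𝓝 ψlim))
    (hs : (fun x => s x • G x (ψ₀ x)) =O[𝓖] fun _ => (1 : ℝ)) (hroot₁ : ∀ᶠ x in 𝓖, G x (ψ₁ x) = 0)
    (hθ : ∀ᶠ x in 𝓖, thetaPart (ψ₂ x) = thetaPart (ψ₀ x))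
    (hroot₂ : ∀ᶠ x in 𝓖, ∀ b, G x (ψ₂ x) (Sum.inr b) = 0) :
    Tendsto (fun x => (s x • (ψ₁ x - ψ₀ x).ofLp - s x • (ψ₂ x - ψ₀ x).ofLp) ⬝ᵥ
        (J *ᵥ (s x • (ψ₁ x - ψ₀ x).ofLp - s x • (ψ₂ x - ψ₀ x).ofLp)) -
      (s x • (thetaPart (ψ₁ x) - thetaPart (ψ₀ x)).ofLp) ⬝ᵥ
        (thetaInfo J *ᵥ (s x • (thetaPart (ψ₁ x) - thetaPart (ψ₀ x)).ofLp))) 𝓖 (𝓝 0) := by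
  obtain ⟨b1, -⟩ := h.unrestricted hJ h₀ h₁ hs hroot₁
  obtain ⟨b2, -⟩ := h.restricted hJ h₀ h₂ hs hθ hroot₂
  have t := tendsto_dotProduct_zero (b1.sub b2)
    (h.tendsto_mulVec_diff hJ h₀ h₁ h₂ hs hroot₁ hθ hroot₂)
  refine t.congr' ?_
  filter_upwards [hθ] with x hx
  rw [dotProduct_sub]
  congr 1
  rw [dotProduct, dotProduct, Fintype.sum_sum_type]
  simp only [Sum.elim_inl, Sum.elim_inr, Pi.zero_apply, mul_zero, Finset.sum_const_zero, add_zero]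
  refine Finset.sum_congr rfl fun a _ => ?_
  have e2 : (ψ₂ x) (Sum.inl a) = (ψ₀ x) (Sum.inl a) :=
    congrArg (fun v : EuclideanSpace ℝ (Fin k) => v a) hx
  simp [e2, thetaPart]

/-- Let `u` and `v` be the scaled errors of the unrestricted and the restricted estimator. With the
score at `ψ₀` replaced by `J u`, twice the difference of the two quadratic expansions is `(u - v)ᵀ J
(u - v)`, already known to be a form in the error of `θ`. -/
theorem tendsto_likelihoodRatio (h : LocallyQuadratic 𝓖 ψlim J G f) (hJ : J.PosDef)
    (h₀ : Tendsto ψ₀ 𝓖 (𝓝 ψlim)) (h₁ : Tendsto ψ₁ 𝓖 (𝓝 ψlim)) (h₂ : Tendsto ψ₂ 𝓖 (𝓝 ψlim))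
    (hs : (fun x => s x • G x (ψ₀ x)) =O[𝓖] fun _ => (1 : ℝ)) (hroot₁ : ∀ᶠ x in 𝓖, G x (ψ₁ x) = 0)
    (hθ : ∀ᶠ x in 𝓖, thetaPart (ψ₂ x) = thetaPart (ψ₀ x))
    (hroot₂ : ∀ᶠ x in 𝓖, ∀ b, G x (ψ₂ x) (Sum.inr b) = 0) :
    Tendsto (fun x => 2 * (s x ^ 2 * (f x (ψ₁ x) - f x (ψ₂ x))) -
      (s x • (thetaPart (ψ₁ x) - thetaPart (ψ₀ x)).ofLp) ⬝ᵥ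
        (thetaInfo J *ᵥ (s x • (thetaPart (ψ₁ x) - thetaPart (ψ₀ x)).ofLp))) 𝓖 (𝓝 0) := by
  obtain ⟨b1, t1⟩ := h.unrestricted hJ h₀ h₁ hs hroot₁
  obtain ⟨b2, -⟩ := h.restricted hJ h₀ h₂ hs hθ hroot₂
  have v1 := h.scaled_value h₀ h₁ b1
  have v2 := h.scaled_value h₀ h₂ b2
  have t2 := tendsto_dotProduct_zero (b1.sub b2) t1
  have t3 := h.tendsto_diff_quadratic hJ h₀ h₁ h₂ hs hroot₁ hθ hroot₂
  have t4 := (((v1.sub v2).const_mul 2).sub (t2.const_mul 2)).add t3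
  simp only [sub_zero, mul_zero, add_zero] at t4
  refine t4.congr fun x => ?_
  have hsymm : ∀ u v : Fin k ⊕ Fin q → ℝ, u ⬝ᵥ (J *ᵥ v) = v ⬝ᵥ (J *ᵥ u) := fun u v => by
    rw [dotProduct_comm, Matrix.dotProduct_mulVec, ← Matrix.mulVec_transpose,
      (isSymm_of_posDef hJ).eq]
  generalize s x • (ψ₁ x - ψ₀ x).ofLp = u at *
  generalize s x • (ψ₂ x - ψ₀ x).ofLp = v at *
  simp only [Matrix.mulVec_sub, dotProduct_sub, sub_dotProduct]
  rw [hsymm v u, dotProduct_comm (s x • G x (ψ₀ x)) u, dotProduct_comm (s x • G x (ψ₀ x)) v]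
  ring

/-- The scaled score at the restricted estimator is asymptotically `J e`, where `e` is the
difference of the two scaled errors. Hence `A⁻¹` maps it to `e`, up to `o(1)`, and the statistic
becomes `eᵀ J e`. -/
theorem tendsto_scoreStatistic (h : LocallyQuadratic 𝓖 ψlim J G f) (hJ : J.PosDef)
    (h₀ : Tendsto ψ₀ 𝓖 (𝓝 ψlim)) (h₁ : Tendsto ψ₁ 𝓖 (𝓝 ψlim)) (h₂ : Tendsto ψ₂ 𝓖 (𝓝 ψlim))
    (hs : (fun x => s x • G x (ψ₀ x)) =O[𝓖] fun _ => (1 : ℝ)) (hroot₁ : ∀ᶠ x in 𝓖, G x (ψ₁ x) = 0)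
    (hθ : ∀ᶠ x in 𝓖, thetaPart (ψ₂ x) = thetaPart (ψ₀ x))
    (hroot₂ : ∀ᶠ x in 𝓖, ∀ b, G x (ψ₂ x) (Sum.inr b) = 0)
    {A : α → Matrix (Fin k ⊕ Fin q) (Fin k ⊕ Fin q) ℝ} (hA : Tendsto A 𝓖 (𝓝 J)) :
    Tendsto (fun x => (s x • G x (ψ₂ x)) ⬝ᵥ ((A x)⁻¹ *ᵥ (s x • G x (ψ₂ x))) -
      (s x • (thetaPart (ψ₁ x) - thetaPart (ψ₀ x)).ofLp) ⬝ᵥ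
        (thetaInfo J *ᵥ (s x • (thetaPart (ψ₁ x) - thetaPart (ψ₀ x)).ofLp))) 𝓖 (𝓝 0) := by
  have hunit : IsUnit J.det := hJ.det_pos.ne'.isUnit
  obtain ⟨b1, t1⟩ := h.unrestricted hJ h₀ h₁ hs hroot₁
  obtain ⟨b2, -⟩ := h.restricted hJ h₀ h₂ hs hθ hroot₂
  set e : α → Fin k ⊕ Fin q → ℝ := fun x =>
    s x • (ψ₁ x - ψ₀ x).ofLp - s x • (ψ₂ x - ψ₀ x).ofLp with he
  set g : α → Fin k ⊕ Fin q → ℝ := fun x => s x • G x (ψ₂ x) with hg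
  have t2 : Tendsto (fun x => g x - s x • G x (ψ₀ x) + J *ᵥ (s x • (ψ₂ x - ψ₀ x).ofLp)) 𝓖
      (𝓝 0) := by
    rw [← isLittleO_one_iff ℝ]
    exact IsLittleO.trans_isBigO (isLittleO_iff.2 fun ε hε => h.scaled_grad h₀ h₂ s hε) b2
  have hge : Tendsto (fun x => g x - J *ᵥ e x) 𝓖 (𝓝 0) := by
    have t3 := t2.sub t1
    rw [sub_zero] at t3
    refine t3.congr fun x => ?_
    rw [he, Matrix.mulVec_sub]
    abel
  have hgO : g =O[𝓖] fun _ => (1 : ℝ) := by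
    have h5 := ((isLittleO_one_iff ℝ).2 hge).isBigO.add (isBigO_one_mulVec J (b1.sub b2))
    exact h5.congr_left fun x => sub_add_cancel _ _
  have hdiff : Tendsto (fun x => (A x)⁻¹ *ᵥ g x - e x) 𝓖 (𝓝 0) := by
    have h7 := tendsto_inv_sub_mulVec hunit hA hgO
    have h10 := h7.add (tendsto_mulVec_zero J⁻¹ hge)
    rw [add_zero] at h10
    refine h10.congr fun x => ?_
    rw [Matrix.sub_mulVec, Matrix.mulVec_sub, Matrix.mulVec_mulVec, Matrix.nonsing_inv_mul _ hunit,
      Matrix.one_mulVec]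
    abel
  have h11 := (tendsto_dotProduct_zero hgO hdiff).add
    ((tendsto_dotProduct_zero (b1.sub b2) hge).add
      (h.tendsto_diff_quadratic hJ h₀ h₁ h₂ hs hroot₁ hθ hroot₂))
  simp only [add_zero] at h11
  refine h11.congr fun x => ?_
  change g x ⬝ᵥ ((A x)⁻¹ *ᵥ g x - e x) + (e x ⬝ᵥ (g x - J *ᵥ e x) + (e x ⬝ᵥ (J *ᵥ e x) - _)) = _
  rw [dotProduct_sub (g x) _ (e x), dotProduct_sub (e x) (g x), dotProduct_comm (g x) (e x)]
  ring

end LocallyQuadratic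

end MLE

/-! ### The likelihood of a stacked dataset -/

section StackedLikelihood

variable {k q p m : ℕ} (𝓜 : Model k q p)

theorem lik_nonneg (X : List (Row p)) {ψ : Param k q} (hψ : ψ ∈ 𝓜.Psi) : 0 ≤ 𝓜.lik X ψ := by
  refine List.prod_nonneg fun a ha => ?_
  obtain ⟨x, -, rfl⟩ := List.mem_map.1 ha
  exact 𝓜.nonneg_f ψ hψ x

theorem prod_map_stack {M : Type*} [CommMonoid M] (D : Fin m → List (Row p)) (S : Multiset (Fin m))
    (g : Row p → M) : ((stack D S).map g).prod = (S.map fun ℓ => ((D ℓ).map g).prod).prod := by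
  rw [stack, List.map_flatMap, List.flatMap, List.prod_flatten, List.map_map]
  conv_rhs => rw [← Multiset.sort_eq S (· ≤ ·)]
  rw [Multiset.map_coe, Multiset.prod_coe]
  rfl

theorem sum_map_stack {M : Type*} [AddCommMonoid M] (D : Fin m → List (Row p))
    (S : Multiset (Fin m)) (g : Row p → M) :
    ((stack D S).map g).sum = (S.map fun ℓ => ((D ℓ).map g).sum).sum :=
  prod_map_stack (M := Multiplicative M) D S g

theorem length_stack {D : Fin m → List (Row p)} {n : ℕ} (hD : ∀ ℓ, (D ℓ).length = n)
    (S : Multiset (Fin m)) : (stack D S).length = Multiset.card S * n := by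
  have h := sum_map_stack D S fun _ => (1 : ℕ)
  simpa [hD] using h

theorem lik_stack (D : Fin m → List (Row p)) (S : Multiset (Fin m)) (ψ : Param k q) :
    𝓜.lik (stack D S) ψ = (S.map fun ℓ => 𝓜.lik (D ℓ) ψ).prod :=
  prod_map_stack D S _

/-- On `s` the likelihood of the dataset `X` is positive and twice continuously differentiable. -/
structure SmoothLik (X : List (Row p)) (s : Set (Param k q)) : Prop where
  pos : ∀ ψ ∈ s, 0 < 𝓜.lik X ψ
  contDiffOn : ContDiffOn ℝ 2 (fun ψ => Real.log (𝓜.lik X ψ)) s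

variable {𝓜}

theorem SmoothLik.of_rows {n : ℕ} {Y : Fin n → Row p} {s : Set (Param k q)}
    (h : ∀ i, (∀ ψ ∈ s, 0 < 𝓜.f ψ (Y i)) ∧ ContDiffOn ℝ 2 (fun ψ => Real.log (𝓜.f ψ (Y i))) s) :
    SmoothLik 𝓜 (List.ofFn Y) s := by
  have e : ∀ ψ, 𝓜.lik (List.ofFn Y) ψ = ∏ i, 𝓜.f ψ (Y i) := fun ψ => by
    rw [Model.lik, List.map_ofFn, List.prod_ofFn]
    rfl
  constructor
  · intro ψ hψ
    rw [e]
    exact Finset.prod_pos fun i _ => (h i).1 ψ hψ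
  · have h1 : ContDiffOn ℝ 2 (fun ψ => ∑ i, Real.log (𝓜.f ψ (Y i))) s :=
      ContDiffOn.sum fun i _ => (h i).2
    refine h1.congr fun ψ hψ => ?_
    rw [e, Real.log_prod fun i _ => ((h i).1 ψ hψ).ne']

theorem log_multiset_prod {a : Fin m → ℝ} (h : ∀ ℓ, 0 < a ℓ) (S : Multiset (Fin m)) :
    0 < (S.map a).prod ∧ Real.log (S.map a).prod = (S.map fun ℓ => Real.log (a ℓ)).sum := by
  induction S using Multiset.induction_on with
  | empty => simp
  | cons b S ih =>
    simp only [Multiset.map_cons, Multiset.prod_cons, Multiset.sum_cons]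
    exact ⟨mul_pos (h b) ih.1, by rw [Real.log_mul (h b).ne' ih.1.ne', ih.2]⟩

theorem log_lik_stack {D : Fin m → List (Row p)} {s : Set (Param k q)}
    (h : ∀ ℓ, SmoothLik 𝓜 (D ℓ) s) (S : Multiset (Fin m)) {ψ : Param k q} (hψ : ψ ∈ s) :
    Real.log (𝓜.lik (stack D S) ψ) = (S.map fun ℓ => Real.log (𝓜.lik (D ℓ) ψ)).sum := by
  rw [lik_stack]
  exact (log_multiset_prod (fun ℓ => (h ℓ).pos ψ hψ) S).2

theorem SmoothLik.stack {D : Fin m → List (Row p)} {s : Set (Param k q)}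
    (h : ∀ ℓ, SmoothLik 𝓜 (D ℓ) s) (S : Multiset (Fin m)) : SmoothLik 𝓜 (stack D S) s := by
  constructor
  · intro ψ hψ
    rw [lik_stack]
    exact (log_multiset_prod (fun ℓ => (h ℓ).pos ψ hψ) S).1
  · have h1 : ContDiffOn ℝ 2
        (fun ψ => (S.map fun ℓ => Real.log (𝓜.lik (D ℓ) ψ)).sum) s := by
      induction S using Multiset.induction_on with
      | empty => simpa using contDiffOn_const
      | cons b S ih =>
        simp only [Multiset.map_cons, Multiset.sum_cons]
        exact (h b).contDiffOn.add ih
    exact h1.congr fun ψ hψ => log_lik_stack h S hψ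

theorem contDiffAt_multiset_sum {g : Fin m → Param k q → ℝ} {ψ : Param k q}
    (hg : ∀ ℓ, ContDiffAt ℝ 2 (g ℓ) ψ) (S : Multiset (Fin m)) :
    ContDiffAt ℝ 2 (fun φ => (S.map fun ℓ => g ℓ φ).sum) ψ ∧
    grad (fun φ => (S.map fun ℓ => g ℓ φ).sum) ψ = (S.map fun ℓ => grad (g ℓ) ψ).sum ∧
    hess (fun φ => (S.map fun ℓ => g ℓ φ).sum) ψ = (S.map fun ℓ => hess (g ℓ) ψ).sum := by
  induction S using Multiset.induction_on with
  | empty =>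
    simp only [Multiset.map_zero, Multiset.sum_zero]
    refine ⟨contDiffAt_const, ?_, ?_⟩
    · funext a
      simp [grad]
    · ext a b
      simp [hess]
  | cons b S ih =>
    obtain ⟨h1, h2, h3⟩ := ih
    simp only [Multiset.map_cons, Multiset.sum_cons]
    refine ⟨(hg b).add h1, ?_, ?_⟩
    · rw [← h2]
      funext a
      simp only [grad, Pi.add_apply]
      rw [fderiv_fun_add ((hg b).differentiableAt (by norm_num))
        (h1.differentiableAt (by norm_num))]
      rfl
    · rw [← h3]
      ext a c
      simp only [hess, Matrix.add_apply, Matrix.of_apply]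
      have := iteratedFDeriv_add_apply (i := 2) (hg b) h1
      rw [show (fun φ => g b φ + (S.map fun ℓ => g ℓ φ).sum) =
        g b + fun φ => (S.map fun ℓ => g ℓ φ).sum from rfl, this]
      rfl

theorem grad_congr {g g' : Param k q → ℝ} {ψ : Param k q} (h : g =ᶠ[𝓝 ψ] g') :
    grad g ψ = grad g' ψ := by
  funext a
  rw [grad, grad, h.fderiv_eq]

theorem hess_congr {g g' : Param k q → ℝ} {ψ : Param k q} (h : g =ᶠ[𝓝 ψ] g') :
    hess g ψ = hess g' ψ := by
  ext a b
  simp only [hess, Matrix.of_apply, iteratedFDeriv_two_apply]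
  rw [h.fderiv.fderiv_eq]

theorem score_stack {D : Fin m → List (Row p)} {s : Set (Param k q)} (hs : IsOpen s)
    (h : ∀ ℓ, SmoothLik 𝓜 (D ℓ) s) (S : Multiset (Fin m)) {ψ : Param k q} (hψ : ψ ∈ s) :
    𝓜.score (stack D S) ψ = (S.map fun ℓ => 𝓜.score (D ℓ) ψ).sum := by
  have h1 : (fun φ => Real.log (𝓜.lik (StackedMI.stack D S) φ)) =ᶠ[𝓝 ψ]
      fun φ => (S.map fun ℓ => Real.log (𝓜.lik (D ℓ) φ)).sum := by
    filter_upwards [hs.mem_nhds hψ] with φ hφ using log_lik_stack h S hφ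
  rw [Model.score, grad_congr h1]
  exact (contDiffAt_multiset_sum
    (fun ℓ => (h ℓ).contDiffOn.contDiffAt (hs.mem_nhds hψ)) S).2.1

theorem info_stack {D : Fin m → List (Row p)} {s : Set (Param k q)} (hs : IsOpen s)
    (h : ∀ ℓ, SmoothLik 𝓜 (D ℓ) s) (S : Multiset (Fin m)) {ψ : Param k q} (hψ : ψ ∈ s) :
    𝓜.info (stack D S) ψ = (S.map fun ℓ => 𝓜.info (D ℓ) ψ).sum := by
  have h1 : (fun φ => Real.log (𝓜.lik (StackedMI.stack D S) φ)) =ᶠ[𝓝 ψ]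
      fun φ => (S.map fun ℓ => Real.log (𝓜.lik (D ℓ) φ)).sum := by
    filter_upwards [hs.mem_nhds hψ] with φ hφ using log_lik_stack h S hφ
  rw [Model.info, hess_congr h1, (contDiffAt_multiset_sum
    (fun ℓ => (h ℓ).contDiffOn.contDiffAt (hs.mem_nhds hψ)) S).2.2]
  simp only [Model.info]
  exact Multiset.sum_map_neg.symm

/-! ### Maximum likelihood estimation in one dataset -/

/-- Outside the ball every value is beaten by the one at `ψlim`; inside, compactness yields a
maximum. Existence is needed because the estimators are maximizers only when a maximizer exists. The
set `C` is the whole space or the null hypothesis. -/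
theorem isMaximizer_of_separated {X : List (Row p)} {C : Set (Param k q)} (hC : IsClosed C)
    {ψlim : Param k q} {ρ ρ₀ : ℝ} (hρ : 0 < ρ) (hρρ₀ : ρ < ρ₀)
    (hball : Metric.ball ψlim ρ₀ ⊆ 𝓜.Psi) (hX : SmoothLik 𝓜 X (Metric.ball ψlim ρ₀))
    (hlim : ψlim ∈ C)
    (hsep : ∀ ψ ∈ 𝓜.Psi, ρ ≤ ‖ψ - ψlim‖ → 𝓜.lik X ψ < 𝓜.lik X ψlim) :
    (∃ ψ, IsMaximizer (𝓜.lik X) (𝓜.Psi ∩ C) ψ) ∧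
      ∀ ψ, IsMaximizer (𝓜.lik X) (𝓜.Psi ∩ C) ψ → ψ ∈ Metric.ball ψlim ρ := by
  have hρ₀ : 0 < ρ₀ := hρ.trans hρρ₀
  have hmem : ψlim ∈ 𝓜.Psi ∩ C := ⟨hball (Metric.mem_ball_self hρ₀), hlim⟩
  constructor
  · have hsub : Metric.closedBall ψlim ρ ⊆ Metric.ball ψlim ρ₀ :=
      Metric.closedBall_subset_ball hρρ₀
    have hcont : ContinuousOn (𝓜.lik X) (Metric.ball ψlim ρ₀) := by
      -- Only the logarithm of the likelihood is assumed smooth, so continuity is recovered by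
      -- exponentiation.
      refine (Real.continuous_exp.comp_continuousOn hX.contDiffOn.continuousOn).congr fun ψ hψ => ?_
      exact (Real.exp_log (hX.pos ψ hψ)).symm
    obtain ⟨ψ, hψ, hmax⟩ := ((isCompact_closedBall ψlim ρ).inter_right hC).exists_isMaxOn
      ⟨ψlim, Metric.mem_closedBall_self hρ.le, hlim⟩
      (hcont.mono (Set.inter_subset_left.trans hsub))
    refine ⟨ψ, ⟨hball (hsub hψ.1), hψ.2⟩, fun φ hφ => ?_⟩
    by_cases hd : φ ∈ Metric.closedBall ψlim ρ
    · exact hmax ⟨hd, hφ.2⟩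
    · have h1 : ρ ≤ ‖φ - ψlim‖ := by
        rw [Metric.mem_closedBall, dist_eq_norm, not_le] at hd
        exact hd.le
      exact (hsep φ hφ.1 h1).le.trans (hmax ⟨Metric.mem_closedBall_self hρ.le, hlim⟩)
  · intro ψ hψ
    by_contra hd
    rw [Metric.mem_ball, dist_eq_norm, not_lt] at hd
    exact absurd (hψ.2 ψlim hmem) (not_le.2 (hsep ψ hψ.1.1 hd))

theorem score_eq_zero_of_isMaximizer {X : List (Row p)} {s : Set (Param k q)} (hs : IsOpen s)
    (hsub : s ⊆ 𝓜.Psi) (hX : SmoothLik 𝓜 X s) {ψ : Param k q} (hψ : ψ ∈ s)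
    (hmax : IsMaximizer (𝓜.lik X) 𝓜.Psi ψ) : 𝓜.score X ψ = 0 := by
  have h : IsLocalMax (fun φ => Real.log (𝓜.lik X φ)) ψ := by
    filter_upwards [hs.mem_nhds hψ] with φ hφ
    exact Real.log_le_log (hX.pos φ hφ) (hmax.2 φ (hsub hφ))
  funext a
  simp [Model.score, grad, h.fderiv_eq_zero]

/-- Moving a nuisance coordinate preserves `θ`, so the restricted maximizer is a local maximum along
that line. -/
theorem score_inr_eq_zero_of_isMaximizer {X : List (Row p)} {s : Set (Param k q)} (hs : IsOpen s)
    (hsub : s ⊆ 𝓜.Psi) (hX : SmoothLik 𝓜 X s) {ψ : Param k q} (hψ : ψ ∈ s)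
    (hmax : IsMaximizer (𝓜.lik X) {φ ∈ 𝓜.Psi | thetaPart φ = 𝓜.θ₀} ψ) (b : Fin q) :
    𝓜.score X ψ (Sum.inr b) = 0 := by
  set v : Param k q := EuclideanSpace.single (Sum.inr b) 1 with hv
  set γ : ℝ → Param k q := fun t => ψ + t • v with hγ
  have hγd : HasDerivAt γ v 0 := by
    have h := ((hasDerivAt_id (0 : ℝ)).smul_const v).const_add ψ
    rwa [one_smul] at h
  have hγ0 : γ 0 = ψ := by simp [hγ]
  have hγs : ∀ᶠ t in 𝓝 (0 : ℝ), γ t ∈ s :=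
    hγd.continuousAt.eventually (by rw [hγ0]; exact hs.mem_nhds hψ)
  have h : IsLocalMax (fun t => Real.log (𝓜.lik X (γ t))) 0 := by
    filter_upwards [hγs] with t ht
    rw [hγ0]
    refine Real.log_le_log (hX.pos _ ht) (hmax.2 _ ⟨hsub ht, ?_⟩)
    rw [← hmax.1.2]
    simp [thetaPart, hγ, hv]
  have hd : HasFDerivAt (fun φ => Real.log (𝓜.lik X φ))
      (fderiv ℝ (fun φ => Real.log (𝓜.lik X φ)) ψ) (γ 0) := by
    rw [hγ0]
    exact ((hX.contDiffOn.contDiffAt (hs.mem_nhds hψ)).differentiableAt (by norm_num)).hasFDerivAt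
  exact h.hasDerivAt_eq_zero (hd.comp_hasDerivAt 0 hγd)

end StackedLikelihood

/-! ### Regularity of the completed datasets in probability -/

section Regularity

open Asymptotics

/-- A statement that holds eventually and uniformly on some ball is an eventual statement along `𝓖
×ˢ 𝓝 c`. In this form it is stable under finite conjunctions. -/
theorem exists_ball_forall {α E ι : Type*} [PseudoMetricSpace E] [Finite ι] {𝓖 : Filter α} {c : E}
    {r : ι → α → E → Prop}
    (h : ∀ i, ∃ ρ > 0, ∀ᶠ x in 𝓖, ∀ ψ ∈ Metric.ball c ρ, r i x ψ) :
    ∃ ρ > 0, ∀ᶠ x in 𝓖, ∀ ψ ∈ Metric.ball c ρ, ∀ i, r i x ψ := by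
  have hb : (𝓖 ×ˢ 𝓝 c).HasBasis (fun s : Set α × ℝ => s.1 ∈ 𝓖 ∧ 0 < s.2)
      fun s => s.1 ×ˢ Metric.ball c s.2 := 𝓖.basis_sets.prod Metric.nhds_basis_ball
  have key : ∀ u : α → E → Prop, (∃ ρ > 0, ∀ᶠ x in 𝓖, ∀ ψ ∈ Metric.ball c ρ, u x ψ) ↔
      ∀ᶠ z in 𝓖 ×ˢ 𝓝 c, u z.1 z.2 := by
    intro u
    rw [hb.eventually_iff]
    constructor
    · rintro ⟨ρ, hρ, h1⟩
      exact ⟨({x | ∀ ψ ∈ Metric.ball c ρ, u x ψ}, ρ), ⟨h1, hρ⟩, fun z hz => hz.1 _ hz.2⟩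
    · rintro ⟨⟨s, ρ⟩, ⟨hs, hρ⟩, h1⟩
      exact ⟨ρ, hρ, mem_of_superset hs fun x hx ψ hψ => h1 (x := (x, ψ)) ⟨hx, hψ⟩⟩
  rw [key]
  exact eventually_all.2 fun i => (key _).1 (h i)

variable {k q p m : ℕ} {Ω : ℕ → Type*} [∀ n, MeasurableSpace (Ω n)] {P : ∀ n, Measure (Ω n)}
  {𝓜 : Model k q p} {𝓔 : Estimators k q p} {𝓣 : Truth k q} {𝓓 : MIData p m Ω}

theorem exists_ball_eventually_smoothLik (h : Regular 𝓜 𝓣 𝓓 P) :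
    ∃ ρ > 0, Metric.ball 𝓣.ψlim ρ ⊆ 𝓜.Psi ∧
      ∀ᶠ x in probFilter P, ∀ ℓ,
        SmoothLik 𝓜 (𝓓.completed x.1 x.2 ℓ) (Metric.ball 𝓣.ψlim ρ) := by
  obtain ⟨ρ, hρ, hsub, hs⟩ := h.smooth
  refine ⟨ρ, hρ, hsub, eventually_probFilter_of_ae fun n => ?_⟩
  refine ae_all_iff.2 fun ℓ => ?_
  filter_upwards [hs n ℓ] with ω hω
  exact SmoothLik.of_rows hω

theorem exists_ball_eventually_info (h : Regular 𝓜 𝓣 𝓓 P) {ε : ℝ} (hε : 0 < ε) :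
    ∃ ρ > 0, ∀ᶠ x in probFilter P, ∀ ψ ∈ Metric.ball 𝓣.ψlim ρ, ∀ i : Fin m × _ × _,
      |(x.1 : ℝ)⁻¹ * 𝓜.info (𝓓.completed x.1 x.2 i.1) ψ i.2.1 i.2.2 - 𝓣.Jcom i.2.1 i.2.2| < ε := by
  refine exists_ball_forall fun i => ?_
  obtain ⟨ρ, hρ, h1⟩ := h.info i.1 i.2.1 i.2.2 ε hε
  refine ⟨ρ, hρ, eventually_probFilter.2 (h1.congr fun n => ?_)⟩
  congr 1
  ext ω
  simp only [Set.mem_ofPred_eq]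
  push Not
  rfl

theorem eventually_fst_pos : ∀ᶠ x in probFilter P, 0 < x.1 :=
  tendsto_fst_probFilter.eventually (eventually_gt_atTop 0)

theorem norm_le_mul_norm_ofLp (v : Param k q) : ‖v‖ ≤ (k + q + 1 : ℝ) * ‖v.ofLp‖ := by
  have h : ‖v‖ ^ 2 ≤ ((k + q + 1 : ℝ) * ‖v.ofLp‖) ^ 2 := by
    rw [EuclideanSpace.norm_sq_eq]
    have h1 : ∑ a, ‖v a‖ ^ 2 ≤ (k + q : ℝ) * ‖v.ofLp‖ ^ 2 := by
      refine (Finset.sum_le_card_nsmul _ _ (‖v.ofLp‖ ^ 2) fun a _ => ?_).trans (le_of_eq (by simp))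
      exact pow_le_pow_left₀ (norm_nonneg _) (norm_le_pi_norm v.ofLp a) 2
    refine h1.trans ?_
    rw [mul_pow]
    refine mul_le_mul_of_nonneg_right ?_ (sq_nonneg _)
    nlinarith [Nat.cast_nonneg (α := ℝ) k, Nat.cast_nonneg (α := ℝ) q]
  exact le_of_sq_le_sq h (by positivity)

/-- The Taylor estimates are applied to the log-likelihood with `n Jcom` and `n ε` and divided by
`n`. The powers of `d` absorb the dimension and the comparison of the Euclidean norm with the sup
norm. -/
theorem locallyQuadratic_completed (h : Regular 𝓜 𝓣 𝓓 P) (hJ : 𝓣.Jcom.PosDef) (ℓ : Fin m) :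
    LocallyQuadratic (probFilter P) 𝓣.ψlim 𝓣.Jcom
      (fun x ψ => (x.1 : ℝ)⁻¹ • 𝓜.score (𝓓.completed x.1 x.2 ℓ) ψ)
      fun x ψ => (x.1 : ℝ)⁻¹ * Real.log (𝓜.lik (𝓓.completed x.1 x.2 ℓ) ψ) := by
  obtain ⟨ρ₀, hρ₀, -, hsm⟩ := exists_ball_eventually_smoothLik h
  have hJs : ∀ n : ℝ, (n • 𝓣.Jcom).IsSymm := fun n => (isSymm_of_posDef hJ).smul n
  set d : ℝ := (k + q + 1 : ℝ) with hd
  have hd1 : (k + q : ℝ) ≤ d := by rw [hd]; linarith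
  have hd0 : (0 : ℝ) < d := by positivity
  have hkq : (0 : ℝ) ≤ (k + q : ℝ) := by positivity
  have main : ∀ ε > 0, ∃ ρ > 0, ∀ᶠ x in probFilter P,
      0 < x.1 ∧ SmoothLik 𝓜 (𝓓.completed x.1 x.2 ℓ) (Metric.ball 𝓣.ψlim ρ) ∧
      ∀ ψ ∈ Metric.ball 𝓣.ψlim ρ, ∀ a b,
        |hess (fun φ => Real.log (𝓜.lik (𝓓.completed x.1 x.2 ℓ) φ)) ψ a b +
          ((x.1 : ℝ) • 𝓣.Jcom) a b| ≤ x.1 * ε := by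
    intro ε hε
    obtain ⟨ρ, hρ, h1⟩ := exists_ball_eventually_info h hε
    refine ⟨min ρ ρ₀, lt_min hρ hρ₀, ?_⟩
    filter_upwards [eventually_fst_pos, hsm, h1] with x hx hs hi
    refine ⟨hx, ⟨fun ψ hψ => (hs ℓ).pos ψ (Metric.ball_subset_ball (min_le_right _ _) hψ),
      (hs ℓ).contDiffOn.mono (Metric.ball_subset_ball (min_le_right _ _))⟩, fun ψ hψ a b => ?_⟩
    have h2 := (hi ψ (Metric.ball_subset_ball (min_le_left _ _) hψ) (ℓ, a, b)).le
    have hx' : (0 : ℝ) < x.1 := Nat.cast_pos.2 hx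
    have e : hess (fun φ => Real.log (𝓜.lik (𝓓.completed x.1 x.2 ℓ) φ)) ψ a b +
        ((x.1 : ℝ) • 𝓣.Jcom) a b =
        -(x.1 * ((x.1 : ℝ)⁻¹ * 𝓜.info (𝓓.completed x.1 x.2 ℓ) ψ a b - 𝓣.Jcom a b)) := by
      rw [mul_sub, mul_inv_cancel_left₀ hx'.ne']
      simp [Model.info]
      ring
    rw [e, abs_neg, abs_mul, abs_of_pos hx']
    gcongr
  constructor
  · intro ε hε
    obtain ⟨ρ, hρ, h1⟩ := main (ε / d ^ 2) (by positivity)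
    refine ⟨ρ, hρ, ?_⟩
    filter_upwards [h1] with x hx ψ hψ ψ' hψ'
    obtain ⟨hn, hs, hh⟩ := hx
    have hx' : (0 : ℝ) < x.1 := Nat.cast_pos.2 hn
    refine (pi_norm_le_iff_of_nonneg (by positivity)).2 fun a => ?_
    have h2 := abs_grad_sub_le Metric.isOpen_ball (convex_ball _ _) hs.contDiffOn (hJs x.1)
      (by positivity) hh hψ hψ' a
    have e : ((x.1 : ℝ)⁻¹ • 𝓜.score (𝓓.completed x.1 x.2 ℓ) ψ' -
        (x.1 : ℝ)⁻¹ • 𝓜.score (𝓓.completed x.1 x.2 ℓ) ψ + 𝓣.Jcom *ᵥ (ψ' - ψ).ofLp) a =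
        (x.1 : ℝ)⁻¹ * (𝓜.score (𝓓.completed x.1 x.2 ℓ) ψ' a - 𝓜.score (𝓓.completed x.1 x.2 ℓ) ψ a +
          (((x.1 : ℝ) • 𝓣.Jcom) *ᵥ (ψ' - ψ).ofLp) a) := by
      rw [Matrix.smul_mulVec]
      simp only [Pi.add_apply, Pi.sub_apply, Pi.smul_apply, smul_eq_mul]
      field_simp
    rw [e, Real.norm_eq_abs, abs_mul, abs_of_pos (inv_pos.2 hx'), inv_mul_le_iff₀ hx']
    refine h2.trans ?_
    calc (k + q : ℝ) * (x.1 * (ε / d ^ 2)) * ‖ψ' - ψ‖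
        ≤ d * (x.1 * (ε / d ^ 2)) * (d * ‖(ψ' - ψ).ofLp‖) := by
          have := norm_le_mul_norm_ofLp (ψ' - ψ)
          gcongr
      _ = x.1 * (ε * ‖(ψ' - ψ).ofLp‖) := by field_simp
  · intro ε hε
    obtain ⟨ρ, hρ, h1⟩ := main (ε / d ^ 4) (by positivity)
    refine ⟨ρ, hρ, ?_⟩
    filter_upwards [h1] with x hx ψ hψ ψ' hψ'
    obtain ⟨hn, hs, hh⟩ := hx
    have hx' : (0 : ℝ) < x.1 := Nat.cast_pos.2 hn
    have h2 := abs_value_sub_le Metric.isOpen_ball (convex_ball _ _) hs.contDiffOn (hJs x.1)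
      (by positivity) hh hψ hψ'
    have e : (x.1 : ℝ)⁻¹ * Real.log (𝓜.lik (𝓓.completed x.1 x.2 ℓ) ψ') -
        (x.1 : ℝ)⁻¹ * Real.log (𝓜.lik (𝓓.completed x.1 x.2 ℓ) ψ) -
        ((x.1 : ℝ)⁻¹ • 𝓜.score (𝓓.completed x.1 x.2 ℓ) ψ) ⬝ᵥ (ψ' - ψ).ofLp +
        (1 / 2) * ((ψ' - ψ).ofLp ⬝ᵥ (𝓣.Jcom *ᵥ (ψ' - ψ).ofLp)) =
        (x.1 : ℝ)⁻¹ * (Real.log (𝓜.lik (𝓓.completed x.1 x.2 ℓ) ψ') -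
        Real.log (𝓜.lik (𝓓.completed x.1 x.2 ℓ) ψ) -
        (𝓜.score (𝓓.completed x.1 x.2 ℓ) ψ) ⬝ᵥ (ψ' - ψ).ofLp +
        (1 / 2) * ((ψ' - ψ).ofLp ⬝ᵥ (((x.1 : ℝ) • 𝓣.Jcom) *ᵥ (ψ' - ψ).ofLp))) := by
      rw [Matrix.smul_mulVec, smul_dotProduct, dotProduct_smul, smul_eq_mul, smul_eq_mul]
      field_simp
    rw [e, abs_mul, abs_of_pos (inv_pos.2 hx'), inv_mul_le_iff₀ hx']
    refine h2.trans ?_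
    calc (k + q : ℝ) * ((k + q : ℝ) * (x.1 * (ε / d ^ 4))) * ‖ψ' - ψ‖ ^ 2
        ≤ d * (d * (x.1 * (ε / d ^ 4))) * (d * ‖(ψ' - ψ).ofLp‖) ^ 2 := by
          have := norm_le_mul_norm_ofLp (ψ' - ψ)
          gcongr
      _ = x.1 * (ε * ‖(ψ' - ψ).ofLp‖ ^ 2) := by field_simp

theorem LocallyQuadratic.congr {α : Type*} {𝓖 : Filter α} {ψlim : Param k q}
    {J : Matrix (Fin k ⊕ Fin q) (Fin k ⊕ Fin q) ℝ} {G G' : α → Param k q → Fin k ⊕ Fin q → ℝ}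
    {f f' : α → Param k q → ℝ} (h : LocallyQuadratic 𝓖 ψlim J G f)
    (hc : ∃ ρ > 0, ∀ᶠ x in 𝓖, ∀ ψ ∈ Metric.ball ψlim ρ, G x ψ = G' x ψ ∧ f x ψ = f' x ψ) :
    LocallyQuadratic 𝓖 ψlim J G' f' := by
  obtain ⟨ρ', hρ', h'⟩ := hc
  constructor
  · intro ε hε
    obtain ⟨ρ, hρ, h1⟩ := h.grad ε hε
    refine ⟨min ρ ρ', lt_min hρ hρ', ?_⟩
    filter_upwards [h1, h'] with x hx hx' ψ hψ ψ' hψ'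
    rw [← (hx' ψ (Metric.ball_subset_ball (min_le_right _ _) hψ)).1,
      ← (hx' ψ' (Metric.ball_subset_ball (min_le_right _ _) hψ')).1]
    exact hx ψ (Metric.ball_subset_ball (min_le_left _ _) hψ) ψ'
      (Metric.ball_subset_ball (min_le_left _ _) hψ')
  · intro ε hε
    obtain ⟨ρ, hρ, h1⟩ := h.value ε hε
    refine ⟨min ρ ρ', lt_min hρ hρ', ?_⟩
    filter_upwards [h1, h'] with x hx hx' ψ hψ ψ' hψ'
    rw [← (hx' ψ (Metric.ball_subset_ball (min_le_right _ _) hψ)).1,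
      ← (hx' ψ (Metric.ball_subset_ball (min_le_right _ _) hψ)).2,
      ← (hx' ψ' (Metric.ball_subset_ball (min_le_right _ _) hψ')).2]
    exact hx ψ (Metric.ball_subset_ball (min_le_left _ _) hψ) ψ'
      (Metric.ball_subset_ball (min_le_left _ _) hψ')

theorem locallyQuadratic_stack (h : Regular 𝓜 𝓣 𝓓 P) (hJ : 𝓣.Jcom.PosDef)
    (S : Multiset (Fin m)) :
    LocallyQuadratic (probFilter P) 𝓣.ψlim ((Multiset.card S : ℝ) • 𝓣.Jcom)
      (fun x ψ => (x.1 : ℝ)⁻¹ • 𝓜.score (stack (𝓓.completed x.1 x.2) S) ψ)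
      fun x ψ => (x.1 : ℝ)⁻¹ * Real.log (𝓜.lik (stack (𝓓.completed x.1 x.2) S) ψ) := by
  obtain ⟨ρ₀, hρ₀, -, hsm⟩ := exists_ball_eventually_smoothLik h
  refine (LocallyQuadratic.sum (fun ℓ => locallyQuadratic_completed h hJ ℓ) S).congr
    ⟨ρ₀, hρ₀, ?_⟩
  filter_upwards [hsm] with x hx ψ hψ
  rw [score_stack Metric.isOpen_ball hx S hψ, log_lik_stack hx S hψ, Multiset.smul_sum,
    Multiset.map_map, Multiset.sum_map_mul_left]
  exact ⟨rfl, rfl⟩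

theorem multiset_prod_lt {a b : Fin m → ℝ} (h : ∀ ℓ, 0 ≤ a ℓ ∧ a ℓ < b ℓ) {S : Multiset (Fin m)}
    (hS : S ≠ 0) : (S.map a).prod < (S.map b).prod := by
  have key : ∀ S : Multiset (Fin m), 0 < (S.map b).prod ∧ (S.map a).prod ≤ (S.map b).prod := by
    intro S
    induction S using Multiset.induction_on with
    | empty => simp
    | cons c S ih =>
      simp only [Multiset.map_cons, Multiset.prod_cons]
      have hb := (h c).1.trans_lt (h c).2
      exact ⟨mul_pos hb ih.1, (mul_le_mul_of_nonneg_left ih.2 (h c).1).trans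
        (mul_le_mul_of_nonneg_right (h c).2.le ih.1.le)⟩
  obtain ⟨c, hc⟩ := Multiset.exists_mem_of_ne_zero hS
  obtain ⟨S', rfl⟩ := Multiset.exists_cons_of_mem hc
  simp only [Multiset.map_cons, Multiset.prod_cons]
  exact (mul_le_mul_of_nonneg_left (key S').2 (h c).1).trans_lt
    (mul_lt_mul_of_pos_right (h c).2 (key S').1)

/-- In each completed dataset the factor `exp (-c n) < 1` and positivity at `ψlim` give strict
separation, and strict inequalities multiply over a non-empty stack. -/
theorem eventually_separated_stack (h : Regular 𝓜 𝓣 𝓓 P) {S : Multiset (Fin m)} (hS : S ≠ 0)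
    {ε : ℝ} (hε : 0 < ε) :
    ∀ᶠ x in probFilter P, ∀ ψ ∈ 𝓜.Psi, ε ≤ ‖ψ - 𝓣.ψlim‖ →
      𝓜.lik (stack (𝓓.completed x.1 x.2) S) ψ <
        𝓜.lik (stack (𝓓.completed x.1 x.2) S) 𝓣.ψlim := by
  obtain ⟨ρ₀, hρ₀, -, hsm⟩ := exists_ball_eventually_smoothLik h
  have hsep : ∀ ℓ, ∀ᶠ x in probFilter P, ∀ ψ ∈ 𝓜.Psi, ε ≤ ‖ψ - 𝓣.ψlim‖ →
      𝓜.lik (𝓓.completed x.1 x.2 ℓ) 𝓣.ψlim > 0 →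
      𝓜.lik (𝓓.completed x.1 x.2 ℓ) ψ < 𝓜.lik (𝓓.completed x.1 x.2 ℓ) 𝓣.ψlim := by
    intro ℓ
    obtain ⟨c, hc, h1⟩ := h.separated ℓ ε hε
    have h2 : ∀ᶠ x in probFilter P, ∀ ψ ∈ 𝓜.Psi, ε ≤ ‖ψ - 𝓣.ψlim‖ →
        𝓜.lik (𝓓.completed x.1 x.2 ℓ) ψ ≤
          Real.exp (-(c * x.1)) * 𝓜.lik (𝓓.completed x.1 x.2 ℓ) 𝓣.ψlim := by
      refine eventually_probFilter.2 (h1.congr fun n => ?_)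
      congr 1
      ext ω
      simp only [Set.mem_ofPred_eq]
      push Not
      rfl
    filter_upwards [h2, eventually_fst_pos] with x hx hn ψ hψ hd hpos
    refine (hx ψ hψ hd).trans_lt (mul_lt_of_lt_one_left hpos ?_)
    rw [Real.exp_lt_one_iff]
    have : (0 : ℝ) < x.1 := Nat.cast_pos.2 hn
    nlinarith [mul_pos hc this]
  filter_upwards [hsm, eventually_all.2 hsep] with x hx hs ψ hψ hd
  rw [lik_stack, lik_stack]
  exact multiset_prod_lt (fun ℓ => ⟨lik_nonneg 𝓜 _ hψ,
    hs ℓ ψ hψ hd ((hx ℓ).pos _ (Metric.mem_ball_self hρ₀))⟩) hS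

/-! ### Consistency of the estimators -/

/-- With probability tending to one the maximizers exist and lie in a small ball inside the
parameter space, so the estimating equations hold there. -/
theorem eventually_mle_stack (hE : 𝓔.AreMLE 𝓜) (h : Regular 𝓜 𝓣 𝓓 P)
    (hlim : thetaPart 𝓣.ψlim = 𝓜.θ₀) {S : Multiset (Fin m)} (hS : S ≠ 0) {ε : ℝ} (hε : 0 < ε) :
    ∀ᶠ x in probFilter P,
      𝓔.ψhat (stack (𝓓.completed x.1 x.2) S) ∈ Metric.ball 𝓣.ψlim ε ∧
      𝓔.ψhat₀ (stack (𝓓.completed x.1 x.2) S) ∈ Metric.ball 𝓣.ψlim ε ∧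
      𝓜.score (stack (𝓓.completed x.1 x.2) S) (𝓔.ψhat (stack (𝓓.completed x.1 x.2) S)) = 0 ∧
      thetaPart (𝓔.ψhat₀ (stack (𝓓.completed x.1 x.2) S)) = 𝓜.θ₀ ∧
      ∀ b, 𝓜.score (stack (𝓓.completed x.1 x.2) S)
        (𝓔.ψhat₀ (stack (𝓓.completed x.1 x.2) S)) (Sum.inr b) = 0 := by
  obtain ⟨ρ₀, hρ₀, hsub, hsm⟩ := exists_ball_eventually_smoothLik h
  set ρ := min ε (ρ₀ / 2) with hρdef
  have hρ : 0 < ρ := lt_min hε (half_pos hρ₀)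
  have hρρ₀ : ρ < ρ₀ := (min_le_right _ _).trans_lt (half_lt_self hρ₀)
  have hC : IsClosed {φ : Param k q | thetaPart φ = 𝓜.θ₀} := by
    refine isClosed_eq ?_ continuous_const
    exact (PiLp.continuous_toLp 2 _).comp (continuous_pi fun a => by fun_prop)
  filter_upwards [hsm, eventually_separated_stack h hS hρ] with x hx hsep
  have hX := SmoothLik.stack hx S
  obtain ⟨h1, h1'⟩ := isMaximizer_of_separated isClosed_univ hρ hρρ₀ hsub hX (Set.mem_univ _) hsep
  obtain ⟨h2, h2'⟩ := isMaximizer_of_separated hC hρ hρρ₀ hsub hX hlim hsep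
  rw [Set.inter_univ] at h1 h1'
  have m1 := hE.unrestricted _ h1
  have m2 := hE.restricted _ h2
  have b1 := h1' _ m1
  have b2 := h2' _ m2
  refine ⟨Metric.ball_subset_ball (min_le_left _ _) b1, Metric.ball_subset_ball (min_le_left _ _) b2,
    score_eq_zero_of_isMaximizer Metric.isOpen_ball hsub hX
      (Metric.ball_subset_ball hρρ₀.le b1) m1, m2.1.2,
    score_inr_eq_zero_of_isMaximizer Metric.isOpen_ball hsub hX
      (Metric.ball_subset_ball hρρ₀.le b2) m2⟩

end Regularity

/-! ### The devices are asymptotically quadratic -/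

section Device

open Asymptotics

variable {k q p m : ℕ} {Ω : ℕ → Type*} [∀ n, MeasurableSpace (Ω n)] {P : ∀ n, Measure (Ω n)}
  {𝓜 : Model k q p} {𝓔 : Estimators k q p} {𝓣 : Truth k q} {𝓓 : MIData p m Ω}

/-- The parameter with the null value of `θ` and the true value of `η`. -/
def nullParam (𝓜 : Model k q p) (𝓣 : Truth k q) (n : ℕ) : Param k q :=
  WithLp.toLp 2 (Sum.elim 𝓜.θ₀ fun b => 𝓣.ψstar n (Sum.inr b))

theorem thetaPart_nullParam (n : ℕ) : thetaPart (nullParam 𝓜 𝓣 n) = 𝓜.θ₀ := rfl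

theorem LocalAlternatives.isBigO (h : LocalAlternatives 𝓜 𝓣) :
    (fun n : ℕ => √(n : ℝ) • (thetaPart (𝓣.ψstar n) - 𝓜.θ₀).ofLp) =O[atTop] fun _ => (1 : ℝ) := by
  obtain ⟨A, δ, hA, hδ⟩ := h
  refine (isBigO_one_mulVec A⁻¹ (hδ.isBigO_one ℝ)).congr_left fun n => ?_
  rw [Matrix.mulVec_smul, Matrix.mulVec_mulVec, Matrix.nonsing_inv_mul _ hA, Matrix.one_mulVec]

theorem LocalAlternatives.tendsto (h : LocalAlternatives 𝓜 𝓣) :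
    Tendsto (fun n : ℕ => (thetaPart (𝓣.ψstar n) - 𝓜.θ₀).ofLp) atTop (𝓝 0) := by
  have hs : Tendsto (fun n : ℕ => (√(n : ℝ))⁻¹) atTop (𝓝 0) :=
    tendsto_inv_atTop_zero.comp (Real.tendsto_sqrt_atTop.comp tendsto_natCast_atTop_atTop)
  rw [← isLittleO_one_iff ℝ] at hs ⊢
  have h1 := hs.smul_isBigO h.isBigO
  simp only [smul_eq_mul, mul_one] at h1
  refine h1.congr' ?_ EventuallyEq.rfl
  filter_upwards [eventually_gt_atTop 0] with n hn
  have : √(n : ℝ) ≠ 0 := (Real.sqrt_pos.2 (Nat.cast_pos.2 hn)).ne'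
  rw [smul_smul, inv_mul_cancel₀ this, one_smul]

theorem continuous_thetaPart : Continuous (thetaPart : Param k q → EuclideanSpace ℝ (Fin k)) :=
  (PiLp.continuous_toLp 2 _).comp (continuous_pi fun a => by fun_prop)

theorem thetaPart_ψlim (h : LocalAlternatives 𝓜 𝓣)
    (ht : Tendsto 𝓣.ψstar atTop (𝓝 𝓣.ψlim)) : thetaPart 𝓣.ψlim = 𝓜.θ₀ := by
  have h1 := (continuous_thetaPart.tendsto 𝓣.ψlim).comp ht
  have h2 : Tendsto (fun n : ℕ => thetaPart (𝓣.ψstar n)) atTop (𝓝 𝓜.θ₀) := by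
    have h3 := ((PiLp.continuous_toLp 2 fun _ : Fin k => ℝ).tendsto 0).comp h.tendsto
    have h4 := h3.add_const 𝓜.θ₀
    simpa [Function.comp_def] using h4
  exact tendsto_nhds_unique h1 h2

theorem nullParam_sub (n : ℕ) : (nullParam 𝓜 𝓣 n - 𝓣.ψstar n).ofLp =
    Sum.elim (-(thetaPart (𝓣.ψstar n) - 𝓜.θ₀).ofLp) 0 := by
  funext a
  rcases a with a | b
  · simp [nullParam, thetaPart]
  · simp [nullParam]

theorem tendsto_nullParam (h : LocalAlternatives 𝓜 𝓣)
    (ht : Tendsto 𝓣.ψstar atTop (𝓝 𝓣.ψlim)) : Tendsto (nullParam 𝓜 𝓣) atTop (𝓝 𝓣.ψlim) := by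
  have h1 : Tendsto (fun n => (nullParam 𝓜 𝓣 n - 𝓣.ψstar n).ofLp) atTop (𝓝 0) := by
    simp_rw [nullParam_sub]
    refine tendsto_pi_nhds.2 fun a => ?_
    rcases a with a | b
    · have := (tendsto_pi_nhds.1 h.tendsto a).neg
      simpa using this
    · exact tendsto_const_nhds
  have h2 := (((PiLp.continuous_toLp 2 fun _ : Fin k ⊕ Fin q => ℝ).tendsto 0).comp h1).add ht
  simpa [Function.comp_def] using h2

theorem isBigO_nullParam (h : LocalAlternatives 𝓜 𝓣) :
    (fun n : ℕ => √(n : ℝ) • (nullParam 𝓜 𝓣 n - 𝓣.ψstar n).ofLp) =O[atTop] fun _ => (1 : ℝ) := by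
  simp_rw [nullParam_sub]
  refine isBigO_one_pi.2 fun a => ?_
  rcases a with a | b
  · refine (isBigO_one_pi.1 h.isBigO a).neg_left.congr_left fun n => ?_
    simp only [Pi.smul_apply, Pi.neg_apply, Sum.elim_inl, smul_eq_mul]
    ring
  · exact (isBigO_zero (fun _ : ℕ => (1 : ℝ)) atTop).congr_left fun n => by simp

theorem tendsto_ψhat (hE : 𝓔.AreMLE 𝓜) (h : Regular 𝓜 𝓣 𝓓 P)
    (hlim : thetaPart 𝓣.ψlim = 𝓜.θ₀) {S : Multiset (Fin m)} (hS : S ≠ 0) :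
    Tendsto (fun x : Σ n, Ω n => 𝓔.ψhat (stack (𝓓.completed x.1 x.2) S)) (probFilter P)
      (𝓝 𝓣.ψlim) :=
  Metric.tendsto_nhds.2 fun _ hε => (eventually_mle_stack hE h hlim hS hε).mono fun _ hx => hx.1

theorem tendsto_ψhat₀ (hE : 𝓔.AreMLE 𝓜) (h : Regular 𝓜 𝓣 𝓓 P)
    (hlim : thetaPart 𝓣.ψlim = 𝓜.θ₀) {S : Multiset (Fin m)} (hS : S ≠ 0) :
    Tendsto (fun x : Σ n, Ω n => 𝓔.ψhat₀ (stack (𝓓.completed x.1 x.2) S)) (probFilter P)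
      (𝓝 𝓣.ψlim) :=
  Metric.tendsto_nhds.2 fun _ hε => (eventually_mle_stack hE h hlim hS hε).mono fun _ hx => hx.2.1

/-- The event that the scores of the completed datasets at the truth are of order `K √n`. -/
def scoreEvent (𝓜 : Model k q p) (𝓣 : Truth k q) (𝓓 : MIData p m Ω) (K : ℝ) : Set (Σ n, Ω n) :=
  {x | ∀ i : Fin m × (Fin k ⊕ Fin q),
    |𝓜.score (𝓓.completed x.1 x.2 i.1) (𝓣.ψstar x.1) i.2| ≤ K * √(x.1 : ℝ)}

theorem exists_scoreEvent (h : Regular 𝓜 𝓣 𝓓 P) {ε : ℝ≥0∞} (hε : 0 < ε) :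
    ∃ K : ℝ, ∀ᶠ n in atTop, P n {ω | (⟨n, ω⟩ : Σ n, Ω n) ∉ scoreEvent 𝓜 𝓣 𝓓 K} ≤ ε := by
  classical
  set c : ℝ≥0∞ := (Fintype.card (Fin m × (Fin k ⊕ Fin q)) : ℝ≥0∞) + 1 with hc
  have hc0 : c ≠ 0 := by simp [hc]
  have hcT : c ≠ ⊤ := ENNReal.add_ne_top.2 ⟨ENNReal.natCast_ne_top _, ENNReal.one_ne_top⟩
  have hε' : 0 < ε / c := ENNReal.div_pos hε.ne' hcT
  choose K hK using fun i : Fin m × (Fin k ⊕ Fin q) => h.score i.1 i.2 (ε / c) hε'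
  refine ⟨∑ i, |K i|, ?_⟩
  filter_upwards [eventually_all.2 hK] with n hn
  calc P n {ω | (⟨n, ω⟩ : Σ n, Ω n) ∉ scoreEvent 𝓜 𝓣 𝓓 (∑ i, |K i|)}
      ≤ P n (⋃ i, {ω | K i * √(n : ℝ) <
          |𝓜.score (𝓓.completed n ω i.1) (𝓣.ψstar n) i.2|}) := by
        refine measure_mono fun ω hω => ?_
        simp only [scoreEvent, Set.mem_ofPred_eq, not_forall, not_le] at hω
        obtain ⟨i, hi⟩ := hω
        refine Set.mem_iUnion.2 ⟨i, lt_of_le_of_lt ?_ hi⟩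
        refine mul_le_mul_of_nonneg_right ((le_abs_self _).trans ?_) (Real.sqrt_nonneg _)
        exact Finset.single_le_sum (f := fun i => |K i|) (fun _ _ => abs_nonneg _)
          (Finset.mem_univ i)
    _ ≤ ∑ i, P n {ω | K i * √(n : ℝ) <
          |𝓜.score (𝓓.completed n ω i.1) (𝓣.ψstar n) i.2|} := measure_iUnion_fintype_le _ _
    _ ≤ ∑ _i : Fin m × (Fin k ⊕ Fin q), ε / c := Finset.sum_le_sum fun i _ => hn i
    _ ≤ ε := by
        rw [Finset.sum_const, Finset.card_univ, nsmul_eq_mul]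
        calc (Fintype.card (Fin m × (Fin k ⊕ Fin q)) : ℝ≥0∞) * (ε / c) ≤ c * (ε / c) := by
              gcongr
              exact le_self_add
          _ = ε := ENNReal.mul_div_cancel hc0 hcT

theorem isBigO_multiset_sum {α E : Type*} [NormedAddCommGroup E] {𝓖 : Filter α}
    {v : Fin m → α → E} (hv : ∀ ℓ, v ℓ =O[𝓖] fun _ => (1 : ℝ)) (S : Multiset (Fin m)) :
    (fun x => (S.map fun ℓ => v ℓ x).sum) =O[𝓖] fun _ => (1 : ℝ) := by
  induction S using Multiset.induction_on with
  | empty => exact (isBigO_zero (E' := E) (fun _ : α => (1 : ℝ)) 𝓖).congr_left fun x => by simp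
  | cons a S ih =>
    simp only [Multiset.map_cons, Multiset.sum_cons]
    exact (hv a).add ih

theorem isBigO_score_ψstar (h : Regular 𝓜 𝓣 𝓓 P) (ht : Tendsto 𝓣.ψstar atTop (𝓝 𝓣.ψlim)) (K : ℝ)
    (S : Multiset (Fin m)) :
    (fun x : Σ n, Ω n => √(x.1 : ℝ) •
      ((x.1 : ℝ)⁻¹ • 𝓜.score (stack (𝓓.completed x.1 x.2) S) (𝓣.ψstar x.1)))
      =O[probFilter P ⊓ 𝓟 (scoreEvent 𝓜 𝓣 𝓓 K)] fun _ => (1 : ℝ) := by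
  obtain ⟨ρ₀, hρ₀, -, hsm⟩ := exists_ball_eventually_smoothLik h
  have h1 : ∀ ℓ, (fun x : Σ n, Ω n => √(x.1 : ℝ) •
      ((x.1 : ℝ)⁻¹ • 𝓜.score (𝓓.completed x.1 x.2 ℓ) (𝓣.ψstar x.1)))
      =O[probFilter P ⊓ 𝓟 (scoreEvent 𝓜 𝓣 𝓓 K)] fun _ => (1 : ℝ) := by
    intro ℓ
    refine isBigO_one_pi.2 fun a => IsBigO.of_bound K ?_
    filter_upwards [mem_inf_of_right (mem_principal_self _),
      mem_inf_of_left (eventually_fst_pos (P := P))] with x hx hn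
    have hx' := hx (ℓ, a)
    have hn' : (0 : ℝ) < x.1 := Nat.cast_pos.2 hn
    have hs : 0 < √(x.1 : ℝ) := Real.sqrt_pos.2 hn'
    simp only [Pi.smul_apply, smul_eq_mul, norm_mul, Real.norm_eq_abs, abs_inv, abs_of_pos hn',
      abs_of_pos hs, abs_one, mul_one]
    calc √(x.1 : ℝ) * ((x.1 : ℝ)⁻¹ * |𝓜.score (𝓓.completed x.1 x.2 ℓ) (𝓣.ψstar x.1) a|)
        ≤ √(x.1 : ℝ) * ((x.1 : ℝ)⁻¹ * (K * √(x.1 : ℝ))) := by gcongr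
      _ = K * ((x.1 : ℝ)⁻¹ * (√(x.1 : ℝ) * √(x.1 : ℝ))) := by ring
      _ = K := by rw [Real.mul_self_sqrt hn'.le, inv_mul_cancel₀ hn'.ne', mul_one]
  refine (isBigO_multiset_sum h1 S).congr' ?_ EventuallyEq.rfl
  have hball : ∀ᶠ x in probFilter P, 𝓣.ψstar x.1 ∈ Metric.ball 𝓣.ψlim ρ₀ :=
    (ht.comp tendsto_fst_probFilter) (Metric.ball_mem_nhds _ hρ₀)
  filter_upwards [mem_inf_of_left hsm, mem_inf_of_left hball] with x hx hb
  rw [score_stack Metric.isOpen_ball hx S hb, Multiset.smul_sum, Multiset.map_map,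
    Multiset.smul_sum, Multiset.map_map]
  rfl

/-- The normalized error of the estimator of `θ` in a stacked dataset. -/
def wStack (𝓜 : Model k q p) (𝓔 : Estimators k q p) (𝓓 : MIData p m Ω) (S : Multiset (Fin m))
    (x : Σ n, Ω n) : Fin k → ℝ :=
  √(x.1 : ℝ) • (thetaPart (𝓔.ψhat (stack (𝓓.completed x.1 x.2) S)) - 𝓜.θ₀).ofLp

theorem stack_singleton {p m : ℕ} (D : Fin m → List (Row p)) (ℓ : Fin m) : stack D {ℓ} = D ℓ := by
  simp [stack]

end Device

/-! ### Estimators and information of a stacked dataset -/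

section DeviceLimit

open Asymptotics

theorem inv_smul_of_ne_zero {ι : Type*} [Fintype ι] [DecidableEq ι] {c : ℝ} (hc : c ≠ 0)
    (A : Matrix ι ι ℝ) : (c • A)⁻¹ = c⁻¹ • A⁻¹ := by
  by_cases h : IsUnit A.det
  · exact Matrix.inv_smul' A (Units.mk0 c hc) h
  · have h' : ¬ IsUnit (c • A).det := by
      rw [Matrix.det_smul]
      simpa [isUnit_iff_ne_zero, hc] using h
    rw [Matrix.nonsing_inv_apply_not_isUnit _ h, Matrix.nonsing_inv_apply_not_isUnit _ h', smul_zero]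

theorem thetaInfo_smul {k q : ℕ} {c : ℝ} (hc : c ≠ 0)
    (J : Matrix (Fin k ⊕ Fin q) (Fin k ⊕ Fin q) ℝ) : thetaInfo (c • J) = c • thetaInfo J := by
  have h11 : (c • J).toBlocks₁₁ = c • J.toBlocks₁₁ := rfl
  have h12 : (c • J).toBlocks₁₂ = c • J.toBlocks₁₂ := rfl
  have h21 : (c • J).toBlocks₂₁ = c • J.toBlocks₂₁ := rfl
  have h22 : (c • J).toBlocks₂₂ = c • J.toBlocks₂₂ := rfl
  rw [thetaInfo, h11, h12, h21, h22, inv_smul_of_ne_zero hc, thetaInfo, smul_sub]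
  congr 1
  simp only [Matrix.smul_mul, Matrix.mul_smul, smul_smul]
  rw [inv_mul_cancel₀ hc, mul_one]

variable {k q p m : ℕ} {Ω : ℕ → Type*} [∀ n, MeasurableSpace (Ω n)] {P : ∀ n, Measure (Ω n)}
  {𝓜 : Model k q p} {𝓔 : Estimators k q p} {𝓣 : Truth k q} {𝓓 : MIData p m Ω}

theorem card_pos_of_ne_zero {S : Multiset (Fin m)} (hS : S ≠ 0) : (0 : ℝ) < Multiset.card S :=
  Nat.cast_pos.2 (Multiset.card_pos.2 hS)

theorem tendsto_nullParam_probFilter (hloc : LocalAlternatives 𝓜 𝓣)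
    (ht : Tendsto 𝓣.ψstar atTop (𝓝 𝓣.ψlim)) :
    Tendsto (fun x : Σ n, Ω n => nullParam 𝓜 𝓣 x.1) (probFilter P) (𝓝 𝓣.ψlim) :=
  (tendsto_nullParam hloc ht).comp tendsto_fst_probFilter

/-- The expansions start at `nullParam`, since the restricted estimator shares its `θ`-part. Local
alternatives place it within `O(1/√n)` of the truth, so the score there is still of order `√n`. -/
theorem isBigO_score_nullParam (h : Regular 𝓜 𝓣 𝓓 P) (hJ : 𝓣.Jcom.PosDef)
    (hloc : LocalAlternatives 𝓜 𝓣) (ht : Tendsto 𝓣.ψstar atTop (𝓝 𝓣.ψlim)) (K : ℝ)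
    (S : Multiset (Fin m)) :
    (fun x : Σ n, Ω n => √(x.1 : ℝ) •
      ((x.1 : ℝ)⁻¹ • 𝓜.score (stack (𝓓.completed x.1 x.2) S) (nullParam 𝓜 𝓣 x.1)))
      =O[probFilter P ⊓ 𝓟 (scoreEvent 𝓜 𝓣 𝓓 K)] fun _ => (1 : ℝ) :=
  ((locallyQuadratic_stack h hJ S).mono inf_le_left).isBigO_score
    ((ht.comp tendsto_fst_probFilter).mono_left inf_le_left)
    ((tendsto_nullParam_probFilter hloc ht).mono_left inf_le_left)
    (isBigO_score_ψstar h ht K S)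
    (((isBigO_nullParam hloc).comp_tendsto tendsto_fst_probFilter).mono inf_le_left)

theorem tendsto_probFilter_of_scoreEvent (h : Regular 𝓜 𝓣 𝓓 P) {β : Type*} {l : Filter β}
    {f : (Σ n, Ω n) → β}
    (hf : ∀ K, Tendsto f (probFilter P ⊓ 𝓟 (scoreEvent 𝓜 𝓣 𝓓 K)) l) :
    Tendsto f (probFilter P) l := by
  refine tendsto_probFilter_of_inf_principal fun ε hε => ?_
  obtain ⟨K, hK⟩ := exists_scoreEvent h hε
  exact ⟨scoreEvent 𝓜 𝓣 𝓓 K, hK, hf K⟩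

theorem singleton_ne_zero (ℓ : Fin m) : ({ℓ} : Multiset (Fin m)) ≠ 0 :=
  Multiset.singleton_ne_zero ℓ

/-- The estimator in a stacked dataset is asymptotically the average of those in its parts. -/
theorem tendsto_wStack_sub (hE : 𝓔.AreMLE 𝓜) (h : Regular 𝓜 𝓣 𝓓 P) (hJ : 𝓣.Jcom.PosDef)
    (hloc : LocalAlternatives 𝓜 𝓣) (ht : Tendsto 𝓣.ψstar atTop (𝓝 𝓣.ψlim))
    {S : Multiset (Fin m)} (hS : S ≠ 0) :
    Tendsto (fun x => (Multiset.card S : ℝ) • wStack 𝓜 𝓔 𝓓 S x -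
      (S.map fun ℓ => wStack 𝓜 𝓔 𝓓 {ℓ} x).sum) (probFilter P) (𝓝 0) := by
  refine tendsto_probFilter_of_scoreEvent h fun K => ?_
  have hlim := thetaPart_ψlim hloc ht
  obtain ⟨ρ₀, hρ₀, -, hsm⟩ := exists_ball_eventually_smoothLik h
  set 𝓖 := probFilter P ⊓ 𝓟 (scoreEvent 𝓜 𝓣 𝓓 K) with h𝓖
  have hle : 𝓖 ≤ probFilter P := inf_le_left
  have hc := card_pos_of_ne_zero hS
  set s₀ : Multiset (Fin m) → (Σ n, Ω n) → Fin k ⊕ Fin q → ℝ := fun S x => √(x.1 : ℝ) •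
      ((x.1 : ℝ)⁻¹ • 𝓜.score (stack (𝓓.completed x.1 x.2) S) (nullParam 𝓜 𝓣 x.1)) with hs₀
  set e : Multiset (Fin m) → (Σ n, Ω n) → Fin k ⊕ Fin q → ℝ := fun S x => √(x.1 : ℝ) •
      (𝓔.ψhat (stack (𝓓.completed x.1 x.2) S) - nullParam 𝓜 𝓣 x.1).ofLp with he
  -- Asymptotic linearity gives `|S| Jcom e_S ≈ s₀ S`, and likewise for each single dataset. The
  -- scores add over the stack, and the invertible `Jcom` is then cancelled.
  have key : ∀ S : Multiset (Fin m), S ≠ 0 →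
      Tendsto (fun x => ((Multiset.card S : ℝ) • 𝓣.Jcom) *ᵥ e S x - s₀ S x) 𝓖 (𝓝 0) := by
    intro S hS
    refine (((locallyQuadratic_stack h hJ S).mono hle).unrestricted
      (hJ.smul (card_pos_of_ne_zero hS)) ((tendsto_nullParam_probFilter hloc ht).mono_left hle)
      ((tendsto_ψhat hE h hlim hS).mono_left hle) (isBigO_score_nullParam h hJ hloc ht K S) ?_).2
    filter_upwards [(eventually_mle_stack hE h hlim hS one_pos).filter_mono hle] with x hx
    rw [hx.2.2.1, smul_zero]
  have hsum := tendsto_multiset_sum (f := fun ℓ x => ((Multiset.card {ℓ} : ℝ) • 𝓣.Jcom) *ᵥ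
    e {ℓ} x - s₀ {ℓ} x) S (fun ℓ _ => key {ℓ} (singleton_ne_zero ℓ))
  have hscore : ∀ᶠ x in 𝓖, s₀ S x = (S.map fun ℓ => s₀ {ℓ} x).sum := by
    have hball := ((tendsto_nullParam_probFilter (P := P) hloc ht)
      (Metric.ball_mem_nhds _ hρ₀))
    filter_upwards [hsm.filter_mono hle, hle hball] with x hx hb
    have e1 := score_stack Metric.isOpen_ball hx S (show nullParam 𝓜 𝓣 x.1 ∈ _ from hb)
    simp only [hs₀, stack_singleton]
    rw [e1, Multiset.smul_sum, Multiset.map_map, Multiset.smul_sum, Multiset.map_map]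
    rfl
  have hdiff := (key S hS).sub hsum
  simp only [Multiset.map_const', Multiset.sum_replicate, smul_zero, sub_zero] at hdiff
  have hJe : Tendsto (fun x => 𝓣.Jcom *ᵥ ((Multiset.card S : ℝ) • e S x -
      (S.map fun ℓ => e {ℓ} x).sum)) 𝓖 (𝓝 0) := by
    refine hdiff.congr' ?_
    filter_upwards [hscore] with x hx
    have e2 : 𝓣.Jcom *ᵥ (S.map fun ℓ => e {ℓ} x).sum =
        (S.map fun ℓ => 𝓣.Jcom *ᵥ e {ℓ} x).sum := by
      have := map_multiset_sum 𝓣.Jcom.mulVecLin (S.map fun ℓ => e {ℓ} x)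
      rw [Multiset.map_map] at this
      exact this
    rw [Multiset.sum_map_sub, ← hx, Matrix.mulVec_sub, e2,
      Matrix.mulVec_smul 𝓣.Jcom (Multiset.card S : ℝ) (e S x), Matrix.smul_mulVec]
    simp only [Multiset.card_singleton, Nat.cast_one, one_smul]
    abel
  have hinv := tendsto_mulVec_zero 𝓣.Jcom⁻¹ hJe
  simp only [Matrix.mulVec_mulVec, Matrix.nonsing_inv_mul _ hJ.det_pos.ne'.isUnit,
    Matrix.one_mulVec] at hinv
  refine tendsto_pi_nhds.2 fun a => (tendsto_pi_nhds.1 hinv (Sum.inl a)).congr fun x => ?_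
  have hew : ∀ S, e S x (Sum.inl a) = wStack 𝓜 𝓔 𝓓 S x a := fun S => by
    simp [he, wStack, thetaPart, nullParam]
  have hsumapply : ∀ {ι : Type} (v : Fin m → ι → ℝ) (i : ι),
      (S.map fun ℓ => v ℓ).sum i = (S.map fun ℓ => v ℓ i).sum := fun v i => by
    have := map_multiset_sum (Pi.evalAddMonoidHom (fun _ => ℝ) i) (S.map fun ℓ => v ℓ)
    rw [Multiset.map_map] at this
    exact this
  simp only [Pi.sub_apply, Pi.smul_apply, hsumapply, hew]

theorem tendsto_info_stack (h : Regular 𝓜 𝓣 𝓓 P) (S : Multiset (Fin m))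
    {ψ : (Σ n, Ω n) → Param k q} (hψ : Tendsto ψ (probFilter P) (𝓝 𝓣.ψlim)) :
    Tendsto (fun x => (x.1 : ℝ)⁻¹ • 𝓜.info (stack (𝓓.completed x.1 x.2) S) (ψ x)) (probFilter P)
      (𝓝 ((Multiset.card S : ℝ) • 𝓣.Jcom)) := by
  obtain ⟨ρ₀, hρ₀, -, hsm⟩ := exists_ball_eventually_smoothLik h
  have h1 : ∀ ℓ, Tendsto (fun x => (x.1 : ℝ)⁻¹ • 𝓜.info (𝓓.completed x.1 x.2 ℓ) (ψ x))
      (probFilter P) (𝓝 𝓣.Jcom) := by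
    intro ℓ
    refine tendsto_pi_nhds.2 fun a => tendsto_pi_nhds.2 fun b => Metric.tendsto_nhds.2 fun ε hε => ?_
    obtain ⟨ρ, hρ, h2⟩ := exists_ball_eventually_info h hε
    filter_upwards [h2, hψ (Metric.ball_mem_nhds _ hρ)] with x hx hb
    exact hx _ hb (ℓ, a, b)
  have h2 := tendsto_multiset_sum S fun ℓ _ => h1 ℓ
  simp only [Multiset.map_const', Multiset.sum_replicate] at h2
  rw [Nat.cast_smul_eq_nsmul]
  refine h2.congr' ?_
  filter_upwards [hsm, hψ (Metric.ball_mem_nhds _ hρ₀)] with x hx hb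
  rw [info_stack Metric.isOpen_ball hx S hb, Multiset.smul_sum, Multiset.map_map]
  rfl

end DeviceLimit

/-- Conditional probabilities are bounded by one, so their convergence to zero in probability passes
to their expectations, the unconditional probabilities. -/
theorem tendsto_of_condExp_indicator {Ω : ℕ → Type*} {σ : ∀ n, MeasurableSpace (Ω n)}
    [mΩ : ∀ n, MeasurableSpace (Ω n)] {P : ∀ n, Measure (Ω n)} [∀ n, IsProbabilityMeasure (P n)]
    (hσ : ∀ n, σ n ≤ mΩ n) {A : ∀ n, Set (Ω n)} (hA : ∀ n, MeasurableSet (A n))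
    (h : ∀ ε' > 0, Tendsto (fun n => P n {ω | ε' ≤
      ((P n)[(A n).indicator fun _ => (1 : ℝ) | σ n]) ω}) atTop (𝓝 0)) :
    Tendsto (fun n => P n (A n)) atTop (𝓝 0) := by
  have hint : ∀ n, Integrable ((A n).indicator fun _ => (1 : ℝ)) (P n) := fun n =>
    (integrable_const 1).indicator (hA n)
  have h0 : ∀ n, 0 ≤ᵐ[P n] (P n)[(A n).indicator fun _ => (1 : ℝ) | σ n] := fun n =>
    condExp_nonneg (ae_of_all _ fun ω => Set.indicator_nonneg (fun _ _ => zero_le_one) ω)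
  have h1 : ∀ n, (P n)[(A n).indicator fun _ => (1 : ℝ) | σ n] ≤ᵐ[P n] fun _ => 1 := fun n => by
    have h2 := condExp_mono (m := σ n) (hint n) (integrable_const (1 : ℝ))
      (ae_of_all (P n) fun ω => Set.indicator_le_self' (fun _ _ => zero_le_one) ω)
    rwa [condExp_const (hσ n)] at h2
  have hlim : Tendsto (fun x : Σ n, Ω n =>
      ((P x.1)[(A x.1).indicator fun _ => (1 : ℝ) | σ x.1]) x.2) (probFilter P) (𝓝 0) := by
    refine (tendsto_order.2 ⟨fun a ha => ?_, fun a ha => ?_⟩)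
    · refine eventually_probFilter_of_ae fun n => ?_
      filter_upwards [h0 n] with ω hω using ha.trans_le hω
    · refine eventually_probFilter.2 ((h a ha).congr fun n => ?_)
      simp only [not_lt]
  have hsm : ∀ n, AEStronglyMeasurable ((P n)[(A n).indicator fun _ => (1 : ℝ) | σ n]) (P n) :=
    fun n => (stronglyMeasurable_condExp.mono (hσ n)).aestronglyMeasurable
  have h3 := tendsto_integral_of_tendsto_probFilter (M := 1) hsm (fun n => by
      filter_upwards [h0 n, h1 n] with ω hω hω'
      rw [Real.norm_of_nonneg hω]
      exact hω') hlim
  simp only [integral_condExp (hσ _)] at h3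
  have h4 := (ENNReal.continuous_ofReal.tendsto 0).comp h3
  rw [ENNReal.ofReal_zero] at h4
  refine h4.congr fun n => ?_
  rw [Function.comp_apply, integral_indicator_const _ (hA n)]
  simp

/-! ### The variance estimator in a stacked dataset -/

section VarianceEstimator

open Asymptotics

variable {k q p m : ℕ} {Ω : ℕ → Type*} [∀ n, MeasurableSpace (Ω n)] {P : ∀ n, Measure (Ω n)}
  {𝓜 : Model k q p} {𝓔 : Estimators k q p} {𝓣 : Truth k q} {𝓓 : MIData p m Ω}

theorem length_completed (n : ℕ) (ω : Ω n) (ℓ : Fin m) : (𝓓.completed n ω ℓ).length = n :=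
  List.length_ofFn

theorem tendsto_VImp [∀ n, IsProbabilityMeasure (P n)] [∀ n, StandardBorelSpace (Ω n)]
    {test : Test} (hst : AreStatistics 𝓜 𝓔 𝓓 test) (hprop : ProperImputation 𝓔 𝓣 𝓓 P)
    (ℓ : Fin m) :
    Tendsto (fun x : Σ n, Ω n => (x.1 : ℝ) • 𝓔.Vhat (𝓓.completed x.1 x.2 ℓ)) (probFilter P)
      (𝓝 𝓣.Icom⁻¹) := by
  refine tendsto_pi_nhds.2 fun a => tendsto_pi_nhds.2 fun b => tendsto_probFilter.2 fun ε hε => ?_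
  refine tendsto_of_condExp_indicator (σ := fun n => 𝓓.sigmaObs n) (fun n => 𝓓.sigmaObs_le n)
    (fun n => ?_) (hprop.condVariance ℓ a b ε hε)
  have h1 : Measurable fun ω => VImp 𝓔 𝓓 n ℓ ω a b :=
    (measurable_pi_apply b).comp ((measurable_pi_apply a).comp (hst.VImp n ℓ))
  have h2 : Measurable fun ω => |(n : ℝ) * VImp 𝓔 𝓓 n ℓ ω a b - 𝓣.Icom⁻¹ a b| :=
    ((h1.const_mul (n : ℝ)).sub_const (𝓣.Icom⁻¹ a b)).abs
  exact measurableSet_le measurable_const h2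

/-- The average of `g` over the stack is the mean of its averages over the parts, which all tend to
`h₀`. So the scaled estimator has the limit `Φ h₀` for every `S`, and the case of a single dataset,
where proper imputation applies, identifies it with `Icom⁻¹`. -/
theorem tendsto_Vhat_stack [∀ n, IsProbabilityMeasure (P n)] [∀ n, StandardBorelSpace (Ω n)]
    (hE : 𝓔.AreMLE 𝓜) (h : Regular 𝓜 𝓣 𝓓 P) (hlim : thetaPart 𝓣.ψlim = 𝓜.θ₀)
    (hV : PlugInVariance 𝓔 𝓣 𝓓 P) {test : Test} (hst : AreStatistics 𝓜 𝓔 𝓓 test)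
    (hprop : ProperImputation 𝓔 𝓣 𝓓 P) {S : Multiset (Fin m)} (hS : S ≠ 0) :
    Tendsto (fun x : Σ n, Ω n => ((Multiset.card S : ℝ) * x.1) •
      𝓔.Vhat (stack (𝓓.completed x.1 x.2) S)) (probFilter P) (𝓝 𝓣.Icom⁻¹) := by
  obtain ⟨b, g, Φ, h₀, hΦ, hg, hplug⟩ := hV
  have hlen : ∀ (x : Σ n, Ω n) (S : Multiset (Fin m)),
      ((stack (𝓓.completed x.1 x.2) S).length : ℝ) = (Multiset.card S : ℝ) * x.1 := fun x S => by
    rw [length_stack (fun ℓ => length_completed x.1 x.2 ℓ), Nat.cast_mul]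
  have key : ∀ S : Multiset (Fin m), S ≠ 0 → Tendsto (fun x : Σ n, Ω n =>
      ((Multiset.card S : ℝ) * x.1) • 𝓔.Vhat (stack (𝓓.completed x.1 x.2) S)) (probFilter P)
      (𝓝 (Φ h₀)) := by
    intro S hS
    have hc := card_pos_of_ne_zero hS
    set ψ : (Σ n, Ω n) → Param k q := fun x => 𝓔.ψhat (stack (𝓓.completed x.1 x.2) S) with hψdef
    have hψ : Tendsto ψ (probFilter P) (𝓝 𝓣.ψlim) := tendsto_ψhat hE h hlim hS
    have h1 : ∀ ℓ, Tendsto (fun x : Σ n, Ω n => (x.1 : ℝ)⁻¹ •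
        ((𝓓.completed x.1 x.2 ℓ).map fun y => g y (ψ x)).sum) (probFilter P) (𝓝 h₀) := by
      intro ℓ
      refine Metric.tendsto_nhds.2 fun ε hε => ?_
      obtain ⟨ρ, hρ, h2⟩ := hg ℓ ε hε
      have h3 : ∀ᶠ x in probFilter P, ∀ φ ∈ Metric.ball 𝓣.ψlim ρ,
          ‖(x.1 : ℝ)⁻¹ • ((𝓓.completed x.1 x.2 ℓ).map fun y => g y φ).sum - h₀‖ < ε := by
        refine eventually_probFilter.2 (h2.congr fun n => ?_)
        congr 1
        ext ω
        simp only [Set.mem_ofPred_eq]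
        push Not
        rfl
      filter_upwards [h3, hψ (Metric.ball_mem_nhds _ hρ)] with x hx hb
      rw [dist_eq_norm]
      exact hx _ hb
    have h2 := (tendsto_multiset_sum S fun ℓ _ => h1 ℓ).const_smul (Multiset.card S : ℝ)⁻¹
    simp only [Multiset.map_const', Multiset.sum_replicate] at h2
    rw [← Nat.cast_smul_eq_nsmul ℝ, smul_smul, inv_mul_cancel₀ hc.ne', one_smul] at h2
    have h3 := hΦ.tendsto.comp h2
    refine h3.congr' ?_
    have h4 : ∀ᶠ x in probFilter P, ((stack (𝓓.completed x.1 x.2) S).length : ℝ) •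
        𝓔.Vhat (stack (𝓓.completed x.1 x.2) S) =
        Φ (((stack (𝓓.completed x.1 x.2) S).length : ℝ)⁻¹ •
          ((stack (𝓓.completed x.1 x.2) S).map fun y => g y (ψ x)).sum) :=
      eventually_probFilter.2 (hplug S hS)
    filter_upwards [h4] with x hx
    rw [hlen] at hx
    rw [hx, Function.comp_apply]
    congr 1
    rw [sum_map_stack, mul_inv, ← smul_smul]
    congr 1
    rw [Multiset.smul_sum, Multiset.map_map]
    rfl
  obtain ⟨ℓ, -⟩ := Multiset.exists_mem_of_ne_zero hS
  have h1 := key {ℓ} (singleton_ne_zero ℓ)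
  simp only [stack_singleton, Multiset.card_singleton, Nat.cast_one, one_mul] at h1
  rw [← tendsto_nhds_unique h1 (tendsto_VImp hst hprop ℓ)]
  exact key S hS

end VarianceEstimator

/-! ### Common expansion of the three devices -/

section DeviceExpansion

open Asymptotics

variable {k q p m : ℕ} {Ω : ℕ → Type*} [∀ n, MeasurableSpace (Ω n)] [∀ n, StandardBorelSpace (Ω n)]
  {P : ∀ n, Measure (Ω n)} [∀ n, IsProbabilityMeasure (P n)]
  {𝓜 : Model k q p} {𝓔 : Estimators k q p} {𝓣 : Truth k q} {𝓓 : MIData p m Ω}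

/-- On each score event the abstract expansions apply with Hessian `-|S| Jcom` and scale `√n`; the
factor `|S|` arises because `thetaInfo` is homogeneous. For the Wald device the limit of the scaled
variance estimator supplies `Icom` directly. -/
theorem tendsto_device (hE : 𝓔.AreMLE 𝓜) (h : Regular 𝓜 𝓣 𝓓 P) (hJ : 𝓣.Jcom.PosDef)
    (hI : IsUnit 𝓣.Icom.det)
    (hloc : LocalAlternatives 𝓜 𝓣) (ht : Tendsto 𝓣.ψstar atTop (𝓝 𝓣.ψlim)) {test : Test}
    (hV : test = Test.wald → PlugInVariance 𝓔 𝓣 𝓓 P) (hst : AreStatistics 𝓜 𝓔 𝓓 test)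
    (hprop : ProperImputation 𝓔 𝓣 𝓓 P) {S : Multiset (Fin m)} (hS : S ≠ 0) :
    Tendsto (fun x : Σ n, Ω n => device 𝓜 𝓔 test (stack (𝓓.completed x.1 x.2) S) -
      Multiset.card S * (wStack 𝓜 𝓔 𝓓 S x ⬝ᵥ (𝓣.Icom *ᵥ wStack 𝓜 𝓔 𝓓 S x))) (probFilter P)
      (𝓝 0) := by
  refine tendsto_probFilter_of_scoreEvent h fun K => ?_
  have hlim := thetaPart_ψlim hloc ht
  obtain ⟨ρ₀, hρ₀, -, hsm⟩ := exists_ball_eventually_smoothLik h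
  set 𝓖 := probFilter P ⊓ 𝓟 (scoreEvent 𝓜 𝓣 𝓓 K) with h𝓖
  have hle : 𝓖 ≤ probFilter P := inf_le_left
  have hc := card_pos_of_ne_zero hS
  have hLQ := (locallyQuadratic_stack h hJ S).mono hle
  have hJS : ((Multiset.card S : ℝ) • 𝓣.Jcom).PosDef := hJ.smul hc
  have t₀ := (tendsto_nullParam_probFilter (P := P) hloc ht).mono_left hle
  have t₁ := (tendsto_ψhat hE h hlim hS).mono_left hle
  have t₂ := (tendsto_ψhat₀ hE h hlim hS).mono_left hle
  have hs := isBigO_score_nullParam h hJ hloc ht K S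
  have hmle := eventually_mle_stack hE h hlim hS hρ₀
  have r₁ : ∀ᶠ x in 𝓖, (x.1 : ℝ)⁻¹ • 𝓜.score (stack (𝓓.completed x.1 x.2) S)
      (𝓔.ψhat (stack (𝓓.completed x.1 x.2) S)) = 0 := by
    filter_upwards [hmle.filter_mono hle] with x hx
    rw [hx.2.2.1, smul_zero]
  have hθ : ∀ᶠ x in 𝓖, thetaPart (𝓔.ψhat₀ (stack (𝓓.completed x.1 x.2) S)) =
      thetaPart (nullParam 𝓜 𝓣 x.1) := by
    filter_upwards [hmle.filter_mono hle] with x hx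
    rw [hx.2.2.2.1, thetaPart_nullParam]
  have r₂ : ∀ᶠ x in 𝓖, ∀ b, ((x.1 : ℝ)⁻¹ • 𝓜.score (stack (𝓓.completed x.1 x.2) S)
      (𝓔.ψhat₀ (stack (𝓓.completed x.1 x.2) S))) (Sum.inr b) = 0 := by
    filter_upwards [hmle.filter_mono hle] with x hx b
    rw [Pi.smul_apply, hx.2.2.2.2 b, smul_zero]
  have hpos : ∀ᶠ x in 𝓖, 0 < x.1 := eventually_fst_pos.filter_mono hle
  have hquad : ∀ w : Fin k → ℝ, w ⬝ᵥ (thetaInfo ((Multiset.card S : ℝ) • 𝓣.Jcom) *ᵥ w) =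
      Multiset.card S * (w ⬝ᵥ (𝓣.Icom *ᵥ w)) := fun w => by
    rw [thetaInfo_smul hc.ne', Matrix.smul_mulVec, dotProduct_smul, smul_eq_mul]
    rfl
  have hw : ∀ x : Σ n, Ω n, √(x.1 : ℝ) • (thetaPart (𝓔.ψhat (stack (𝓓.completed x.1 x.2) S)) -
      thetaPart (nullParam 𝓜 𝓣 x.1)).ofLp = wStack 𝓜 𝓔 𝓓 S x := fun x => rfl
  cases test with
  | wald =>
    have hwO : wStack 𝓜 𝓔 𝓓 S =O[𝓖] fun _ => (1 : ℝ) :=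
      hLQ.isBigO_diff hJS t₀ t₁ hs r₁
    have hVt := (tendsto_Vhat_stack hE h hlim (hV rfl) hst hprop hS).mono_left hle
    have hI' : IsUnit (𝓣.Icom⁻¹).det := by
      rw [Matrix.det_nonsing_inv]
      exact hI.ringInverse
    have t := (tendsto_dotProduct_zero hwO (tendsto_inv_sub_mulVec hI' hVt hwO)).const_mul
      (Multiset.card S : ℝ)
    rw [mul_zero, Matrix.nonsing_inv_nonsing_inv _ hI] at t
    refine t.congr' ?_
    filter_upwards [hpos] with x hx
    have hx' : (0 : ℝ) < x.1 := Nat.cast_pos.2 hx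
    rw [inv_smul_of_ne_zero (mul_pos hc hx').ne', Matrix.sub_mulVec, dotProduct_sub, mul_sub]
    congr 1
    simp only [wStack, device, Matrix.smul_mulVec, Matrix.mulVec_smul, smul_dotProduct,
      dotProduct_smul, smul_eq_mul]
    field_simp
    rw [Real.sq_sqrt hx'.le]
  | lrt =>
    have t := hLQ.tendsto_likelihoodRatio hJS t₀ t₁ t₂ hs r₁ hθ r₂
    simp only [hw, hquad] at t
    refine t.congr' ?_
    filter_upwards [hpos, hsm.filter_mono hle, hmle.filter_mono hle] with x hx hX hm
    have hx' : (0 : ℝ) < x.1 := Nat.cast_pos.2 hx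
    have hXS := SmoothLik.stack hX S
    congr 1
    rw [device, Real.log_div (hXS.pos _ hm.1).ne' (hXS.pos _ hm.2.1).ne', Real.sq_sqrt hx'.le]
    field_simp
  | score =>
    have hA := (tendsto_info_stack h S (tendsto_ψhat₀ hE h hlim hS)).mono_left hle
    have t := hLQ.tendsto_scoreStatistic hJS t₀ t₁ t₂ hs r₁ hθ r₂ hA
    simp only [hw, hquad] at t
    refine t.congr' ?_
    filter_upwards [hpos] with x hx
    have hx' : (0 : ℝ) < x.1 := Nat.cast_pos.2 hx
    congr 1
    rw [inv_smul_of_ne_zero (inv_pos.2 hx').ne']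
    simp only [device, Matrix.smul_mulVec, Matrix.mulVec_smul, smul_dotProduct,
      dotProduct_smul, smul_eq_mul, inv_inv]
    field_simp
    rw [Real.sq_sqrt hx'.le]

end DeviceExpansion

/-! ### Spectral description of the odds of missing information -/

open Polynomial in
theorem exists_perm_of_prod_X_sub_C_eq {k : ℕ} {f g : Fin k → ℝ} (hf : Antitone f)
    (h : ∏ i, (X - C (f i)) = ∏ i, (X - C (g i))) : ∃ σ : Equiv.Perm (Fin k), f = g ∘ σ := by
  refine ⟨Tuple.sort fun i => -g i, List.ofFn_injective (List.Perm.eq_of_pairwise'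
    hf.sortedGE_ofFn.pairwise (Antitone.sortedGE_ofFn ?_).pairwise ?_)⟩
  · intro a b hab
    have := Tuple.monotone_sort (fun i => -g i) hab
    simpa using this
  · refine List.Perm.trans ?_ (Equiv.Perm.ofFn_comp_perm _ g).symm
    rw [← Multiset.coe_eq_coe]
    have h1 : ∀ f : Fin k → ℝ, (∏ i, (X - C (f i))).roots = (List.ofFn f : Multiset ℝ) := fun f => by
      rw [← Fin.univ_val_map, ← roots_multiset_prod_X_sub_C (Finset.univ.val.map f),
        Multiset.map_map]
      rfl
    rw [← h1, ← h1, h]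

/-- A Schur complement of a positive definite matrix is positive semidefinite, and the determinant
formula for block matrices excludes a kernel. -/
theorem posDef_thetaInfo {k q : ℕ} {J : Matrix (Fin k ⊕ Fin q) (Fin k ⊕ Fin q) ℝ}
    (hJ : J.PosDef) : (thetaInfo J).PosDef := by
  have hD : J.toBlocks₂₂.PosDef := hJ.submatrix Sum.inr_injective
  have hB : J.toBlocks₁₂ᴴ = J.toBlocks₂₁ := by
    ext a b
    exact congrFun (congrFun hJ.isHermitian (Sum.inr a)) (Sum.inl b)
  have := hD.isUnit.invertible
  have hJ' : Matrix.fromBlocks J.toBlocks₁₁ J.toBlocks₁₂ J.toBlocks₁₂ᴴ J.toBlocks₂₂ = J := by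
    rw [hB, Matrix.fromBlocks_toBlocks]
  have h1 : (thetaInfo J).PosSemidef := by
    rw [thetaInfo, ← hB, ← Matrix.PosDef.fromBlocks₂₂ _ _ hD, hJ']
    exact hJ.posSemidef
  rw [h1.posDef_iff_det_ne_zero]
  intro h0
  refine hJ.det_pos.ne' ?_
  rw [← hJ', Matrix.det_fromBlocks₂₂, Matrix.invOf_eq_nonsing_inv, hB]
  change _ * (thetaInfo J).det = 0
  rw [h0, mul_zero]

/-- The quadratic form of `A` in a centred Gaussian vector with variance `B` is diagonal in suitable
standard Gaussian coordinates, with the roots of the characteristic polynomial of `A * B` as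
coefficients. -/
theorem exists_diagonalization {k : ℕ} {A B : Matrix (Fin k) (Fin k) ℝ} (hA : A.PosDef)
    (hB : B.PosSemidef) : ∃ lam : Fin k → ℝ, (∀ i, 0 ≤ lam i) ∧
      (A * B).charpoly = ∏ i, (Polynomial.X - Polynomial.C (lam i)) ∧
      ∀ σ : Equiv.Perm (Fin k), ∃ T : EuclideanSpace ℝ (Fin k) →L[ℝ] EuclideanSpace ℝ (Fin k),
        (stdGaussian (EuclideanSpace ℝ (Fin k))).map T = multivariateGaussian 0 B ∧
        ∀ z, (T z).ofLp ⬝ᵥ (A *ᵥ (T z).ofLp) = quadForm (lam ∘ σ) z := by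
  open scoped MatrixOrder in
  set N := CFC.sqrt B with hN
  have hNN : N * N = B := CFC.sqrt_mul_sqrt_self B hB.nonneg
  have hNH : N.IsHermitian := (Matrix.nonneg_iff_posSemidef.1 (CFC.sqrt_nonneg B)).isHermitian
  have hM : (N * A * N).PosSemidef := by
    have := hA.posSemidef.mul_mul_conjTranspose_same N
    rwa [hNH.eq] at this
  refine ⟨hM.isHermitian.eigenvalues, hM.eigenvalues_nonneg, ?_, fun σ => ?_⟩
  -- With `N` the square root of `B`, the matrices `A * N * N` and `N * A * N` have the same
  -- characteristic polynomial, and the second one is symmetric.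
  · rw [← hNN, ← mul_assoc, Matrix.charpoly_mul_comm, ← mul_assoc]
    exact hM.isHermitian.charpoly_eq
  set lam := hM.isHermitian.eigenvalues with hlam
  set b := hM.isHermitian.eigenvectorBasis with hb
  -- `U` sends the coordinates, permuted by `σ`, to the eigenbasis of `N * A * N`. As an isometry it
  -- preserves the standard Gaussian law, so `N ∘ U` still produces variance `B`.
  set U : EuclideanSpace ℝ (Fin k) ≃ₗᵢ[ℝ] EuclideanSpace ℝ (Fin k) :=
    (LinearIsometryEquiv.piLpCongrLeft 2 ℝ ℝ σ).trans b.repr.symm with hU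
  refine ⟨(Matrix.toEuclideanCLM (𝕜 := ℝ) N).comp U.toContinuousLinearEquiv.toContinuousLinearMap,
    ?_, fun z => ?_⟩
  · conv_rhs => rw [multivariateGaussian, ← stdGaussian_map U]
    rw [Measure.map_map (by fun_prop) (by fun_prop)]
    simp only [zero_add]
    rfl
  · set y : EuclideanSpace ℝ (Fin k) := LinearIsometryEquiv.piLpCongrLeft 2 ℝ ℝ σ z with hy
    have h1 : ((Matrix.toEuclideanCLM (𝕜 := ℝ) N).comp
        U.toContinuousLinearEquiv.toContinuousLinearMap z).ofLp = N *ᵥ (U z).ofLp := rfl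
    have h2 : U z = ∑ i, y i • b i := (b.sum_repr_symm y).symm
    have h3 : (N * A * N) *ᵥ (U z).ofLp =
        (b.repr.symm (WithLp.toLp 2 fun i => lam i * y i)).ofLp := by
      rw [h2, ← b.sum_repr_symm, WithLp.ofLp_sum, WithLp.ofLp_sum, Matrix.mulVec_sum]
      refine Finset.sum_congr rfl fun i _ => ?_
      rw [WithLp.ofLp_smul, WithLp.ofLp_smul, Matrix.mulVec_smul,
        hM.isHermitian.mulVec_eigenvectorBasis, smul_smul, mul_comm]
    have h4 : (N *ᵥ (U z).ofLp) ⬝ᵥ (A *ᵥ (N *ᵥ (U z).ofLp)) =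
        (U z).ofLp ⬝ᵥ ((N * A * N) *ᵥ (U z).ofLp) := by
      rw [← Matrix.mulVec_mulVec, ← Matrix.mulVec_mulVec, Matrix.dotProduct_mulVec _ N,
        ← Matrix.mulVec_transpose, ← Matrix.conjTranspose_eq_transpose_of_trivial, hNH.eq]
    have h5 : (U z).ofLp ⬝ᵥ (b.repr.symm (WithLp.toLp 2 fun i => lam i * y i)).ofLp =
        inner ℝ (b.repr.symm (WithLp.toLp 2 fun i => lam i * y i)) (b.repr.symm y) := by
      rw [EuclideanSpace.inner_eq_star_dotProduct]
      rfl
    rw [h1, h4, h3, h5, LinearIsometryEquiv.inner_map_map, quadForm, PiLp.inner_apply,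
      ← Equiv.sum_comp σ]
    refine Finset.sum_congr rfl fun i _ => ?_
    have h6 : y (σ i) = z i := by simp [hy]
    simp only [h6, RCLike.inner_apply, Function.comp_apply, conj_trivial]
    ring

theorem det_smul_add_smul_one {k : ℕ} {K : Matrix (Fin k) (Fin k) ℝ} {lam : Fin k → ℝ}
    (h : K.charpoly = ∏ i, (Polynomial.X - Polynomial.C (lam i))) {c : ℝ} (hc : c ≠ 0) (x : ℝ) :
    (c • K + x • (1 : Matrix (Fin k) (Fin k) ℝ)).det = ∏ i, (c * lam i + x) := by
  have h1 := congrArg (Polynomial.eval (-x / c)) h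
  rw [Matrix.eval_charpoly, Polynomial.eval_prod] at h1
  have h2 : c • K + x • (1 : Matrix (Fin k) (Fin k) ℝ) =
      (-c) • (Matrix.scalar (Fin k) (-x / c) - K) := by
    rw [smul_sub, Matrix.scalar_apply, ← Matrix.smul_one_eq_diagonal, smul_smul,
      show -c * (-x / c) = x by field_simp]
    module
  rw [h2, Matrix.det_smul, h1, ← Finset.card_univ, ← Finset.prod_const,
    ← Finset.prod_mul_distrib]
  refine Finset.prod_congr rfl fun i _ => ?_
  simp only [Polynomial.eval_sub, Polynomial.eval_X, Polynomial.eval_C]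
  field_simp
  ring

/-- With `B = I_obs⁻¹ - I_com⁻¹`, the eigenvalues `λ` of `I_com B` and those of
`(I_com - I_obs) I_com⁻¹` are related by `f = λ / (1 + λ)`. -/
theorem charpoly_missingFraction {k : ℕ} {A O : Matrix (Fin k) (Fin k) ℝ} (hA : IsUnit A.det)
    (hO : IsUnit O.det) {lam : Fin k → ℝ} (h0 : ∀ i, 0 ≤ lam i)
    (h : (A * (O⁻¹ - A⁻¹)).charpoly = ∏ i, (Polynomial.X - Polynomial.C (lam i))) :
    ((A - O) * A⁻¹).charpoly =
      ∏ i, (Polynomial.X - Polynomial.C (lam i / (1 + lam i))) := by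
  have h1 : ∀ i, 1 + lam i ≠ 0 := fun i => by linarith [h0 i]
  set K := A * (O⁻¹ - A⁻¹) with hK
  have hAO : A * O⁻¹ = K + 1 := by
    rw [hK, mul_sub, Matrix.mul_nonsing_inv _ hA, sub_add_cancel]
  have hOA : (K + 1) * (O * A⁻¹) = 1 := by
    rw [← hAO, mul_assoc, ← mul_assoc O⁻¹, Matrix.nonsing_inv_mul _ hO, one_mul,
      Matrix.mul_nonsing_inv _ hA]
  have hdet : (K + 1).det = ∏ i, (lam i + 1) := by
    simpa using det_smul_add_smul_one h one_ne_zero 1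
  have hdet0 : (K + 1).det ≠ 0 := by
    rw [hdet]
    exact Finset.prod_ne_zero_iff.2 fun i _ => by rw [add_comm]; exact h1 i
  -- Since `(A - O) A⁻¹ = 1 - (K + 1)⁻¹`, multiplication of `x - (A - O) A⁻¹` by `K + 1` gives `(x -
  -- 1) K + x`. Its determinant is known from the eigenvalues of `K` when `x ≠ 1`, which suffices
  -- for polynomials.
  refine Polynomial.eq_of_infinite_eval_eq _ _ ((Set.finite_singleton (1 : ℝ)).infinite_compl.mono
    fun x hx => ?_)
  have hx' : x - 1 ≠ 0 := sub_ne_zero.2 hx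
  have h2 : (K + 1) * (Matrix.scalar (Fin k) x - (A - O) * A⁻¹) =
      (x - 1) • K + x • (1 : Matrix (Fin k) (Fin k) ℝ) := by
    rw [Matrix.scalar_apply, ← Matrix.smul_one_eq_diagonal, sub_mul, Matrix.mul_nonsing_inv _ hA,
      mul_sub, mul_sub, hOA, mul_smul_comm, mul_one]
    module
  have h3 := congrArg Matrix.det h2
  rw [Matrix.det_mul, det_smul_add_smul_one h hx', hdet] at h3
  rw [Set.mem_ofPred_eq, Matrix.eval_charpoly, Polynomial.eval_prod]
  refine mul_left_cancel₀ (hdet ▸ hdet0) (h3.trans ?_)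
  rw [← Finset.prod_mul_distrib]
  refine Finset.prod_congr rfl fun i _ => ?_
  have := h1 i
  simp only [Polynomial.eval_sub, Polynomial.eval_X, Polynomial.eval_C]
  field_simp
  ring

/-- The relation `f = λ / (1 + λ)` inverts to `λ = f / (1 - f)`, so the odds are the eigenvalues of
`A * (O⁻¹ - A⁻¹)` in decreasing order. The permutation in the diagonalization brings them into that
order. -/
theorem exists_diagonalization_of_isOMI {k : ℕ} {A O : Matrix (Fin k) (Fin k) ℝ} (hA : A.PosDef)
    (hO : O.PosDef) (hB : (O⁻¹ - A⁻¹).PosSemidef) {r : Fin k → ℝ} (hr : IsOMI A O r) :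
    Antitone r ∧ (∀ a, 0 ≤ r a) ∧
      ∃ T : EuclideanSpace ℝ (Fin k) →L[ℝ] EuclideanSpace ℝ (Fin k),
        (stdGaussian (EuclideanSpace ℝ (Fin k))).map T = multivariateGaussian 0 (O⁻¹ - A⁻¹) ∧
        ∀ z, (T z).ofLp ⬝ᵥ (A *ᵥ (T z).ofLp) = quadForm r z := by
  obtain ⟨lam, h0, hlam, hT⟩ := exists_diagonalization hA hB
  obtain ⟨f, hf, hchar, hrf⟩ := hr
  rw [charpoly_missingFraction hA.det_pos.ne'.isUnit hO.det_pos.ne'.isUnit h0 hlam] at hchar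
  obtain ⟨σ, hσ⟩ := exists_perm_of_prod_X_sub_C_eq hf hchar.symm
  have hrσ : r = lam ∘ σ := by
    funext a
    have := h0 (σ a)
    rw [hrf, hσ, Function.comp_apply, Function.comp_apply]
    field_simp
    ring
  have hr0 : ∀ a, 0 ≤ r a := fun a => by rw [hrσ]; exact h0 _
  have hlt : ∀ a, f a < 1 := fun a => by
    have := h0 (σ a)
    rw [hσ, Function.comp_apply, div_lt_one (by linarith)]
    linarith
  refine ⟨fun a b hab => ?_, hr0, hrσ ▸ hT σ⟩
  have h1 := hf hab
  rw [hrf, hrf, div_le_div_iff₀ (by linarith [hlt b]) (by linarith [hlt a])]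
  nlinarith

/-! ### The limit of the stacked statistics -/

/-- Decomposition of variation: the weighted sum of two quadratic forms exceeds the form at the
weighted mean by the part between the two points. -/
theorem quadratic_weighted_mean {ι : Type*} [Fintype ι] (A : Matrix ι ι ℝ) (a b : ι → ℝ) {s t : ℝ}
    (h : s + t ≠ 0) :
    s * (a ⬝ᵥ (A *ᵥ a)) + t * (b ⬝ᵥ (A *ᵥ b)) -
      (s + t) * (((s + t)⁻¹ • (s • a + t • b)) ⬝ᵥ (A *ᵥ ((s + t)⁻¹ • (s • a + t • b)))) =
      s * t / (s + t) * ((a - b) ⬝ᵥ (A *ᵥ (a - b))) := by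
  simp only [Matrix.mulVec_smul, Matrix.mulVec_add, Matrix.mulVec_sub, dotProduct_add,
    dotProduct_sub, add_dotProduct, sub_dotProduct, smul_dotProduct, dotProduct_smul, smul_eq_mul]
  field_simp
  ring

section StackedStatistic

open Asymptotics

variable {k q p m : ℕ} {Ω : ℕ → Type*} [∀ n, MeasurableSpace (Ω n)] {P : ∀ n, Measure (Ω n)}
  {𝓜 : Model k q p} {𝓔 : Estimators k q p} {𝓣 : Truth k q} {𝓓 : MIData p m Ω}

/-- The average of the normalized errors of the estimators of `θ` in the parts of a stacked
dataset. -/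
def wMean (𝓜 : Model k q p) (𝓔 : Estimators k q p) (𝓓 : MIData p m Ω) (S : Multiset (Fin m))
    (x : Σ n, Ω n) : Fin k → ℝ :=
  (Multiset.card S : ℝ)⁻¹ • (S.map fun ℓ => wStack 𝓜 𝓔 𝓓 {ℓ} x).sum

/-- The normalized deviations of the imputed statistics from the observed-data estimator. -/
def impDev (𝓔 : Estimators k q p) (𝓓 : MIData p m Ω) (n : ℕ) (ω : Ω n) (ℓ : Fin m) :
    EuclideanSpace ℝ (Fin k) :=
  √(n : ℝ) • (thetaImp 𝓔 𝓓 n ℓ ω - thetaObs 𝓔 𝓓 n ω)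

theorem isBigO_wStack (hE : 𝓔.AreMLE 𝓜) (h : Regular 𝓜 𝓣 𝓓 P) (hJ : 𝓣.Jcom.PosDef)
    (hloc : LocalAlternatives 𝓜 𝓣) (ht : Tendsto 𝓣.ψstar atTop (𝓝 𝓣.ψlim)) (K : ℝ)
    {S : Multiset (Fin m)} (hS : S ≠ 0) :
    wStack 𝓜 𝓔 𝓓 S =O[probFilter P ⊓ 𝓟 (scoreEvent 𝓜 𝓣 𝓓 K)] fun _ => (1 : ℝ) := by
  have hlim := thetaPart_ψlim hloc ht
  have hle : probFilter P ⊓ 𝓟 (scoreEvent 𝓜 𝓣 𝓓 K) ≤ probFilter P := inf_le_left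
  refine ((locallyQuadratic_stack h hJ S).mono hle).isBigO_diff (hJ.smul (card_pos_of_ne_zero hS))
    ((tendsto_nullParam_probFilter (P := P) hloc ht).mono_left hle)
    ((tendsto_ψhat hE h hlim hS).mono_left hle) (isBigO_score_nullParam h hJ hloc ht K S) ?_
  filter_upwards [(eventually_mle_stack hE h hlim hS one_pos).filter_mono hle] with x hx
  rw [hx.2.2.1, smul_zero]

theorem tendsto_wStack_sub_wMean (hE : 𝓔.AreMLE 𝓜) (h : Regular 𝓜 𝓣 𝓓 P) (hJ : 𝓣.Jcom.PosDef)
    (hloc : LocalAlternatives 𝓜 𝓣) (ht : Tendsto 𝓣.ψstar atTop (𝓝 𝓣.ψlim))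
    {S : Multiset (Fin m)} (hS : S ≠ 0) :
    Tendsto (fun x => wStack 𝓜 𝓔 𝓓 S x - wMean 𝓜 𝓔 𝓓 S x) (probFilter P) (𝓝 0) := by
  have t := (tendsto_wStack_sub hE h hJ hloc ht hS).const_smul (Multiset.card S : ℝ)⁻¹
  rw [smul_zero] at t
  refine t.congr fun x => ?_
  rw [smul_sub, inv_smul_smul₀ (card_pos_of_ne_zero hS).ne']
  rfl

/-- Once the stacked estimator is replaced by the mean of its parts, the algebra of `THat` becomes
exact. On each score event the quadratic form is continuous enough for this replacement, since the
estimator is bounded there. -/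
theorem tendsto_device_wMean [∀ n, StandardBorelSpace (Ω n)] [∀ n, IsProbabilityMeasure (P n)]
    (hE : 𝓔.AreMLE 𝓜) (h : Regular 𝓜 𝓣 𝓓 P) (hJ : 𝓣.Jcom.PosDef)
    (hloc : LocalAlternatives 𝓜 𝓣) (ht : Tendsto 𝓣.ψstar atTop (𝓝 𝓣.ψlim)) {test : Test}
    (hV : test = Test.wald → PlugInVariance 𝓔 𝓣 𝓓 P) (hst : AreStatistics 𝓜 𝓔 𝓓 test)
    (hprop : ProperImputation 𝓔 𝓣 𝓓 P) {S : Multiset (Fin m)} (hS : S ≠ 0) :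
    Tendsto (fun x : Σ n, Ω n => device 𝓜 𝓔 test (stack (𝓓.completed x.1 x.2) S) -
      Multiset.card S * (wMean 𝓜 𝓔 𝓓 S x ⬝ᵥ (𝓣.Icom *ᵥ wMean 𝓜 𝓔 𝓓 S x))) (probFilter P)
      (𝓝 0) := by
  have t1 := tendsto_device hE h hJ (posDef_thetaInfo hJ).det_pos.ne'.isUnit hloc ht hV hst hprop hS
  have t2 : Tendsto (fun x : Σ n, Ω n =>
      wStack 𝓜 𝓔 𝓓 S x ⬝ᵥ (𝓣.Icom *ᵥ wStack 𝓜 𝓔 𝓓 S x) -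
        wMean 𝓜 𝓔 𝓓 S x ⬝ᵥ (𝓣.Icom *ᵥ wMean 𝓜 𝓔 𝓓 S x)) (probFilter P) (𝓝 0) := by
    refine tendsto_probFilter_of_scoreEvent h fun K => ?_
    have hO := isBigO_wStack hE h hJ hloc ht K hS
    have hd := (tendsto_wStack_sub_wMean hE h hJ hloc ht hS).mono_left
      (inf_le_left : probFilter P ⊓ 𝓟 (scoreEvent 𝓜 𝓣 𝓓 K) ≤ probFilter P)
    have a1 := tendsto_dotProduct_zero hO (tendsto_mulVec_zero 𝓣.Icom hd)
    have a2 := tendsto_dotProduct_zero (isBigO_one_mulVec 𝓣.Icom hO) hd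
    have a3 := tendsto_dotProduct_zero (hd.isBigO_one ℝ) (tendsto_mulVec_zero 𝓣.Icom hd)
    have a4 := (a1.add a2).sub a3
    rw [add_zero, sub_zero] at a4
    refine a4.congr fun x => ?_
    rw [dotProduct_comm (𝓣.Icom *ᵥ wStack 𝓜 𝓔 𝓓 S x)]
    simp only [Matrix.mulVec_sub, dotProduct_sub, sub_dotProduct]
    ring
  have t3 := t1.add (t2.const_mul (Multiset.card S : ℝ))
  rw [mul_zero, add_zero] at t3
  refine t3.congr fun x => ?_
  ring

theorem wMean_val (S : Finset (Fin m)) (x : Σ n, Ω n) :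
    wMean 𝓜 𝓔 𝓓 S.val x = (S.card : ℝ)⁻¹ • ∑ ℓ ∈ S, wStack 𝓜 𝓔 𝓓 {ℓ} x := rfl

theorem wMean_add {S T : Multiset (Fin m)} (hS : S ≠ 0) (hT : T ≠ 0) (x : Σ n, Ω n) :
    wMean 𝓜 𝓔 𝓓 (S + T) x = ((Multiset.card S : ℝ) + Multiset.card T)⁻¹ •
      ((Multiset.card S : ℝ) • wMean 𝓜 𝓔 𝓓 S x + (Multiset.card T : ℝ) • wMean 𝓜 𝓔 𝓓 T x) := by
  rw [wMean, wMean, wMean, smul_inv_smul₀ (card_pos_of_ne_zero hS).ne',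
    smul_inv_smul₀ (card_pos_of_ne_zero hT).ne', Multiset.card_add, Nat.cast_add,
    Multiset.map_add, Multiset.sum_add]

theorem sum_rawWeight {S : Finset (Fin m) × Finset (Fin m)} (h1 : S.1.Nonempty)
    (h2 : S.2.Nonempty) : ∑ l, rawWeight S l = 0 := by
  have c1 : (S.1.card : ℝ) ≠ 0 := by exact_mod_cast h1.card_pos.ne'
  have c2 : (S.2.card : ℝ) ≠ 0 := by exact_mod_cast h2.card_pos.ne'
  simp only [rawWeight, Finset.sum_sub_distrib, Finset.sum_ite_mem, Finset.univ_inter,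
    Finset.sum_const, nsmul_eq_mul]
  rw [mul_inv_cancel₀ c1, mul_inv_cancel₀ c2, sub_self]

/-- The raw weights sum to zero, so the shift common to all imputations drops out, and with it any
trace of the local alternative. -/
theorem wMean_sub_wMean {S : Finset (Fin m) × Finset (Fin m)} (h1 : S.1.Nonempty)
    (h2 : S.2.Nonempty) (x : Σ n, Ω n) :
    wMean 𝓜 𝓔 𝓓 S.1.val x - wMean 𝓜 𝓔 𝓓 S.2.val x =
      (∑ l, rawWeight S l • impDev 𝓔 𝓓 x.1 x.2 l).ofLp := by
  have e1 : ∀ l, wStack 𝓜 𝓔 𝓓 {l} x = (impDev 𝓔 𝓓 x.1 x.2 l).ofLp +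
      √(x.1 : ℝ) • (thetaObs 𝓔 𝓓 x.1 x.2 - 𝓜.θ₀).ofLp := fun l => by
    rw [wStack, stack_singleton, impDev, thetaImp, WithLp.ofLp_smul, ← smul_add, ← WithLp.ofLp_add,
      sub_add_sub_cancel]
  have e2 : ∀ T : Finset (Fin m), wMean 𝓜 𝓔 𝓓 T.val x =
      ∑ l, (if l ∈ T then (T.card : ℝ)⁻¹ else 0) • wStack 𝓜 𝓔 𝓓 {l} x := fun T => by
    simp only [ite_smul, zero_smul, Finset.sum_ite_mem, Finset.univ_inter]
    rw [wMean_val, Finset.smul_sum]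
  rw [e2, e2, ← Finset.sum_sub_distrib, WithLp.ofLp_sum]
  simp only [← sub_smul]
  change ∑ l, rawWeight S l • wStack 𝓜 𝓔 𝓓 {l} x = _
  simp only [e1, smul_add, Finset.sum_add_distrib, ← Finset.sum_smul]
  rw [sum_rawWeight h1 h2, zero_smul, add_zero]
  rfl

/-- The prefactor of `THat` times the constant `s t / (s + t)` of the weighted mean identity is the
inverse of the squared length of the raw weights, which normalizes them to unit weights. -/
theorem THat_eq_wMean_quadratic {S : Finset (Fin m) × Finset (Fin m)} (h1 : S.1.Nonempty)
    (h2 : S.2.Nonempty) (h : S.1 ≠ S.2) (x : Σ n, Ω n) (A : Matrix (Fin k) (Fin k) ℝ) :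
    ((S.1.card : ℝ) + S.2.card) / ((S.1.card : ℝ) + S.2.card - 2 * (S.1 ∩ S.2).card) *
      (S.1.card * (wMean 𝓜 𝓔 𝓓 S.1.val x ⬝ᵥ (A *ᵥ wMean 𝓜 𝓔 𝓓 S.1.val x)) +
        S.2.card * (wMean 𝓜 𝓔 𝓓 S.2.val x ⬝ᵥ (A *ᵥ wMean 𝓜 𝓔 𝓓 S.2.val x)) -
        ((S.1.card : ℝ) + S.2.card) * (wMean 𝓜 𝓔 𝓓 (S.1.val + S.2.val) x ⬝ᵥ
          (A *ᵥ wMean 𝓜 𝓔 𝓓 (S.1.val + S.2.val) x))) =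
      (∑ l, unitWeight S l • impDev 𝓔 𝓓 x.1 x.2 l).ofLp ⬝ᵥ
        (A *ᵥ (∑ l, unitWeight S l • impDev 𝓔 𝓓 x.1 x.2 l).ofLp) := by
  have c1 : (0 : ℝ) < S.1.card := by exact_mod_cast h1.card_pos
  have c2 : (0 : ℝ) < S.2.card := by exact_mod_cast h2.card_pos
  have c3 := card_add_card_sub_pos h
  have n1 : S.1.val ≠ 0 := fun e => h1.ne_empty (Finset.val_eq_zero.1 e)
  have n2 : S.2.val ≠ 0 := fun e => h2.ne_empty (Finset.val_eq_zero.1 e)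
  have hsum := sum_rawWeight_sq h1 h2
  have hpos := sum_rawWeight_sq_pos h1 h2 h
  have e1 : ∑ l, unitWeight S l • impDev 𝓔 𝓓 x.1 x.2 l =
      (√(∑ l, rawWeight S l ^ 2))⁻¹ • ∑ l, rawWeight S l • impDev 𝓔 𝓓 x.1 x.2 l := by
    rw [Finset.smul_sum]
    refine Finset.sum_congr rfl fun l _ => ?_
    rw [smul_smul, unitWeight, div_eq_inv_mul]
  rw [wMean_add n1 n2, Finset.card_val, Finset.card_val,
    quadratic_weighted_mean A _ _ (add_pos c1 c2).ne', wMean_sub_wMean h1 h2, e1, WithLp.ofLp_smul,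
    Matrix.mulVec_smul, smul_dotProduct, dotProduct_smul, smul_eq_mul, smul_eq_mul, ← mul_assoc,
    ← mul_assoc, ← mul_inv, Real.mul_self_sqrt hpos.le, hsum]
  congr 1
  have := c1.ne'
  have := c2.ne'
  have := c3.ne'
  have := (add_pos c1 c2).ne'
  field_simp

theorem tendsto_THat [∀ n, StandardBorelSpace (Ω n)] [∀ n, IsProbabilityMeasure (P n)]
    (hE : 𝓔.AreMLE 𝓜) (h : Regular 𝓜 𝓣 𝓓 P) (hJ : 𝓣.Jcom.PosDef)
    (hloc : LocalAlternatives 𝓜 𝓣) (ht : Tendsto 𝓣.ψstar atTop (𝓝 𝓣.ψlim)) {test : Test}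
    (hV : test = Test.wald → PlugInVariance 𝓔 𝓣 𝓓 P) (hst : AreStatistics 𝓜 𝓔 𝓓 test)
    (hprop : ProperImputation 𝓔 𝓣 𝓓 P) {S : Finset (Fin m) × Finset (Fin m)}
    (h1 : S.1.Nonempty) (h2 : S.2.Nonempty) (h12 : S.1 ≠ S.2) :
    Tendsto (fun x : Σ n, Ω n => THat (device 𝓜 𝓔 test) (𝓓.completed x.1 x.2) S.1 S.2 -
      (∑ l, unitWeight S l • impDev 𝓔 𝓓 x.1 x.2 l).ofLp ⬝ᵥ
        (𝓣.Icom *ᵥ (∑ l, unitWeight S l • impDev 𝓔 𝓓 x.1 x.2 l).ofLp)) (probFilter P) (𝓝 0) := by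
  have c1 : (S.1.card : ℝ) ≠ 0 := by exact_mod_cast h1.card_pos.ne'
  have c2 : (S.2.card : ℝ) ≠ 0 := by exact_mod_cast h2.card_pos.ne'
  have c12 : (S.1.card : ℝ) + S.2.card ≠ 0 := by positivity
  have n1 : S.1.val ≠ 0 := fun e => h1.ne_empty (Finset.val_eq_zero.1 e)
  have n2 : S.2.val ≠ 0 := fun e => h2.ne_empty (Finset.val_eq_zero.1 e)
  have n3 : S.1.val + S.2.val ≠ 0 := fun e => n1 (add_eq_zero.1 e).1
  have key := fun {T : Multiset (Fin m)} (hT : T ≠ 0) =>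
    tendsto_device_wMean hE h hJ hloc ht hV hst hprop hT
  have t := (((key n1).add (key n2)).sub (key n3)).const_mul
    (((S.1.card : ℝ) + S.2.card) / ((S.1.card : ℝ) + S.2.card - 2 * (S.1 ∩ S.2).card))
  rw [add_zero, sub_zero, mul_zero] at t
  refine t.congr fun x => ?_
  rw [← THat_eq_wMean_quadratic (𝓜 := 𝓜) h1 h2 h12, THat, dHat, dHat, dHat, Multiset.card_add,
    Nat.cast_add, Finset.card_val, Finset.card_val, mul_div_cancel₀ _ c1, mul_div_cancel₀ _ c2,
    mul_div_cancel₀ _ c12, ← mul_sub]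
  congr 1
  ring

end StackedStatistic

/-! ### Convergence of the mean squared error -/

/-- The scale `l = √(1 + ∑ x_i²)` dominates every `|x_i|`, hence also the power mean of order `τ` by
`l ^ τ`. Weighted homogeneity then bounds the squared error by second powers only, whatever `k` is.
-/
theorem sqError_powerMean_le {k : ℕ} (r : Fin k → ℝ) (j : Fin k) : ∃ C, 0 ≤ C ∧
    ∀ {ι : Type} (A : Finset ι) (x : ι → ℝ),
      sqError r j (powerMean A x) ≤ C * (1 + ∑ i ∈ A, x i ^ 2) := by
  obtain ⟨C, hC0, hC⟩ := exists_sqError_growth r j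
  refine ⟨2 * C, by positivity, fun A x => ?_⟩
  have hs : 0 ≤ ∑ i ∈ A, x i ^ 2 := Finset.sum_nonneg fun _ _ => sq_nonneg _
  set l := √(1 + ∑ i ∈ A, x i ^ 2) with hl
  have hl2 : l ^ 2 = 1 + ∑ i ∈ A, x i ^ 2 := Real.sq_sqrt (by linarith)
  have hl0 : 0 < l := Real.sqrt_pos.2 (by linarith)
  have hx : ∀ i ∈ A, |x i| ≤ l := fun i hi => by
    refine Real.abs_le_sqrt ?_
    have := Finset.single_le_sum (f := fun i => x i ^ 2) (fun i _ => sq_nonneg (x i)) hi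
    linarith
  have h1 : ∀ τ, 1 ≤ τ → τ ≤ k → |powerMean A x τ| ≤ l ^ τ := fun τ _ _ => by
    rw [powerMean, abs_mul, abs_inv, Nat.abs_cast]
    rcases A.eq_empty_or_nonempty with rfl | hA
    · simpa using pow_nonneg hl0.le τ
    · rw [inv_mul_le_iff₀ (by exact_mod_cast hA.card_pos), ← nsmul_eq_mul]
      refine (Finset.abs_sum_le_sum_abs _ _).trans (Finset.sum_le_card_nsmul _ _ _ fun i hi => ?_)
      rw [abs_pow]
      exact pow_le_pow_left₀ (abs_nonneg _) (hx i hi) τ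
  have h2 := hC (powerMean A x) l hl0 h1
  rw [hl2] at h2
  nlinarith

theorem continuous_powerMean {ι : Type*} (A : Finset ι) :
    Continuous fun x : ι → ℝ => powerMean A x := by
  refine continuous_pi fun τ => ?_
  unfold powerMean
  fun_prop

theorem powerMean_univ_coe {ι : Type*} (A : Finset ι) (x : ι → ℝ) :
    powerMean Finset.univ (fun i : A => x i) = powerMean A x := by
  funext τ
  rw [powerMean, powerMean, Finset.card_univ, Fintype.card_coe,
    Finset.sum_coe_sort A fun i => x i ^ τ]

section Main

variable {k q p m : ℕ} {Ω : ℕ → Type*} [mΩ : ∀ n, MeasurableSpace (Ω n)]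
  {P : ∀ n, Measure (Ω n)} [∀ n, IsProbabilityMeasure (P n)]
  {𝓜 : Model k q p} {𝓔 : Estimators k q p} {𝓣 : Truth k q} {𝓓 : MIData p m Ω}

theorem measurable_impDev {test : Test} (hst : AreStatistics 𝓜 𝓔 𝓓 test) (n : ℕ) :
    Measurable (impDev 𝓔 𝓓 n) :=
  measurable_pi_lambda _ fun ℓ => ((hst.thetaImp n ℓ).sub
    ((hst.thetaObs n).mono (𝓓.sigmaObs_le n) le_rfl)).const_smul (√(n : ℝ))

theorem measurable_THat {test : Test} (hst : AreStatistics 𝓜 𝓔 𝓓 test) (n : ℕ)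
    {S₁ S₂ : Finset (Fin m)} (h1 : S₁.Nonempty) (h2 : S₂.Nonempty) :
    Measurable fun ω => THat (device 𝓜 𝓔 test) (𝓓.completed n ω) S₁ S₂ := by
  have n1 : S₁.val ≠ 0 := fun e => h1.ne_empty (Finset.val_eq_zero.1 e)
  have n2 : S₂.val ≠ 0 := fun e => h2.ne_empty (Finset.val_eq_zero.1 e)
  have n3 : S₁.val + S₂.val ≠ 0 := fun e => n1 (add_eq_zero.1 e).1
  have key := fun {T : Multiset (Fin m)} (hT : T ≠ 0) =>
    (hst.device T hT n).div_const (Multiset.card T : ℝ)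
  exact ((((key n1).const_mul _).add ((key n2).const_mul _)).sub ((key n3).const_mul _)).const_mul _

theorem tendsto_integral_impDev [∀ n, StandardBorelSpace (Ω n)] {test : Test} (hst : AreStatistics 𝓜 𝓔 𝓓 test)
    (hprop : ProperImputation 𝓔 𝓣 𝓓 P) (g : (Fin m → EuclideanSpace ℝ (Fin k)) →ᵇ ℝ) :
    Tendsto (fun n => ∫ ω, g (impDev 𝓔 𝓓 n ω) ∂(P n)) atTop (𝓝 (∫ z, g z
      ∂(Measure.pi fun _ : Fin m => multivariateGaussian 0 (𝓣.Iobs⁻¹ - 𝓣.Icom⁻¹)))) :=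
  tendsto_integral_of_iCondIndepFun (σ := fun n => 𝓓.sigmaObs n) (fun n => 𝓓.sigmaObs_le n)
    (X := thetaImp 𝓔 𝓓) (fun n ℓ => hst.thetaImp n ℓ)
    (fun n => Kernel.iIndepFun.comp (hprop.condIndep n) (fun _ => Prod.fst)
      fun _ => measurable_fst)
    (fun n => hst.thetaObs n) (fun n => √(n : ℝ)) hprop.condNormal g

theorem tendsto_mse [∀ n, StandardBorelSpace (Ω n)] (hE : 𝓔.AreMLE 𝓜) (hgen : Generated 𝓜 𝓣 𝓓 P) (h : Regular 𝓜 𝓣 𝓓 P)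
    (hloc : LocalAlternatives 𝓜 𝓣) {test : Test}
    (hV : test = Test.wald → PlugInVariance 𝓔 𝓣 𝓓 P) (hst : AreStatistics 𝓜 𝓔 𝓓 test)
    (hprop : ProperImputation 𝓔 𝓣 𝓓 P) (hui : UniformlyIntegrable 𝓜 𝓔 𝓓 P test)
    {r : Fin k → ℝ} (hr : IsOMI 𝓣.Icom 𝓣.Iobs r) (hm : 2 ≤ m) (rule : SelectionRule) (j : Fin k) :
    (∀ᶠ n : ℕ in atTop, Integrable (fun ω =>
      (rHat k (device 𝓜 𝓔 test) (𝓓.completed n ω) (rule.pairs m) j - r j) ^ 2) (P n)) ∧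
    Tendsto (fun n : ℕ => ∫ ω,
      (rHat k (device 𝓜 𝓔 test) (𝓓.completed n ω) (rule.pairs m) j - r j) ^ 2 ∂(P n)) atTop
      (𝓝 (limMSE r rule j m)) := by
  have hA : 𝓣.Icom.PosDef := posDef_thetaInfo hgen.posDef_com
  have hO : 𝓣.Iobs.PosDef := posDef_thetaInfo hgen.posDef_obs
  obtain ⟨-, -, T, hT, hTq⟩ := exists_diagonalization_of_isOMI hA hO hprop.posSemidef hr
  have hpairs : ∀ S : rule.pairs m, S.1.1.Nonempty ∧ S.1.2.Nonempty ∧ S.1.1 ≠ S.1.2 :=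
    fun S => rule.mem_pairs hm S.2
  set X : ∀ n, Ω n → rule.pairs m → ℝ := fun n ω S =>
    THat (device 𝓜 𝓔 test) (𝓓.completed n ω) S.1.1 S.1.2 with hX
  set Φ : (Fin m → EuclideanSpace ℝ (Fin k)) → rule.pairs m → ℝ := fun z S =>
    (∑ l, unitWeight S.1 l • z l).ofLp ⬝ᵥ (𝓣.Icom *ᵥ (∑ l, unitWeight S.1 l • z l).ofLp) with hΦ
  have hΦc : Continuous Φ := by
    refine continuous_pi fun S => ?_
    have h1 : Continuous fun z : Fin m → EuclideanSpace ℝ (Fin k) =>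
        (∑ l, unitWeight S.1 l • z l).ofLp :=
      (PiLp.continuous_ofLp 2 _).comp (by fun_prop)
    exact h1.dotProduct (Continuous.matrix_mulVec continuous_const h1)
  set Λ : (Fin m → EuclideanSpace ℝ (Fin k)) → rule.pairs m → ℝ := fun z S => limStat r S.1 z
    with hΛ
  have hΛc : Continuous Λ := continuous_pi fun S => (polyGrowth_limStat r S.1).1
  -- The diagonalizing map `T` commutes with linear combinations, so one `T` diagonalizes the forms
  -- of all pairs at once and the joint law of the limits is described by the same standard Gaussian
  -- vectors.
  have hΦΛ : ∀ z, Φ (fun l => T (z l)) = Λ z := fun z => by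
    funext S
    simp only [hΦ, hΛ, limStat, ← map_smul, ← map_sum]
    exact hTq _
  set ν := (stdGaussians (Fin m) k).map Λ with hν
  have : IsProbabilityMeasure ν := Measure.isProbabilityMeasure_map hΛc.measurable.aemeasurable
  have hpi : (stdGaussians (Fin m) k).map (fun z l => T (z l)) =
      Measure.pi fun _ : Fin m => multivariateGaussian 0 (𝓣.Iobs⁻¹ - 𝓣.Icom⁻¹) := by
    have : ∀ _ : Fin m, SigmaFinite ((stdGaussian (EuclideanSpace ℝ (Fin k))).map T) := fun _ => by
      rw [hT]
      infer_instance
    rw [stdGaussians, Measure.pi_map_pi fun _ => T.continuous.aemeasurable]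
    simp only [hT]
  have hXm : ∀ n, Measurable (X n) := fun n => measurable_pi_lambda _ fun S =>
    measurable_THat hst n (hpairs S).1 (hpairs S).2.1
  have hZ := fun n => measurable_impDev hst n
  have hlimY : ∀ g : (rule.pairs m → ℝ) →ᵇ ℝ, Tendsto (fun n =>
      ∫ ω, g (Φ (impDev 𝓔 𝓓 n ω)) ∂(P n)) atTop (𝓝 (∫ x, g x ∂ν)) := by
    intro g
    have t := tendsto_integral_impDev hst hprop (g.compContinuous ⟨Φ, hΦc⟩)
    have hTc : Continuous fun (z : Fin m → EuclideanSpace ℝ (Fin k)) l => T (z l) := by fun_prop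
    rw [← hpi, integral_map hTc.measurable.aemeasurable
      (BoundedContinuousFunction.continuous _).aestronglyMeasurable] at t
    rw [hν, integral_map hΛc.measurable.aemeasurable g.continuous.aestronglyMeasurable]
    simp only [BoundedContinuousFunction.compContinuous_apply, ContinuousMap.coe_mk, hΦΛ] at t
    exact t
  have hdist : Tendsto (fun x : Σ n, Ω n => dist (X x.1 x.2) (Φ (impDev 𝓔 𝓓 x.1 x.2)))
      (probFilter P) (𝓝 0) := by
    have t : Tendsto (fun x : Σ n, Ω n => X x.1 x.2 - Φ (impDev 𝓔 𝓓 x.1 x.2)) (probFilter P)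
        (𝓝 0) := tendsto_pi_nhds.2 fun S =>
      tendsto_THat hE h hgen.posDef_com hloc hgen.tendsto_ψstar hV hst hprop (hpairs S).1
        (hpairs S).2.1 (hpairs S).2.2
    simpa [dist_eq_norm] using t.norm
  have hlim := fun g => tendsto_integral_of_tendsto_dist hXm (fun n => hΦc.measurable.comp (hZ n))
    hlimY hdist g
  obtain ⟨C, hC0, hC⟩ := sqError_powerMean_le r j
  have hh : Continuous fun x : rule.pairs m → ℝ => sqError r j (powerMean Finset.univ x) :=
    (continuous_sqError r j).comp (continuous_powerMean _)
  have hint : Integrable (fun x : rule.pairs m → ℝ => sqError r j (powerMean Finset.univ x)) ν := by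
    rw [hν, integrable_map_measure hh.aestronglyMeasurable hΛc.measurable.aemeasurable]
    have hb : PolyGrowth fun z : Fin m → EuclideanSpace ℝ (Fin k) =>
        C * (1 + ∑ S : rule.pairs m, limStat r S.1 z ^ 2) :=
      (PolyGrowth.const C).mul ((PolyGrowth.const 1).add
        (PolyGrowth.sum _ fun S _ => (polyGrowth_limStat r S.1).pow 2))
    refine (hb.integrable (stdGaussians (Fin m) k)).mono' (hh.comp hΛc).aestronglyMeasurable
      (ae_of_all _ fun z => ?_)
    rw [Function.comp_apply, Real.norm_of_nonneg (sqError_nonneg _ _ _)]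
    exact hC _ _
  have hk : 1 ≤ k := by
    have := j.2
    omega
  -- The squared error grows quadratically in the stacked statistics, so uniform integrability is
  -- invoked for `τ = 1`; the index `j : Fin k` ensures that `1 ≤ k`.
  have hfin := tendsto_integral_of_uniformlyIntegrable hXm hlim (A := Finset.univ)
    (fun S _ ε hε => hui S.1.1 S.1.2 (hpairs S).1 (hpairs S).2.1 (hpairs S).2.2 1
      (Finset.mem_Icc.2 ⟨le_rfl, hk⟩) ε hε) hh (fun x => sqError_nonneg _ _ _) hC0
    (fun x => hC _ x) hint
  have e1 : ∀ n ω, sqError r j (powerMean Finset.univ (X n ω)) =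
      (rHat k (device 𝓜 𝓔 test) (𝓓.completed n ω) (rule.pairs m) j - r j) ^ 2 := fun n ω => by
    rw [hX, powerMean_univ_coe (rule.pairs m)
      fun S => THat (device 𝓜 𝓔 test) (𝓓.completed n ω) S.1 S.2]
    rfl
  have e2 : ∫ x, sqError r j (powerMean Finset.univ x) ∂ν = limMSE r rule j m := by
    rw [hν, integral_map hΛc.measurable.aemeasurable hh.aestronglyMeasurable, limMSE]
    refine integral_congr_ae (ae_of_all _ fun z => ?_)
    simp only [hΛ]
    rw [powerMean_univ_coe (rule.pairs m) fun S => limStat r S z]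
  rw [e2] at hfin
  simpa only [e1] using hfin

end Main

end

end StackedMI

theorem mainTheorem6 {k : ℕ} (r : Fin k → ℝ) (rule : StackedMI.SelectionRule) (j : Fin k) :
    ∃ V : ℕ → ℝ, Tendsto V atTop (𝓝 0) ∧
      ∀ (m : ℕ), 2 ≤ m → ∀ (q p : ℕ) (𝓜 : StackedMI.Model k q p) (𝓔 : StackedMI.Estimators k q p)
        (𝓣 : StackedMI.Truth k q) (test : StackedMI.Test)
        (Ω : ℕ → Type*) [∀ n, MeasurableSpace (Ω n)] [∀ n, StandardBorelSpace (Ω n)]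
        (P : ∀ n, Measure (Ω n)) [∀ n, IsProbabilityMeasure (P n)]
        (𝓓 : StackedMI.MIData p m Ω),
        𝓔.AreMLE 𝓜 →
        StackedMI.Generated 𝓜 𝓣 𝓓 P →
        StackedMI.LocalAlternatives 𝓜 𝓣 →
        StackedMI.Regular 𝓜 𝓣 𝓓 P →
        (test = StackedMI.Test.wald → StackedMI.PlugInVariance 𝓔 𝓣 𝓓 P) →
        StackedMI.AreStatistics 𝓜 𝓔 𝓓 test →
        StackedMI.ObsNormality 𝓔 𝓣 𝓓 P →
        StackedMI.ProperImputation 𝓔 𝓣 𝓓 P →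
        StackedMI.UniformlyIntegrable 𝓜 𝓔 𝓓 P test →
        StackedMI.IsOMI 𝓣.Icom 𝓣.Iobs r →
        (∀ᶠ n : ℕ in atTop, Integrable (fun ω =>
          (StackedMI.rHat k (StackedMI.device 𝓜 𝓔 test) (𝓓.completed n ω) (rule.pairs m) j
            - r j) ^ 2) (P n)) ∧
        Tendsto (fun n : ℕ => ∫ ω,
          (StackedMI.rHat k (StackedMI.device 𝓜 𝓔 test) (𝓓.completed n ω) (rule.pairs m) j
            - r j) ^ 2 ∂(P n)) atTop (𝓝 (V m)) := by
  classical
  -- The function is chosen before the model. If `r` is not decreasing and nonnegative, no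
  -- admissible model has it as its odds of missing information, and the value `0` serves.
  refine ⟨fun m => if Antitone r ∧ ∀ a, 0 ≤ r a then StackedMI.limMSE r rule j m else 0, ?_, ?_⟩
  · split_ifs with h
    · exact StackedMI.tendsto_limMSE h.1 h.2 rule j
    · exact tendsto_const_nhds
  · intro m hm q p 𝓜 𝓔 𝓣 test Ω _ _ P _ 𝓓 hE hgen hloc hreg hV hst _ hprop hui hr
    obtain ⟨h1, h2, -⟩ := StackedMI.exists_diagonalization_of_isOMI
      (StackedMI.posDef_thetaInfo hgen.posDef_com) (StackedMI.posDef_thetaInfo hgen.posDef_obs)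
      hprop.posSemidef hr
    simp only [if_pos (And.intro h1 h2)]
    exact StackedMI.tendsto_mse hE hgen hreg hloc hV hst hprop hui hr hm rule j
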